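/- Let $\Omega\subset\mathbb R^2$ be an open connected set (bounded or exterior) whose boundary is compact and $C^\infty$ smooth, i.e. a disjoint union of finitely many smoothly embedded closed curves with $\Omega$ on one side of each of them. Let $\nu$ be the unit outward normal, let the boundary components be parametrized by arc-length $s$ with unit tangent $T$, and let $\kappa$ be the curvature, $T'(s)=-\kappa(s)\nu(s)$ (so that a disc of radius $R$ has $\kappa=1/R$). Assume that $\kappa$ attains its maximum $\kappa_{\max}$ over $\partial\Omega$ at a unique point, that the parameter of this point on its component is $s=0$, so $\kappa_{\max}=\kappa(0)$, and that the maximum is non-degenerate, $\kappa''(0)<0$. For $h>0$ let $\mathcal L_h=-h^2\Delta$ in $L^2(\Omega)$ with domain $$D(\mathcal L_h)=\{u\in H^2(\Omega):\ h^{1/2}\,\nu\cdot\nabla u-u=0\ \text{ on }\partial\Omega\},$$ and for $j\ge 1$ let $$\mu_j(\mathcal L_h)=\inf_{\substack{V\subset D(\mathcal L_h)\\ \dim V=j}}\ \sup_{0\ne u\in V}\frac{\langle \mathcal L_hu,u\rangle}{\|u\|^2}$$ be its min-max values. **Theorem.** Let $n\in\mathbb N$. There exist constants $h_n\in(0,1)$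 and $C_n>0$ and functions $r_j$ such that, for all $j\in\{1,\dots,n\}$ and all $h\in(0,h_n)$, $$\mu_j(\mathcal L_h)\le -h-\kappa_{\max}h^{3/2}+(2j-1)\sqrt{\frac{-\kappa''(0)}{2}}\;h^{7/4}+r_j(h),\qquad |r_j(h)|\le C_n h^{15/8}.$$ -/

import Mathlib

open MeasureTheory Filter Set
open scoped ContDiff Topology

noncomputable section

namespace RobinPlane

/-- The Euclidean plane `ℝ²`. -/
abbrev Plane := EuclideanSpace ℝ (Fin 2)

/-- Rotation of a vector of the plane by `+π/2`, so that `det (v, rot v) = ‖v‖²`. -/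
def rot (v : Plane) : Plane := !₂[-(v 1), v 0]

/-- The (classical) partial derivative `∂_i f`. -/
def pd {E : Type*} [NormedAddCommGroup E] [NormedSpace ℝ E] (i : Fin 2) (f : Plane → E) (x : Plane) : E :=
  fderiv ℝ f x (EuclideanSpace.single i 1)

/-- A planar domain (open and connected, bounded or not) whose boundary is compact and smooth:
the boundary is the disjoint union of finitely many smoothly embedded closed curves, each
parametrized by arc-length, and the domain lies on the left of each of them. -/
structure SmoothDomain where
  /-- the domain `Ω` -/
  Ω : Set Plane
  isOpen : IsOpen Ω
  isConnected : IsConnected Ω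
  /-- the number of connected components of the boundary -/
  m : ℕ
  /-- the length of each boundary component -/
  len : Fin m → ℝ
  len_pos : ∀ c, 0 < len c
  /-- the arc-length parametrization of each boundary component -/
  M : Fin m → ℝ → Plane
  smooth : ∀ c, ContDiff ℝ ∞ (M c)
  unit_speed : ∀ c s, ‖deriv (M c) s‖ = 1
  periodic : ∀ c s, M c (s + len c) = M c s
  embedded : ∀ c c' s s', M c s = M c' s' → c = c' ∧ ∃ k : ℤ, s' = s + k * len c
  frontier_eq : frontier Ω = ⋃ c, range (M c)
  /-- the left normal points into `Ω`, its opposite points out of `Ω` -/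
  one_sided : ∀ c s, ∀ᶠ t in 𝓝[>] (0 : ℝ),
    M c s + t • rot (deriv (M c) s) ∈ Ω ∧ M c s - t • rot (deriv (M c) s) ∉ Ω

namespace SmoothDomain

variable (D : SmoothDomain)

/-- The unit outward normal at the boundary point `M c s`. -/
def normal (c : Fin D.m) (s : ℝ) : Plane := -rot (deriv (D.M c) s)

/-- The curvature `κ` of the boundary at `M c s` as a function of arc-length: `T' = -κ ν` with `T`
the unit tangent and `ν` the outward normal, so that a disc of radius `R` has curvature `1 / R`. -/
def curvature (c : Fin D.m) (s : ℝ) : ℝ :=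
  inner ℝ (deriv (deriv (D.M c)) s) (-D.normal c s)

/-- The curvature attains its maximum over the whole boundary at a unique boundary point,
namely the point of arc-length parameter `0` on the component `c₀`, and this maximum is
non-degenerate. -/
structure UniqueNondegenerateMax (c₀ : Fin D.m) : Prop where
  is_max : ∀ c s, D.curvature c s ≤ D.curvature c₀ 0
  unique : ∀ c s, D.curvature c s = D.curvature c₀ 0 → D.M c s = D.M c₀ 0
  nondegenerate : iteratedDeriv 2 (D.curvature c₀) 0 < 0

/-- Lebesgue measure on `Ω`. -/
abbrev vol : Measure Plane := volume.restrict D.Ω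

/-- Arc-length measure on one period of the parameter of a boundary component. -/
abbrev bdry (c : Fin D.m) : Measure ℝ := volume.restrict (Ioc 0 (D.len c))

/-- The complex Hilbert space `L²(Ω)`. -/
abbrev L2 := Lp ℂ 2 D.vol

/-- `v` is the weak partial derivative `∂_i u` in `Ω`. -/
def HasWeakDeriv (i : Fin 2) (u v : D.L2) : Prop :=
  ∀ φ : Plane → ℝ, ContDiff ℝ ∞ φ → HasCompactSupport φ → tsupport φ ⊆ D.Ω →
    ∫ x in D.Ω, pd i φ x • u x = -∫ x in D.Ω, φ x • v x

/-- `g` is the trace on the boundary (a square integrable function of arc-length on each component)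
of the function `u ∈ H¹(Ω)` with weak gradient `v`: there are smooth compactly supported
functions on the plane that tend to `u` in `H¹(Ω)` and whose restrictions to the boundary
tend to `g` in `L²(∂Ω)`. -/
def HasTrace (u : D.L2) (v : Fin 2 → D.L2) (g : Fin D.m → ℝ → ℂ) : Prop :=
  (∀ c, MemLp (g c) 2 (D.bdry c)) ∧
  ∃ φ : ℕ → Plane → ℂ,
    (∀ k, ContDiff ℝ ∞ (φ k) ∧ HasCompactSupport (φ k)) ∧
    Tendsto (fun k => eLpNorm (fun x => φ k x - u x) 2 D.vol) atTop (𝓝 0) ∧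
    (∀ i, Tendsto (fun k => eLpNorm (fun x => pd i (φ k) x - v i x) 2 D.vol) atTop (𝓝 0)) ∧
    (∀ c, Tendsto (fun k => eLpNorm (fun s => φ k (D.M c s) - g c s) 2 (D.bdry c)) atTop (𝓝 0))

/-- `u ∈ H²(Ω)` satisfies `h^{1/2} ν·∇u - u = 0` on the boundary in the sense of traces,
and `f = -h² Δu`. Here `v`, `w` are the first and second weak derivatives of `u`, and
`g`, `d` are the traces of `u` and of its first derivatives. -/
def IsRobinPair (h : ℝ) (u f : D.L2) : Prop :=
  ∃ (v : Fin 2 → D.L2) (w : Fin 2 → Fin 2 → D.L2)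
    (g : Fin D.m → ℝ → ℂ) (d : Fin 2 → Fin D.m → ℝ → ℂ),
    (∀ i, D.HasWeakDeriv i u (v i)) ∧
    (∀ i j, D.HasWeakDeriv j (v i) (w i j)) ∧
    D.HasTrace u v g ∧
    (∀ i, D.HasTrace (v i) (w i) (d i)) ∧
    (∀ c, ∀ᵐ s ∂D.bdry c, (√h : ℂ) * ∑ i, (D.normal c s i : ℂ) * d i c s - g c s = 0) ∧
    f = (-(h : ℂ) ^ 2) • ∑ i, w i i

variable {D}

theorem pd_smooth {E : Type*} [NormedAddCommGroup E] [NormedSpace ℝ E] {φ : Plane → E}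
    (hφ : ContDiff ℝ ∞ φ) (i : Fin 2) : Continuous (pd i φ) :=
  (hφ.continuous_fderiv (by simp)).clm_apply continuous_const

theorem pd_compact {E : Type*} [NormedAddCommGroup E] [NormedSpace ℝ E] {φ : Plane → E}
    (hc : HasCompactSupport φ) (i : Fin 2) : HasCompactSupport (pd i φ) := by
  refine (hc.fderiv (𝕜 := ℝ)).mono ?_
  intro x hx h0
  exact hx (by simp [pd, h0])

theorem integrable_test {φ : Plane → ℝ} (hφ : Continuous φ) (hc : HasCompactSupport φ)
    (u : D.L2) : Integrable (fun x => φ x • u x) D.vol :=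
  memLp_one_iff_integrable.1 ((Lp.memLp u).smul (r := 1)
    ((hφ.memLp_of_hasCompactSupport (p := 2) (μ := volume) hc).restrict D.Ω))

theorem HasWeakDeriv.add {i : Fin 2} {u v u' v' : D.L2} (h : D.HasWeakDeriv i u v)
    (h' : D.HasWeakDeriv i u' v') : D.HasWeakDeriv i (u + u') (v + v') := by
  intro φ hφ hc hs
  have e1 : ∫ x in D.Ω, pd i φ x • (u + u' : D.L2) x
      = (∫ x in D.Ω, pd i φ x • u x) + ∫ x in D.Ω, pd i φ x • u' x := by
    rw [← integral_add (integrable_test (pd_smooth hφ i) (pd_compact hc i) u)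
      (integrable_test (pd_smooth hφ i) (pd_compact hc i) u')]
    refine integral_congr_ae ?_
    filter_upwards [Lp.coeFn_add u u'] with x hx
    rw [hx, Pi.add_apply, smul_add]
  have e2 : ∫ x in D.Ω, φ x • (v + v' : D.L2) x
      = (∫ x in D.Ω, φ x • v x) + ∫ x in D.Ω, φ x • v' x := by
    rw [← integral_add (integrable_test hφ.continuous hc v)
      (integrable_test hφ.continuous hc v')]
    refine integral_congr_ae ?_
    filter_upwards [Lp.coeFn_add v v'] with x hx
    rw [hx, Pi.add_apply, smul_add]
  rw [e1, e2, h φ hφ hc hs, h' φ hφ hc hs]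
  ring

theorem HasWeakDeriv.smul {i : Fin 2} {u v : D.L2} (a : ℂ) (h : D.HasWeakDeriv i u v) :
    D.HasWeakDeriv i (a • u) (a • v) := by
  intro φ hφ hc hs
  have key : ∀ (ψ : Plane → ℝ) (w : D.L2),
      ∫ x in D.Ω, ψ x • (a • w : D.L2) x = a * ∫ x in D.Ω, ψ x • w x := by
    intro ψ w
    rw [← integral_const_mul]
    refine integral_congr_ae ?_
    filter_upwards [Lp.coeFn_smul a w] with x hx
    rw [hx, Pi.smul_apply, smul_eq_mul, Complex.real_smul, Complex.real_smul]
    ring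
  rw [key, key, h φ hφ hc hs]
  ring

/-- A weak derivative of the zero function vanishes. -/
theorem HasWeakDeriv.eq_zero {i : Fin 2} {v : D.L2} (h : D.HasWeakDeriv i 0 v) : v = 0 := by
  have hv : ∀ᵐ x ∂volume, x ∈ D.Ω → v x = 0 := by
    refine D.isOpen.ae_eq_zero_of_integral_contDiff_smul_eq_zero ?_ ?_
    · rw [locallyIntegrableOn_iff D.isOpen.isLocallyClosed]
      intro K hK hKc
      have := ((Lp.memLp v).locallyIntegrable (by norm_num)).integrableOn_isCompact hKc
      rwa [IntegrableOn, Measure.restrict_restrict_of_subset hK] at this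
    · intro φ hφ hc hs
      have h1 := h φ hφ hc hs
      have h2 : ∫ x in D.Ω, pd i φ x • (0 : D.L2) x = 0 := by
        rw [← integral_zero Plane ℂ (μ := D.vol)]
        refine integral_congr_ae ?_
        filter_upwards [Lp.coeFn_zero ℂ 2 D.vol] with x hx
        rw [hx, Pi.zero_apply, smul_zero]
      rw [h2] at h1
      rw [← setIntegral_eq_integral_of_forall_compl_eq_zero (s := D.Ω)]
      · exact neg_eq_zero.mp h1.symm
      · intro x hx
        rw [image_eq_zero_of_notMem_tsupport (fun hx' => hx (hs hx')), zero_smul]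
  rw [Lp.eq_zero_iff_ae_eq_zero]
  exact (ae_restrict_iff' D.isOpen.measurableSet).2 hv

theorem tendsto_eLpNorm_add {α : Type*} [MeasurableSpace α] {μ : Measure α}
    {f f' F : ℕ → α → ℂ}
    (hf : ∀ k, AEStronglyMeasurable (f k) μ) (hf' : ∀ k, AEStronglyMeasurable (f' k) μ)
    (h : Tendsto (fun k => eLpNorm (f k) 2 μ) atTop (𝓝 0))
    (h' : Tendsto (fun k => eLpNorm (f' k) 2 μ) atTop (𝓝 0))
    (hF : ∀ k, F k =ᵐ[μ] f k + f' k) :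
    Tendsto (fun k => eLpNorm (F k) 2 μ) atTop (𝓝 0) := by
  refine tendsto_of_tendsto_of_tendsto_of_le_of_le tendsto_const_nhds
    (by simpa using h.add h') (fun _ => zero_le) (fun k => ?_)
  simp only [eLpNorm_congr_ae (hF k)]
  exact eLpNorm_add_le (hf k) (hf' k) (by norm_num)

theorem tendsto_eLpNorm_smul {α : Type*} [MeasurableSpace α] {μ : Measure α}
    {f F : ℕ → α → ℂ} (a : ℂ) (h : Tendsto (fun k => eLpNorm (f k) 2 μ) atTop (𝓝 0))
    (hF : ∀ k, F k =ᵐ[μ] a • f k) :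
    Tendsto (fun k => eLpNorm (F k) 2 μ) atTop (𝓝 0) := by
  have h1 := ENNReal.Tendsto.const_mul (a := ‖a‖ₑ) h (Or.inr enorm_ne_top)
  rw [mul_zero] at h1
  refine h1.congr (fun k => ?_)
  rw [eLpNorm_congr_ae (hF k), eLpNorm_const_smul]

theorem HasTrace.add {u u' : D.L2} {v v' : Fin 2 → D.L2} {g g' : Fin D.m → ℝ → ℂ}
    (h : D.HasTrace u v g) (h' : D.HasTrace u' v' g') :
    D.HasTrace (u + u') (v + v') (g + g') := by
  obtain ⟨hg, φ, hφ, h1, h2, h3⟩ := h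
  obtain ⟨hg', φ', hφ', h1', h2', h3'⟩ := h'
  refine ⟨fun c => (hg c).add (hg' c), fun k => φ k + φ' k,
    fun k => ⟨(hφ k).1.add (hφ' k).1, (hφ k).2.add (hφ' k).2⟩, ?_, fun i => ?_, fun c => ?_⟩
  · refine tendsto_eLpNorm_add
      (fun k => (hφ k).1.continuous.aestronglyMeasurable.sub (Lp.aestronglyMeasurable u))
      (fun k => (hφ' k).1.continuous.aestronglyMeasurable.sub (Lp.aestronglyMeasurable u'))
      h1 h1' (fun k => ?_)
    filter_upwards [Lp.coeFn_add u u'] with x hx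
    simp only [hx, Pi.add_apply, Pi.sub_apply]
    ring
  · refine tendsto_eLpNorm_add
      (fun k => (pd_smooth (hφ k).1 i).aestronglyMeasurable.sub (Lp.aestronglyMeasurable (v i)))
      (fun k => (pd_smooth (hφ' k).1 i).aestronglyMeasurable.sub (Lp.aestronglyMeasurable (v' i)))
      (h2 i) (h2' i) (fun k => ?_)
    filter_upwards [Lp.coeFn_add (v i) (v' i)] with x hx
    have e : pd i (φ k + φ' k) x = pd i (φ k) x + pd i (φ' k) x := by
      simp only [pd]
      rw [fderiv_add ((hφ k).1.differentiable (by simp) x)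
        ((hφ' k).1.differentiable (by simp) x)]
      rfl
    simp only [Pi.add_apply, Pi.sub_apply] at hx ⊢
    rw [hx, e]
    ring
  · refine tendsto_eLpNorm_add
      (fun k => ((hφ k).1.continuous.comp (D.smooth c).continuous).aestronglyMeasurable.sub
        (hg c).1)
      (fun k => ((hφ' k).1.continuous.comp (D.smooth c).continuous).aestronglyMeasurable.sub
        (hg' c).1)
      (h3 c) (h3' c) (fun k => ?_)
    refine Eventually.of_forall fun s => ?_
    simp only [Pi.add_apply, Pi.sub_apply, Function.comp_apply]
    ring

theorem HasTrace.smul {u : D.L2} {v : Fin 2 → D.L2} {g : Fin D.m → ℝ → ℂ} (a : ℂ)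
    (h : D.HasTrace u v g) : D.HasTrace (a • u) (a • v) (a • g) := by
  obtain ⟨hg, φ, hφ, h1, h2, h3⟩ := h
  refine ⟨fun c => (hg c).const_smul a, fun k => a • φ k,
    fun k => ⟨(hφ k).1.const_smul a, (hφ k).2.smul_left (f := fun _ => a)⟩, ?_, fun i => ?_,
    fun c => ?_⟩
  · refine tendsto_eLpNorm_smul a h1 (fun k => ?_)
    filter_upwards [Lp.coeFn_smul a u] with x hx
    simp only [hx, Pi.smul_apply, smul_eq_mul]
    ring
  · refine tendsto_eLpNorm_smul a (h2 i) (fun k => ?_)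
    filter_upwards [Lp.coeFn_smul a (v i)] with x hx
    have e : pd i (a • φ k) x = a * pd i (φ k) x := by
      simp only [pd]
      rw [fderiv_const_smul ((hφ k).1.differentiable (by simp) x)]
      rfl
    simp only [Pi.smul_apply, smul_eq_mul] at hx ⊢
    rw [hx, e]
    ring
  · refine tendsto_eLpNorm_smul a (h3 c) (fun k => ?_)
    refine Eventually.of_forall fun s => ?_
    simp only [Pi.smul_apply, smul_eq_mul]
    ring

theorem HasWeakDeriv.zero (i : Fin 2) : D.HasWeakDeriv i 0 0 := by
  intro φ _ _ _
  have key : ∀ ψ : Plane → ℝ, ∫ x in D.Ω, ψ x • (0 : D.L2) x = 0 := by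
    intro ψ
    rw [← integral_zero Plane ℂ (μ := D.vol)]
    refine integral_congr_ae ?_
    filter_upwards [Lp.coeFn_zero ℂ 2 D.vol] with x hx
    rw [hx, Pi.zero_apply, smul_zero]
  rw [key, key, neg_zero]

theorem HasTrace.zero : D.HasTrace 0 0 0 := by
  have key : eLpNorm (fun x => (0 : Plane → ℂ) x - (0 : D.L2) x) 2 D.vol = 0 := by
    rw [← eLpNorm_zero (ε := ℂ) (p := 2) (μ := D.vol)]
    refine eLpNorm_congr_ae ?_
    filter_upwards [Lp.coeFn_zero ℂ 2 D.vol] with x hx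
    rw [hx, sub_self]
    rfl
  have e : ∀ i x, pd i (0 : Plane → ℂ) x = (0 : Plane → ℂ) x := fun i x => by simp [pd]
  refine ⟨fun c => MemLp.zero, fun _ => 0,
    fun _ => ⟨contDiff_const, HasCompactSupport.zero⟩, ?_, fun i => ?_, fun c => ?_⟩
  · simp only [key]
    exact tendsto_const_nhds
  · simp only [e, Pi.zero_apply (M := fun _ : Fin 2 => D.L2), key]
    exact tendsto_const_nhds
  · simp

variable (D)

/-- The graph of the Robin operator. -/
def robinGraph (h : ℝ) : Submodule ℂ (D.L2 × D.L2) where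
  carrier := {p | D.IsRobinPair h p.1 p.2}
  zero_mem' := by
    refine ⟨0, 0, 0, 0, fun i => HasWeakDeriv.zero i, fun i j => HasWeakDeriv.zero j,
      HasTrace.zero, fun i => HasTrace.zero, fun c => ?_, ?_⟩ <;> simp
  add_mem' := by
    rintro p q ⟨v, w, g, d, h1, h2, h3, h4, h5, h6⟩ ⟨v', w', g', d', h1', h2', h3', h4', h5', h6'⟩
    refine ⟨v + v', w + w', g + g', d + d', fun i => (h1 i).add (h1' i),
      fun i j => (h2 i j).add (h2' i j), h3.add h3', fun i => (h4 i).add (h4' i), fun c => ?_, ?_⟩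
    · filter_upwards [h5 c, h5' c] with s hs hs'
      simp only [Pi.add_apply, Fin.sum_univ_two] at hs hs' ⊢
      linear_combination hs + hs'
    · simp only [Prod.snd_add, h6, h6', Pi.add_apply, Finset.sum_add_distrib, smul_add]
  smul_mem' := by
    rintro a p ⟨v, w, g, d, h1, h2, h3, h4, h5, h6⟩
    refine ⟨a • v, a • w, a • g, a • d, fun i => (h1 i).smul a,
      fun i j => (h2 i j).smul a, h3.smul a, fun i => (h4 i).smul a, fun c => ?_, ?_⟩
    · filter_upwards [h5 c] with s hs
      simp only [Pi.smul_apply, smul_eq_mul, Fin.sum_univ_two] at hs ⊢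
      linear_combination a * hs
    · simp only [Prod.smul_snd, h6, Pi.smul_apply, ← Finset.smul_sum]
      rw [smul_comm]

/-- The Robin operator `L_h = -h² Δ` in `L²(Ω)` with domain
`{u ∈ H²(Ω) : h^{1/2} ν·∇u - u = 0 on ∂Ω}`. -/
def robinOperator (h : ℝ) : D.L2 →ₗ.[ℂ] D.L2 := (D.robinGraph h).toLinearPMap

/-- `u` lies in the domain of the Robin operator and is mapped to `f` iff
`u ∈ H²(Ω)` satisfies the Robin condition and `f = -h² Δu`. -/
theorem mem_graph_robinOperator (h : ℝ) (u f : D.L2) :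
    (u, f) ∈ (D.robinOperator h).graph ↔ D.IsRobinPair h u f := by
  rw [robinOperator, Submodule.toLinearPMap_graph_eq]
  · rfl
  · rintro ⟨u, f⟩ ⟨v, w, g, d, h1, h2, -, -, -, h6⟩ (h0 : u = 0)
    subst h0
    have hv : ∀ i, v i = 0 := fun i => (h1 i).eq_zero
    have hw : ∀ i, w i i = 0 := fun i => HasWeakDeriv.eq_zero (i := i) (by rw [← hv i]; exact h2 i i)
    simpa [hw] using h6

end SmoothDomain

/-- The `j`-th min-max value (`j ≥ 1`) of a (semi-bounded self-adjoint) operator `A`: the infimum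
over the `j`-dimensional subspaces `V` of its domain of the supremum over `0 ≠ u ∈ V` of
the Rayleigh quotient `⟨A u, u⟩ / ‖u‖²`, as an extended real. -/
def minMax {H : Type*} [NormedAddCommGroup H] [InnerProductSpace ℂ H] (A : H →ₗ.[ℂ] H)
    (j : ℕ) : EReal :=
  ⨅ (V : Submodule ℂ H) (_ : V ≤ A.domain ∧ FiniteDimensional ℂ V ∧ Module.finrank ℂ V = j),
    ⨆ (u : A.domain) (_ : (u : H) ∈ V ∧ (u : H) ≠ 0),
      (((inner ℂ (A u) (u : H)).re / ‖(u : H)‖ ^ 2 : ℝ) : EReal)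

end RobinPlane

end

/-!
The upper bound comes from trial functions concentrated at the point of maximal curvature. Let
`s` be arc-length along the boundary component that carries the maximum, `t` the distance to the
boundary, `κ₀ = κ(0)` and `b = √(-κ''(0) / 2)`. Near the point, `(s, t)` are coordinates of `Ω`
with Jacobian `a = 1 - t κ(s)` (`exists_isTubular`). The trial functions are
`u = χ(s) G(s / h^{1/8}) · χ(t) exp (-t / √h)` with `G(σ) = p(σ) exp (-b σ² / 2)`, where `p` runs
through the real polynomials of degree less than `j` and `χ` is a cutoff. They are smooth with
compact support in the plane, and they satisfy the Robin condition exactly, because the normal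
factor has logarithmic derivative `-1 / √h` at `t = 0` (`robin_ofTube`). Hence they lie in the
operator domain, with `-h² Δ u` computed pointwise (`robin_mem_graph`), and no trace theory beyond
smooth functions is used.

From `a Δ = ∂_s (a⁻¹ ∂_s) + ∂_t (a ∂_t)` (`jac_mul_laplacian`) and the equation
`w'' = w / h` for `w(t) = exp (-t / √h)`, the density of `⟨-h² Δ u, u⟩ + (h + κ₀ h^{3/2}) ‖u‖²` is
`-h² w² G G''(s / h^{1/8}) h^{-1/4} + h^{3/2} (κ₀ - κ(s)) w² G²` plus errors, and
`κ₀ - κ(s) ≤ b² s² + O(|s|³)`. Since `s = h^{1/8} σ`, both terms have size `h^{7/4}` and form the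
energy density of the harmonic oscillator `-∂_σ² + b² σ²` in the state `G`, while all errors are
`O(h^{15/8})` relative to the norm. With `ε = h^{1/8}` every power is an integer power of `ε`.
These estimates hold pointwise (`energyDensity_le`, `normDensity_ge`), so no integration by parts
in `s` or `t` is needed, and integrating them gives `exists_trial_estimate`.

The oscillator energy of `G` is at most `(2 j - 1) b` times its squared norm for
`deg p ≤ j - 1`. By the ground state substitution this is the inequality `N(p') ≤ 2 b (j - 1) N(p)`
for the Gaussian norm `N(p) = ∫ p² exp (-b σ²)`, proved by induction on the degree without Hermite
polynomials (`gaussInt_derivative_sq_le`). The same inequality bounds the moments and derivatives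
that enter the errors (`exists_integral_gaussErr_le`).

Finally the trial functions are real, so the Rayleigh quotient on their complex span, which has
dimension `j`, obeys the bound on the real space (`minMax_le_of_real`).
-/

noncomputable section

namespace RobinPlane

/-! ### Polynomials in the Gaussian `L²` space -/

section GaussianPolynomials

open Polynomial

theorem integrable_eval_mul_gaussian {b : ℝ} (hb : 0 < b) (q : ℝ[X]) :
    Integrable (fun x : ℝ => q.eval x * Real.exp (-b * x ^ 2)) := by
  induction q using Polynomial.induction_on' with
  | add p q hp hq =>
    refine (hp.add hq).congr (Eventually.of_forall fun x => ?_)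
    simp only [Pi.add_apply, eval_add]
    ring
  | monomial n a =>
    have h := (integrable_rpow_mul_exp_neg_mul_sq hb (s := n)
      (by linarith [Nat.cast_nonneg (α := ℝ) n])).const_mul a
    refine h.congr (Eventually.of_forall fun x => ?_)
    simp only [eval_monomial, Real.rpow_natCast]
    ring

/-- Integration of polynomials against the Gaussian weight `exp (-b x²)`, as a linear functional. -/
def gaussInt {b : ℝ} (hb : 0 < b) : ℝ[X] →ₗ[ℝ] ℝ where
  toFun q := ∫ x : ℝ, q.eval x * Real.exp (-b * x ^ 2)
  map_add' p q := by
    rw [← integral_add (integrable_eval_mul_gaussian hb p) (integrable_eval_mul_gaussian hb q)]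
    simp only [eval_add, add_mul]
  map_smul' c q := by
    rw [RingHom.id_apply, smul_eq_mul, ← integral_const_mul]
    simp only [eval_smul, smul_eq_mul, mul_assoc]

section

variable {b : ℝ} (hb : 0 < b)

theorem gaussInt_apply (q : ℝ[X]) :
    gaussInt hb q = ∫ x : ℝ, q.eval x * Real.exp (-b * x ^ 2) := rfl

theorem gaussInt_sq_nonneg (q : ℝ[X]) : 0 ≤ gaussInt hb (q ^ 2) := by
  rw [gaussInt_apply]
  refine integral_nonneg fun x => ?_
  simp only [eval_pow]
  positivity

theorem gaussInt_sq_pos {q : ℝ[X]} (hq : q ≠ 0) : 0 < gaussInt hb (q ^ 2) := by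
  refine lt_of_le_of_ne (gaussInt_sq_nonneg hb q) fun h0 => hq ?_
  have hc : Continuous fun x : ℝ => (q ^ 2).eval x * Real.exp (-b * x ^ 2) := by fun_prop
  have h1 := (integral_eq_zero_iff_of_nonneg (fun x => by simp only [eval_pow]; positivity)
    (integrable_eval_mul_gaussian hb (q ^ 2))).1 ((gaussInt_apply hb (q ^ 2)).symm.trans h0.symm)
  have h2 := (Continuous.ae_eq_iff_eq volume hc continuous_zero).1 h1
  refine Polynomial.funext fun x => ?_
  have h3 := congrFun h2 x
  simpa [Real.exp_ne_zero] using h3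

/-- Integration by parts against the Gaussian weight. -/
theorem gaussInt_derivative (q : ℝ[X]) :
    gaussInt hb (derivative q) = 2 * b * gaussInt hb (X * q) := by
  have h1 : ∀ x : ℝ, HasDerivAt (fun x => q.eval x * Real.exp (-b * x ^ 2))
      ((derivative q - C (2 * b) * (X * q)).eval x * Real.exp (-b * x ^ 2)) x := by
    intro x
    have h2 : HasDerivAt (fun x : ℝ => Real.exp (-b * x ^ 2))
        (Real.exp (-b * x ^ 2) * (-b * (2 * x))) x := by
      simpa using (((hasDerivAt_id x).pow 2).const_mul (-b)).exp
    refine ((q.hasDerivAt x).mul h2).congr_deriv ?_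
    simp only [eval_sub, eval_mul, eval_C, eval_X]
    ring
  have h2 := integral_eq_zero_of_hasDerivAt_of_integrable h1
    (integrable_eval_mul_gaussian hb _) (integrable_eval_mul_gaussian hb q)
  rw [← gaussInt_apply hb, map_sub, ← smul_eq_C_mul, map_smul, smul_eq_mul] at h2
  linarith

/-- The first-order form of the operator `L p = -p'' + 2 b X p'`. -/
theorem gaussInt_hermite_mul (p q : ℝ[X]) :
    gaussInt hb ((C (2 * b) * X * derivative p - derivative (derivative p)) * q)
      = gaussInt hb (derivative p * derivative q) := by
  have h := gaussInt_derivative hb (derivative p * q)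
  rw [derivative_mul, map_add] at h
  rw [sub_mul, map_sub, show C (2 * b) * X * derivative p * q
    = (2 * b) • (X * (derivative p * q)) by rw [smul_eq_C_mul]; ring, map_smul, smul_eq_mul]
  linarith

/-- The Gaussian Dirichlet form of a polynomial of degree at most `m` is at most `2 b m` times
its squared norm, `2 b m` being the `m`-th eigenvalue of `L p = -p'' + 2 b X p'`. The induction
uses `⟨L p, L p⟩ = ‖p''‖² + 2 b ‖p'‖²`, which follows from `(L p)' = L p' + 2 b p'`. -/
theorem gaussInt_derivative_sq_le (m : ℕ) : ∀ p : ℝ[X], p.natDegree ≤ m →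
    gaussInt hb (derivative p ^ 2) ≤ 2 * b * m * gaussInt hb (p ^ 2) := by
  induction m with
  | zero =>
    intro p hp
    rw [derivative_of_natDegree_zero (Nat.le_zero.1 hp)]
    simp
  | succ m ih =>
    intro p hp
    set c : ℝ := 2 * b * ((m + 1 : ℕ) : ℝ) with hc
    have hc0 : 0 < c := by rw [hc]; push_cast; positivity
    have ih' := ih (derivative p) ((natDegree_derivative_le p).trans (by omega))
    set l : ℝ[X] := C (2 * b) * X * derivative p - derivative (derivative p) with hl
    have e1 : gaussInt hb (l * p) = gaussInt hb (derivative p ^ 2) := by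
      rw [hl, gaussInt_hermite_mul, sq]
    have e2 : gaussInt hb (l * l)
        = gaussInt hb (derivative (derivative p) ^ 2)
          + 2 * b * gaussInt hb (derivative p ^ 2) := by
      conv_lhs => rw [hl, gaussInt_hermite_mul]
      have h := gaussInt_hermite_mul hb (derivative p) (derivative p)
      have e : derivative p * derivative (C (2 * b) * X * derivative p
            - derivative (derivative p))
          = (C (2 * b) * X * derivative (derivative p)
              - derivative (derivative (derivative p))) * derivative p
            + (2 * b) • (derivative p ^ 2) := by
        rw [smul_eq_C_mul]
        simp only [derivative_sub, derivative_mul, derivative_C, derivative_X]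
        ring
      rw [← hl, hl, e, map_add, h, map_smul, smul_eq_mul, sq, sq]
    have h := gaussInt_sq_nonneg hb (l - C c * p)
    have e3 : (l - C c * p) ^ 2 = l * l - (2 * c) • (l * p) + (c ^ 2) • (p ^ 2) := by
      simp only [smul_eq_C_mul, C_mul, C_pow, C_ofNat]
      ring
    rw [e3, map_add, map_sub, map_smul, map_smul, e1, e2, smul_eq_mul, smul_eq_mul] at h
    have h2 : gaussInt hb (derivative (derivative p) ^ 2)
        + 2 * b * gaussInt hb (derivative p ^ 2) ≤ c * gaussInt hb (derivative p ^ 2) := by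
      rw [hc]; push_cast
      linarith
    have h3 : c * gaussInt hb (derivative p ^ 2) ≤ c * (c * gaussInt hb (p ^ 2)) := by
      linarith
    exact le_of_mul_le_mul_left h3 hc0

theorem gaussInt_X_mul_sq_le {m : ℕ} {p : ℝ[X]} (hp : p.natDegree ≤ m) :
    gaussInt hb ((X * p) ^ 2) ≤ (1 + 2 * m) / b * gaussInt hb (p ^ 2) := by
  have h1 := gaussInt_derivative_sq_le hb m p hp
  have h2 := gaussInt_derivative hb (X * p ^ 2)
  have e1 : derivative (X * p ^ 2) = p ^ 2 + (2 : ℝ) • (X * p * derivative p) := by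
    simp only [smul_eq_C_mul, derivative_mul, derivative_X, derivative_pow]
    norm_num
    rw [show (C (2 : ℝ) : ℝ[X]) = 2 from map_ofNat C 2]
    ring
  rw [e1, map_add, map_smul, smul_eq_mul, show X * (X * p ^ 2) = (X * p) ^ 2 by ring] at h2
  have h3 := gaussInt_sq_nonneg hb (C b * (X * p) - derivative p)
  have e2 : (C b * (X * p) - derivative p) ^ 2
      = (b ^ 2) • (X * p) ^ 2 - (2 * b) • (X * p * derivative p) + derivative p ^ 2 := by
    simp only [smul_eq_C_mul, C_mul, C_pow, C_ofNat]
    ring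
  rw [e2, map_add, map_sub, map_smul, map_smul, smul_eq_mul, smul_eq_mul] at h3
  rw [div_mul_eq_mul_div, le_div_iff₀ hb]
  have h4 : b * (gaussInt hb ((X * p) ^ 2) * b) ≤ b * ((1 + 2 * m) * gaussInt hb (p ^ 2)) := by
    nlinarith
  exact le_of_mul_le_mul_left h4 hb

/-- A map of polynomials that on each space of polynomials of bounded degree is bounded for
the Gaussian norm (and keeps the degree bounded). -/
def GaussBounded (T : ℝ[X] → ℝ[X]) : Prop :=
  ∀ m : ℕ, ∃ k : ℕ, ∃ c : ℝ, 0 ≤ c ∧ ∀ p : ℝ[X], p.natDegree ≤ m →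
    (T p).natDegree ≤ k ∧ gaussInt hb (T p ^ 2) ≤ c * gaussInt hb (p ^ 2)

theorem GaussBounded.id : GaussBounded hb (fun p => p) :=
  fun m => ⟨m, 1, zero_le_one, fun _ hp => ⟨hp, (one_mul _).ge⟩⟩

theorem GaussBounded.derivative {T : ℝ[X] → ℝ[X]} (hT : GaussBounded hb T) :
    GaussBounded hb (fun p => derivative (T p)) := by
  intro m
  obtain ⟨k, c, hc, h⟩ := hT m
  refine ⟨k, 2 * b * k * c, by positivity, fun p hp => ?_⟩
  obtain ⟨h1, h2⟩ := h p hp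
  refine ⟨(natDegree_derivative_le _).trans (by omega), ?_⟩
  calc _ ≤ 2 * b * k * gaussInt hb (T p ^ 2) := gaussInt_derivative_sq_le hb k _ h1
    _ ≤ 2 * b * k * (c * gaussInt hb (p ^ 2)) := by gcongr
    _ = _ := by ring

theorem GaussBounded.X_mul {T : ℝ[X] → ℝ[X]} (hT : GaussBounded hb T) :
    GaussBounded hb (fun p => X * T p) := by
  intro m
  obtain ⟨k, c, hc, h⟩ := hT m
  refine ⟨k + 1, (1 + 2 * k) / b * c, by positivity, fun p hp => ?_⟩
  obtain ⟨h1, h2⟩ := h p hp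
  refine ⟨natDegree_mul_le.trans (by rw [natDegree_X]; omega), ?_⟩
  calc _ ≤ (1 + 2 * k) / b * gaussInt hb (T p ^ 2) := gaussInt_X_mul_sq_le hb h1
    _ ≤ (1 + 2 * k) / b * (c * gaussInt hb (p ^ 2)) := by gcongr
    _ = _ := by ring

theorem GaussBounded.C_mul {T : ℝ[X] → ℝ[X]} (hT : GaussBounded hb T) (a : ℝ) :
    GaussBounded hb (fun p => C a * T p) := by
  intro m
  obtain ⟨k, c, hc, h⟩ := hT m
  refine ⟨k, a ^ 2 * c, by positivity, fun p hp => ?_⟩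
  obtain ⟨h1, h2⟩ := h p hp
  refine ⟨(natDegree_C_mul_le _ _).trans h1, ?_⟩
  rw [mul_pow, ← C_pow, ← smul_eq_C_mul, map_smul, smul_eq_mul, mul_assoc]
  gcongr

theorem GaussBounded.add {T S : ℝ[X] → ℝ[X]} (hT : GaussBounded hb T) (hS : GaussBounded hb S) :
    GaussBounded hb (fun p => T p + S p) := by
  intro m
  obtain ⟨k, c, hc, h⟩ := hT m
  obtain ⟨k', c', hc', h'⟩ := hS m
  refine ⟨max k k', 2 * c + 2 * c', by positivity, fun p hp => ?_⟩
  obtain ⟨h1, h2⟩ := h p hp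
  obtain ⟨h1', h2'⟩ := h' p hp
  refine ⟨(natDegree_add_le _ _).trans (max_le_max h1 h1'), ?_⟩
  have h3 := gaussInt_sq_nonneg hb (T p - S p)
  have e1 : (T p + S p) ^ 2 = (2 : ℝ) • T p ^ 2 + (2 : ℝ) • S p ^ 2 - (T p - S p) ^ 2 := by
    simp only [smul_eq_C_mul, C_ofNat]
    ring
  rw [e1, map_sub, map_add, map_smul, map_smul, smul_eq_mul, smul_eq_mul]
  linarith

end

end GaussianPolynomials

/-! ### Upper bounds for min-max values -/

/-- A real `j`-dimensional space of real trial vectors (real scalar products among themselves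
and with their images) bounds the `j`-th min-max value of a complex operator: its
complex span is `j`-dimensional, and the Rayleigh quotient of `x + i y` splits. -/
theorem minMax_le_of_real {H : Type*} [NormedAddCommGroup H] [InnerProductSpace ℂ H]
    [Module ℝ H] [IsScalarTower ℝ ℂ H]
    (A : H →ₗ.[ℂ] H) {W : Type*} [AddCommGroup W] [Module ℝ W] [FiniteDimensional ℝ W]
    (T : W →ₗ[ℝ] H) (F : W → H) (Λ : ℝ) (h_graph : ∀ p, (T p, F p) ∈ A.graph)
    (h_real : ∀ p q, (inner ℂ (T p) (T q)).im = 0)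
    (h_real' : ∀ p q, (inner ℂ (F p) (T q)).im = 0)
    (h_inj : ∀ p, T p = 0 → p = 0)
    (h_le : ∀ p, (inner ℂ (F p) (T p)).re ≤ Λ * ‖T p‖ ^ 2) :
    minMax A (Module.finrank ℝ W) ≤ (Λ : EReal) := by
  have norm_split : ∀ p q, ‖T p + Complex.I • T q‖ ^ 2 = ‖T p‖ ^ 2 + ‖T q‖ ^ 2 := by
    intro p q
    have e : RCLike.re (inner ℂ (T p) (Complex.I • T q)) = 0 := by
      rw [inner_smul_right]
      simp [h_real p q]
    rw [norm_add_sq (𝕜 := ℂ), e, norm_smul]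
    simp
  let B := Module.finBasis ℝ W
  let V : Submodule ℂ H := Submodule.span ℂ (range fun i => T (B i))
  have comb : ∀ c : Fin (Module.finrank ℝ W) → ℂ, ∃ p q : W,
      p = ∑ i, (c i).re • B i ∧ q = ∑ i, (c i).im • B i ∧
      ∑ i, c i • T (B i) = T p + Complex.I • T q := by
    intro c
    refine ⟨_, _, rfl, rfl, ?_⟩
    rw [map_sum, map_sum, Finset.smul_sum, ← Finset.sum_add_distrib]
    refine Finset.sum_congr rfl fun i _ => ?_
    rw [map_smul, map_smul, ← IsScalarTower.algebraMap_smul ℂ (c i).re,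
      ← IsScalarTower.algebraMap_smul ℂ (c i).im, smul_smul, ← add_smul]
    congr 1
    rw [mul_comm, Complex.coe_algebraMap, Complex.re_add_im]
  have lin : LinearIndependent ℂ fun i => T (B i) := by
    rw [Fintype.linearIndependent_iff]
    intro c hc
    obtain ⟨p, q, hp, hq, h⟩ := comb c
    have h2 := norm_split p q
    rw [← h, hc, norm_zero] at h2
    have hp0 : p = 0 := h_inj p (by
      rw [← norm_eq_zero]; nlinarith [sq_nonneg ‖T p‖, sq_nonneg ‖T q‖])
    have hq0 : q = 0 := h_inj q (by
      rw [← norm_eq_zero]; nlinarith [sq_nonneg ‖T p‖, sq_nonneg ‖T q‖])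
    have hre := Fintype.linearIndependent_iff.1 B.linearIndependent _ (hp.symm.trans hp0)
    have him := Fintype.linearIndependent_iff.1 B.linearIndependent _ (hq.symm.trans hq0)
    exact fun i => Complex.ext (hre i) (him i)
  refine iInf₂_le_of_le V ⟨?_, ?_, ?_⟩ ?_
  · rw [Submodule.span_le]
    rintro _ ⟨i, rfl⟩
    exact LinearPMap.mem_domain_of_mem_graph (h_graph (B i))
  · exact FiniteDimensional.span_of_finite ℂ (finite_range _)
  · rw [finrank_span_eq_card lin, Fintype.card_fin]
  · refine iSup₂_le fun u hu => ?_
    obtain ⟨huV, hu0⟩ := hu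
    obtain ⟨c, hc⟩ := (Submodule.mem_span_range_iff_exists_fun ℂ).1 huV
    obtain ⟨p, q, -, -, h⟩ := comb c
    have hu : (u : H) = T p + Complex.I • T q := by rw [← h, hc]
    have hpos : 0 < ‖(u : H)‖ ^ 2 := by positivity
    have hAu : A u = F p + Complex.I • F q := by
      obtain ⟨y, hy1, hy2⟩ := (LinearPMap.mem_graph_iff _).1
        (A.graph.add_mem (h_graph p) (A.graph.smul_mem Complex.I (h_graph q)))
      have e : y = u := Subtype.ext (hy1.trans hu.symm)
      rw [← e, hy2]
      rfl
    rw [EReal.coe_le_coe_iff, div_le_iff₀ hpos]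
    have e : (inner ℂ (A u) (u : H)).re
        = (inner ℂ (F p) (T p)).re + (inner ℂ (F q) (T q)).re := by
      rw [hAu, hu]
      simp only [inner_add_left, inner_add_right, inner_smul_left, inner_smul_right,
        Complex.add_re, Complex.mul_re, Complex.I_re, Complex.I_im, Complex.conj_I,
        Complex.neg_re, Complex.neg_im, Complex.add_im,
        Complex.mul_im, h_real' p q, h_real' q p]
      ring
    rw [e, hu, norm_split]
    linarith [h_le p, h_le q]

/-! ### Smooth functions in the domain of the Robin operator -/

/-- The real-valued smooth functions of compact support on the plane. -/
def testSpace : Submodule ℝ (Plane → ℝ) where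
  carrier := {φ | ContDiff ℝ ∞ φ ∧ HasCompactSupport φ}
  zero_mem' := ⟨contDiff_const, HasCompactSupport.zero⟩
  add_mem' h h' := ⟨h.1.add h'.1, h.2.add h'.2⟩
  smul_mem' a _ h := ⟨h.1.const_smul a, h.2.smul_left (f := fun _ => a)⟩

theorem contDiff_pd {φ : Plane → ℝ} (hφ : ContDiff ℝ ∞ φ) (i : Fin 2) : ContDiff ℝ ∞ (pd i φ) :=
  (hφ.fderiv_right (m := ∞) (by simp)).clm_apply contDiff_const

theorem pd_mem_testSpace {φ : Plane → ℝ} (h : φ ∈ testSpace) (i : Fin 2) : pd i φ ∈ testSpace :=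
  ⟨contDiff_pd h.1 i, SmoothDomain.pd_compact h.2 i⟩

theorem pd_ofReal {φ : Plane → ℝ} (hφ : ContDiff ℝ ∞ φ) (i : Fin 2) (x : Plane) :
    pd i (fun x => ((φ x : ℝ) : ℂ)) x = ((pd i φ x : ℝ) : ℂ) := by
  have h : HasFDerivAt (fun x => (φ x : ℂ)) (Complex.ofRealCLM.comp (fderiv ℝ φ x)) x :=
    Complex.ofRealCLM.hasFDerivAt.comp x (hφ.differentiable (by simp) x).hasFDerivAt
  simp only [pd, h.fderiv]
  rfl

/-- The Laplacian of a function on the plane. -/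
def laplacian (φ : Plane → ℝ) (x : Plane) : ℝ := ∑ i, pd i (pd i φ) x

namespace SmoothDomain

variable (D : SmoothDomain)

theorem memLp_ofReal {φ : Plane → ℝ} (h : φ ∈ testSpace) :
    MemLp (fun x => (φ x : ℂ)) 2 D.vol :=
  ((h.1.continuous.memLp_of_hasCompactSupport (p := 2) (μ := volume) h.2).restrict D.Ω).ofReal

/-- The class in `L²(Ω)` of a smooth function of compact support on the plane. -/
def toL2 : testSpace →ₗ[ℝ] D.L2 where
  toFun φ := (D.memLp_ofReal φ.2).toLp
  map_add' φ ψ := by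
    rw [← MemLp.toLp_add]
    refine MemLp.toLp_congr _ _ (Eventually.of_forall fun x => ?_)
    simp
  map_smul' a φ := by
    rw [RingHom.id_apply, ← MemLp.toLp_const_smul]
    refine MemLp.toLp_congr _ _ (Eventually.of_forall fun x => ?_)
    simp

theorem coeFn_toL2 (φ : testSpace) : ∀ᵐ x ∂D.vol, D.toL2 φ x = (φ.1 x : ℂ) :=
  MemLp.coeFn_toLp (D.memLp_ofReal φ.2)

theorem inner_toL2 (φ ψ : testSpace) :
    inner ℂ (D.toL2 φ) (D.toL2 ψ) = ((∫ x in D.Ω, φ.1 x * ψ.1 x : ℝ) : ℂ) := by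
  rw [L2.inner_def, ← integral_complex_ofReal]
  refine integral_congr_ae ?_
  filter_upwards [D.coeFn_toL2 φ, D.coeFn_toL2 ψ] with x h1 h2
  rw [h1, h2]
  simp [mul_comm]

theorem norm_toL2_sq (φ : testSpace) : ‖D.toL2 φ‖ ^ 2 = ∫ x in D.Ω, φ.1 x ^ 2 := by
  have h := inner_self_eq_norm_sq (𝕜 := ℂ) (D.toL2 φ)
  rw [inner_toL2] at h
  simp only [← sq] at h
  exact h.symm

variable {D}

theorem hasWeakDeriv_toL2 (φ : testSpace) (i : Fin 2) :
    D.HasWeakDeriv i (D.toL2 φ) (D.toL2 ⟨pd i φ.1, pd_mem_testSpace φ.2 i⟩) := by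
  intro ψ hψ hc hs
  obtain ⟨φ, hφ, hφc⟩ := φ
  have e1 : ∫ x in D.Ω, pd i ψ x • D.toL2 ⟨φ, hφ, hφc⟩ x
      = ∫ x, ((pd i ψ x * φ x : ℝ) : ℂ) := by
    refine Eq.trans ?_ (setIntegral_eq_integral_of_forall_compl_eq_zero (s := D.Ω) ?_)
    · refine integral_congr_ae ?_
      filter_upwards [D.coeFn_toL2 ⟨φ, hφ, hφc⟩] with x hx
      rw [hx]
      simp
    · intro x hx
      have hz : fderiv ℝ ψ x = 0 := by
        by_contra h
        exact hx (hs (support_fderiv_subset ℝ (f := ψ) h))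
      simp [pd, hz]
  have e2 : ∫ x in D.Ω, ψ x • D.toL2 ⟨pd i φ, pd_mem_testSpace ⟨hφ, hφc⟩ i⟩ x
      = ∫ x, ((ψ x * pd i φ x : ℝ) : ℂ) := by
    refine Eq.trans ?_ (setIntegral_eq_integral_of_forall_compl_eq_zero (s := D.Ω) ?_)
    · refine integral_congr_ae ?_
      filter_upwards [D.coeFn_toL2 ⟨pd i φ, pd_mem_testSpace ⟨hφ, hφc⟩ i⟩] with x hx
      rw [hx]
      simp
    · intro x hx
      rw [image_eq_zero_of_notMem_tsupport (fun hx' => hx (hs hx'))]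
      simp
  have hψ1 := pd_smooth hψ i
  have hφ1 := pd_smooth hφ i
  rw [e1, e2, integral_complex_ofReal, integral_complex_ofReal]
  unfold pd
  rw [integral_mul_fderiv_eq_neg_fderiv_mul_of_integrable (𝕜 := ℝ)]
  · simp
  · exact (hψ1.mul hφ.continuous).integrable_of_hasCompactSupport (hφc.mul_left)
  · exact (hψ.continuous.mul hφ1).integrable_of_hasCompactSupport (hc.mul_right)
  · exact (hψ.continuous.mul hφ.continuous).integrable_of_hasCompactSupport (hφc.mul_left)
  · exact fun x _ => hψ.differentiable (by simp) x
  · exact fun x _ => hφ.differentiable (by simp) x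

theorem hasTrace_toL2 (φ : testSpace) :
    D.HasTrace (D.toL2 φ) (fun i => D.toL2 ⟨pd i φ.1, pd_mem_testSpace φ.2 i⟩)
      (fun c s => ((φ.1 (D.M c s) : ℝ) : ℂ)) := by
  refine ⟨fun c => ?_, fun _ x => (φ.1 x : ℂ), fun _ => ⟨?_, ?_⟩, ?_, fun i => ?_, fun c => ?_⟩
  · obtain ⟨C, hC⟩ := φ.2.2.exists_bound_of_continuous φ.2.1.continuous
    refine MemLp.of_bound (Continuous.aestronglyMeasurable ?_) C
      (Eventually.of_forall fun s => ?_)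
    · exact Complex.continuous_ofReal.comp (φ.2.1.continuous.comp (D.smooth c).continuous)
    · simpa using hC (D.M c s)
  · exact Complex.ofRealCLM.contDiff.comp φ.2.1
  · exact φ.2.2.comp_left (g := fun x : ℝ => (x : ℂ)) Complex.ofReal_zero
  · have h : eLpNorm (fun x => (φ.1 x : ℂ) - D.toL2 φ x) 2 D.vol = 0 := by
      rw [← eLpNorm_zero (ε := ℂ) (p := 2) (μ := D.vol)]
      refine eLpNorm_congr_ae ?_
      filter_upwards [D.coeFn_toL2 φ] with x hx
      rw [hx, sub_self]
      rfl
    simp only [h]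
    exact tendsto_const_nhds
  · have h : eLpNorm (fun x => pd i (fun x => (φ.1 x : ℂ)) x
        - D.toL2 ⟨pd i φ.1, pd_mem_testSpace φ.2 i⟩ x) 2 D.vol = 0 := by
      rw [← eLpNorm_zero (ε := ℂ) (p := 2) (μ := D.vol)]
      refine eLpNorm_congr_ae ?_
      filter_upwards [D.coeFn_toL2 ⟨pd i φ.1, pd_mem_testSpace φ.2 i⟩] with x hx
      rw [hx, pd_ofReal φ.2.1, sub_self]
      rfl
    simp only [h]
    exact tendsto_const_nhds
  · simp

variable (D) in
/-- The test functions satisfying the Robin condition pointwise at the boundary. -/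
def robinTestSpace (h : ℝ) : Submodule ℝ testSpace where
  carrier := {φ | ∀ c s, √h * ∑ i, D.normal c s i * pd i φ.1 (D.M c s) = φ.1 (D.M c s)}
  zero_mem' c s := by simp [pd]
  add_mem' := by
    intro φ ψ h1 h2 c s
    have e : ∀ i x, pd i (φ + ψ).1 x = pd i φ.1 x + pd i ψ.1 x := fun i x => by
      simp only [pd, Submodule.coe_add]
      rw [fderiv_add (φ.2.1.differentiable (by simp) x) (ψ.2.1.differentiable (by simp) x)]
      rfl
    simp only [e]
    simp only [Submodule.coe_add, Pi.add_apply, ← h1 c s, ← h2 c s, Fin.sum_univ_two]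
    ring
  smul_mem' := by
    intro a φ h1 c s
    have e : ∀ i x, pd i (a • φ).1 x = a * pd i φ.1 x := fun i x => by
      simp only [pd, Submodule.coe_smul]
      rw [fderiv_const_smul (φ.2.1.differentiable (by simp) x)]
      rfl
    simp only [e]
    simp only [Submodule.coe_smul, Pi.smul_apply, smul_eq_mul, ← h1 c s, Fin.sum_univ_two]
    ring

theorem laplacian_mem_testSpace {φ : Plane → ℝ} (h : φ ∈ testSpace) :
    laplacian φ ∈ testSpace := by
  have e : laplacian φ = ∑ i, pd i (pd i φ) := by
    ext x
    simp [laplacian]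
  rw [e]
  exact Submodule.sum_mem _ fun i _ => pd_mem_testSpace (pd_mem_testSpace h i) i

theorem isRobinPair_toL2 {h : ℝ} (φ : D.robinTestSpace h) :
    D.IsRobinPair h (D.toL2 φ)
      (D.toL2 ((-h ^ 2) • ⟨laplacian φ.1.1, laplacian_mem_testSpace φ.1.2⟩)) := by
  refine ⟨_, _, _, _, fun i => hasWeakDeriv_toL2 φ.1 i, fun i j => hasWeakDeriv_toL2 _ j,
    hasTrace_toL2 φ.1, fun i => hasTrace_toL2 _, fun c => Eventually.of_forall fun s => ?_, ?_⟩
  · rw [sub_eq_zero]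
    have := φ.2 c s
    exact_mod_cast congrArg (fun x : ℝ => (x : ℂ)) this
  · have e : (⟨laplacian φ.1.1, laplacian_mem_testSpace φ.1.2⟩ : testSpace)
        = ∑ i, ⟨pd i (pd i φ.1.1), pd_mem_testSpace (pd_mem_testSpace φ.1.2 i) i⟩ := by
      ext x
      simp [laplacian]
    rw [map_smul, e, map_sum, ← IsScalarTower.algebraMap_smul ℂ (-h ^ 2), Complex.coe_algebraMap]
    push_cast
    rfl

theorem robin_mem_graph {h : ℝ} (φ : D.robinTestSpace h) :
    (D.toL2 φ, D.toL2 ((-h ^ 2) • ⟨laplacian φ.1.1, laplacian_mem_testSpace φ.1.2⟩))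
      ∈ (D.robinOperator h).graph :=
  (D.mem_graph_robinOperator h _ _).2 (isRobinPair_toL2 φ)

/-- A `j`-dimensional space of test functions satisfying the Robin condition bounds the `j`-th
min-max value of the Robin operator. -/
theorem minMax_le_of_test {h : ℝ} {W : Type*} [AddCommGroup W] [Module ℝ W]
    [FiniteDimensional ℝ W] (T : W →ₗ[ℝ] D.robinTestSpace h) (Λ : ℝ)
    (h_pos : ∀ p, p ≠ 0 → 0 < ∫ x in D.Ω, (T p).1.1 x ^ 2)
    (h_le : ∀ p, ∫ x in D.Ω, -h ^ 2 * ((T p).1.1 x * laplacian (T p).1.1 x)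
      ≤ Λ * ∫ x in D.Ω, (T p).1.1 x ^ 2) :
    minMax (D.robinOperator h) (Module.finrank ℝ W) ≤ (Λ : EReal) := by
  refine minMax_le_of_real (D.robinOperator h)
    (D.toL2 ∘ₗ (D.robinTestSpace h).subtype ∘ₗ T)
    (fun p => D.toL2 ((-h ^ 2) • ⟨laplacian (T p).1.1, laplacian_mem_testSpace (T p).1.2⟩)) Λ
    (fun p => robin_mem_graph (T p)) (fun p q => ?_) (fun p q => ?_) (fun p hp => ?_)
    (fun p => ?_)
  · simp only [LinearMap.comp_apply, inner_toL2, Complex.ofReal_im]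
  · simp only [LinearMap.comp_apply, inner_toL2, Complex.ofReal_im]
  · by_contra h0
    have h1 := D.norm_toL2_sq (T p)
    simp only [LinearMap.comp_apply, Submodule.subtype_apply] at hp
    rw [hp, norm_zero] at h1
    have := h_pos p h0
    simp_all
  · simp only [LinearMap.comp_apply, Submodule.subtype_apply, inner_toL2, Complex.ofReal_re,
      norm_toL2_sq]
    refine le_trans (le_of_eq (integral_congr_ae (Eventually.of_forall fun x => ?_))) (h_le p)
    simp only [Submodule.coe_smul, Pi.smul_apply, smul_eq_mul]
    ring

end SmoothDomain

/-! ### Tubular coordinates near a boundary point -/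

/-- The plane with its Cartesian coordinates. -/
def planeEquiv : Plane ≃L[ℝ] ℝ × ℝ :=
  (EuclideanSpace.equiv (Fin 2) ℝ).trans (ContinuousLinearEquiv.finTwoArrow ℝ ℝ)

theorem planeEquiv_apply (x : Plane) : planeEquiv x = (x 0, x 1) := rfl

theorem measurePreserving_planeEquiv : MeasurePreserving planeEquiv volume volume :=
  (volume_preserving_finTwoArrow ℝ).comp (PiLp.volume_preserving_ofLp (Fin 2))

namespace SmoothDomain

variable (D : SmoothDomain)

/-- The components of the unit tangent along a boundary curve. -/
def tangent (c : Fin D.m) (i : Fin 2) (s : ℝ) : ℝ := deriv (D.M c) s i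

variable {D} {c : Fin D.m}

theorem normal_zero (s : ℝ) : D.normal c s 0 = D.tangent c 1 s := by
  simp [normal, rot, tangent]

theorem normal_one (s : ℝ) : D.normal c s 1 = -D.tangent c 0 s := by
  simp [normal, rot, tangent]

theorem contDiff_deriv_M : ContDiff ℝ ∞ (deriv (D.M c)) :=
  ((contDiff_infty_iff_deriv).1 (D.smooth c)).2

theorem contDiff_tangent (i : Fin 2) : ContDiff ℝ ∞ (D.tangent c i) :=
  (EuclideanSpace.proj (𝕜 := ℝ) i).contDiff.comp contDiff_deriv_M

theorem contDiff_M_apply (i : Fin 2) : ContDiff ℝ ∞ (fun s => D.M c s i) :=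
  (EuclideanSpace.proj (𝕜 := ℝ) i).contDiff.comp (D.smooth c)

theorem hasDerivAt_M (i : Fin 2) (s : ℝ) :
    HasDerivAt (fun s => D.M c s i) (D.tangent c i s) s :=
  (EuclideanSpace.proj (𝕜 := ℝ) i).hasFDerivAt.comp_hasDerivAt s
    ((D.smooth c).differentiable (by simp) s).hasDerivAt

theorem tangent_sq (s : ℝ) : D.tangent c 0 s ^ 2 + D.tangent c 1 s ^ 2 = 1 := by
  have h := EuclideanSpace.norm_sq_eq (deriv (D.M c) s)
  rw [D.unit_speed, Fin.sum_univ_two] at h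
  simp only [Real.norm_eq_abs, sq_abs] at h
  simp only [tangent]
  linarith

theorem curvature_eq (s : ℝ) : D.curvature c s
    = D.tangent c 0 s * deriv (D.tangent c 1) s - D.tangent c 1 s * deriv (D.tangent c 0) s := by
  have h : ∀ i, deriv (D.tangent c i) s = deriv (deriv (D.M c)) s i := fun i =>
    ((EuclideanSpace.proj (𝕜 := ℝ) i).hasFDerivAt.comp_hasDerivAt s
      (contDiff_deriv_M.differentiable (by simp) s).hasDerivAt).deriv
  simp only [curvature, normal, neg_neg, h, PiLp.inner_apply, Fin.sum_univ_two, rot, tangent]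
  simp
  ring

theorem contDiff_curvature : ContDiff ℝ ∞ (D.curvature c) := by
  have e : D.curvature c = fun s => D.tangent c 0 s * deriv (D.tangent c 1) s
      - D.tangent c 1 s * deriv (D.tangent c 0) s := funext curvature_eq
  have h : ∀ i, ContDiff ℝ ∞ (deriv (D.tangent c i)) := fun i =>
    ((contDiff_infty_iff_deriv).1 (contDiff_tangent i)).2
  rw [e]
  exact ((contDiff_tangent 0).mul (h 1)).sub ((contDiff_tangent 1).mul (h 0))

theorem tangent_mul_deriv (s : ℝ) : D.tangent c 0 s * deriv (D.tangent c 0) s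
    + D.tangent c 1 s * deriv (D.tangent c 1) s = 0 := by
  have h : ∀ i, HasDerivAt (D.tangent c i) (deriv (D.tangent c i) s) s := fun i =>
    ((contDiff_tangent i).differentiable (by simp) s).hasDerivAt
  have h1 := ((h 0).pow 2).add ((h 1).pow 2)
  have h2 : HasDerivAt (D.tangent c 0 ^ 2 + D.tangent c 1 ^ 2) 0 s := by
    have e : D.tangent c 0 ^ 2 + D.tangent c 1 ^ 2 = fun _ => 1 := funext tangent_sq
    rw [e]
    exact hasDerivAt_const s 1
  have h3 := h1.unique h2
  simp only [Nat.cast_ofNat, Nat.add_one_sub_one, pow_one] at h3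
  linarith

/-- Frenet equation, first component. -/
theorem hasDerivAt_tangent_zero (s : ℝ) :
    HasDerivAt (D.tangent c 0) (-(D.curvature c s * D.tangent c 1 s)) s := by
  refine ((contDiff_tangent 0).differentiable (by simp) s).hasDerivAt.congr_deriv ?_
  rw [curvature_eq]
  linear_combination D.tangent c 0 s * tangent_mul_deriv (c := c) s
    - deriv (D.tangent c 0) s * tangent_sq (c := c) s

/-- Frenet equation, second component. -/
theorem hasDerivAt_tangent_one (s : ℝ) :
    HasDerivAt (D.tangent c 1) (D.curvature c s * D.tangent c 0 s) s := by
  refine ((contDiff_tangent 1).differentiable (by simp) s).hasDerivAt.congr_deriv ?_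
  rw [curvature_eq]
  linear_combination D.tangent c 1 s * tangent_mul_deriv (c := c) s
    - deriv (D.tangent c 1) s * tangent_sq (c := c) s

variable (D c) in
/-- The point at signed distance `t` from the boundary point of arc-length parameter `s`, in the
direction of the inward normal, in Cartesian coordinates. -/
def tube (z : ℝ × ℝ) : ℝ × ℝ :=
  (D.M c z.1 0 - z.2 * D.tangent c 1 z.1, D.M c z.1 1 + z.2 * D.tangent c 0 z.1)

variable (D c) in
/-- The Jacobian determinant of the tubular coordinates. -/
def jac (z : ℝ × ℝ) : ℝ := 1 - z.2 * D.curvature c z.1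

theorem tube_eq (z : ℝ × ℝ) :
    planeEquiv.symm (D.tube c z) = D.M c z.1 + z.2 • rot (deriv (D.M c) z.1) := by
  refine planeEquiv.injective ?_
  rw [ContinuousLinearEquiv.apply_symm_apply, planeEquiv_apply]
  simp [tube, rot, tangent, sub_eq_add_neg]

theorem contDiff_tube : ContDiff ℝ ∞ (D.tube c) := by
  have h : ∀ i, ContDiff ℝ ∞ fun z : ℝ × ℝ => D.tangent c i z.1 := fun i =>
    (contDiff_tangent i).comp contDiff_fst
  have h' : ∀ i, ContDiff ℝ ∞ fun z : ℝ × ℝ => D.M c z.1 i := fun i =>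
    (contDiff_M_apply i).comp contDiff_fst
  exact ((h' 0).sub (contDiff_snd.mul (h 1))).prodMk ((h' 1).add (contDiff_snd.mul (h 0)))

variable (D c) in
/-- The derivative of the tubular coordinates. -/
def tubeDeriv (z : ℝ × ℝ) : ℝ × ℝ →L[ℝ] ℝ × ℝ :=
  (Matrix.toLin (.finTwoProd ℝ) (.finTwoProd ℝ)
    !![D.jac c z * D.tangent c 0 z.1, -D.tangent c 1 z.1;
      D.jac c z * D.tangent c 1 z.1, D.tangent c 0 z.1]).toContinuousLinearMap

theorem det_tubeDeriv (z : ℝ × ℝ) : (D.tubeDeriv c z).det = D.jac c z := by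
  rw [tubeDeriv, LinearMap.det_toContinuousLinearMap, LinearMap.det_toLin, Matrix.det_fin_two_of]
  linear_combination D.jac c z * tangent_sq (c := c) z.1

theorem hasFDerivAt_tube (z : ℝ × ℝ) : HasFDerivAt (D.tube c) (D.tubeDeriv c z) z := by
  unfold tubeDeriv
  rw [Matrix.toLin_finTwoProd_toContinuousLinearMap]
  have h1 := ((hasDerivAt_M (c := c) 0 z.1).comp_hasFDerivAt z hasFDerivAt_fst).sub
    ((hasFDerivAt_snd (𝕜 := ℝ) (p := z)).mul
      ((hasDerivAt_tangent_one (c := c) z.1).comp_hasFDerivAt z hasFDerivAt_fst))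
  have h2 := ((hasDerivAt_M (c := c) 1 z.1).comp_hasFDerivAt z hasFDerivAt_fst).add
    ((hasFDerivAt_snd (𝕜 := ℝ) (p := z)).mul
      ((hasDerivAt_tangent_zero (c := c) z.1).comp_hasFDerivAt z hasFDerivAt_fst))
  refine (h1.prodMk h2).congr_fderiv ?_
  ext <;> simp [jac] <;> ring

variable (D c) in
/-- The derivative of the tubular coordinates as a linear equivalence, at points where the
Jacobian does not vanish. -/
def tubeDerivEquiv (z : ℝ × ℝ) (hz : D.jac c z ≠ 0) : (ℝ × ℝ) ≃L[ℝ] ℝ × ℝ :=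
  (D.tubeDeriv c z).toContinuousLinearEquivOfDetNeZero (by rwa [det_tubeDeriv])

theorem hasFDerivAt_tube_equiv (z : ℝ × ℝ) (hz : D.jac c z ≠ 0) :
    HasFDerivAt (D.tube c) (D.tubeDerivEquiv c z hz : ℝ × ℝ →L[ℝ] ℝ × ℝ) z :=
  hasFDerivAt_tube z

theorem jac_zero_ne (s : ℝ) : D.jac c (s, 0) ≠ 0 := by simp [jac]

theorem tube_zero (s : ℝ) : planeEquiv.symm (D.tube c (s, 0)) = D.M c s := by
  rw [tube_eq]; simp

theorem M_mem_frontier (s : ℝ) : D.M c s ∈ frontier D.Ω := by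
  rw [D.frontier_eq]
  exact mem_iUnion.2 ⟨c, mem_range_self s⟩

theorem exists_M_eq_of_mem_Icc (s : ℝ) :
    ∃ s' ∈ Icc (-(D.len c / 2)) (D.len c / 2), D.M c s' = D.M c s := by
  have hp : Function.Periodic (D.M c) (D.len c) := D.periodic c
  obtain ⟨y, hy, h⟩ := hp.exists_mem_Ico (D.len_pos c) s (-(D.len c / 2))
  exact ⟨y, ⟨hy.1, by linarith [hy.2]⟩, h.symm⟩

/-- Near the boundary point of parameter `0` the boundary consists of the points of small
parameter on the same component. -/
theorem eventually_frontier (c : Fin D.m) {η : ℝ} (hη : 0 < η) :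
    ∀ᶠ x in 𝓝 (D.M c 0), x ∈ frontier D.Ω → ∃ s, |s| < η ∧ x = D.M c s := by
  let K : Set Plane := ⋃ c', D.M c' ''
    (Icc (-(D.len c' / 2)) (D.len c' / 2) ∩ {s | c' = c → η ≤ |s|})
  have hK : IsCompact K := by
    refine isCompact_iUnion fun c' => IsCompact.image (isCompact_Icc.inter_right ?_)
      (D.smooth c').continuous
    by_cases h : c' = c
    · simpa [h] using isClosed_le continuous_const continuous_abs
    · simp [h]
  have h0 : D.M c 0 ∉ K := by
    intro h
    obtain ⟨c', s, ⟨hs1, hs2⟩, hs⟩ := mem_iUnion.1 h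
    obtain ⟨rfl, k, hk⟩ := D.embedded c c' 0 s hs.symm
    have hl := D.len_pos c
    have hs3 : |s| ≤ D.len c / 2 := abs_le.2 ⟨by linarith [hs1.1], hs1.2⟩
    have hk0 : k = 0 := by
      by_contra hk0
      have h1 : (1 : ℝ) ≤ |(k : ℝ)| := by exact_mod_cast Int.one_le_abs hk0
      rw [hk, zero_add, abs_mul, abs_of_pos hl] at hs3
      nlinarith
    rw [hk0] at hk
    have h2 := hs2 rfl
    rw [hk] at h2
    simp at h2
    linarith
  filter_upwards [hK.isClosed.isOpen_compl.mem_nhds h0] with x hx hxf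
  rw [D.frontier_eq] at hxf
  obtain ⟨c', s, rfl⟩ := mem_iUnion.1 hxf
  obtain ⟨s', hs', e⟩ := exists_M_eq_of_mem_Icc (c := c') s
  by_contra hcon
  refine hx (mem_iUnion.2 ⟨c', s', ⟨hs', fun hc => ?_⟩, e⟩)
  subst hc
  by_contra h1
  exact hcon ⟨s', not_le.1 h1, e.symm⟩

/-- A preconnected set that avoids the frontier of an open set and meets it is contained in it. -/
theorem _root_.IsPreconnected.subset_of_disjoint_frontier {X : Type*} [TopologicalSpace X]
    {S U : Set X} (hS : IsPreconnected S) (hU : IsOpen U) (hd : Disjoint S (frontier U))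
    (hne : (S ∩ U).Nonempty) : S ⊆ U := by
  refine hS.subset_left_of_subset_union hU isClosed_closure.isOpen_compl
    (disjoint_compl_right_iff_subset.2 subset_closure) (fun x hx => ?_) hne
  by_contra h
  simp only [mem_union, mem_compl_iff, not_or, not_not] at h
  refine hd.notMem_of_mem_left hx ?_
  rw [hU.frontier_eq]
  exact ⟨h.2, h.1⟩

/-- Tubular coordinates on a square of half-side `δ` around the boundary point of parameter `0`:
they are a diffeomorphism in which the domain is the upper half and the boundary is the axis. -/
structure IsTubular (D : SmoothDomain) (c : Fin D.m) (δ : ℝ)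
    (e : OpenPartialHomeomorph (ℝ × ℝ) (ℝ × ℝ)) : Prop where
  coe_eq : ⇑e = D.tube c
  source_eq : e.source = Ioo (-δ) δ ×ˢ Ioo (-δ) δ
  contDiffOn_symm : ContDiffOn ℝ ∞ e.symm e.target
  mem_iff : ∀ z ∈ e.source, planeEquiv.symm (D.tube c z) ∈ D.Ω ↔ 0 < z.2
  frontier : ∀ z ∈ e.source, planeEquiv.symm (D.tube c z) ∈ frontier D.Ω → z.2 = 0

/-- Tubular coordinates exist around the boundary point of parameter `0`. The inverse function
theorem gives the diffeomorphism. The frontier meets a small square only on the axis, so each open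
half of the square is connected and avoids the frontier; hence it lies in `Ω` or misses `Ω`, and
the sidedness at a single point decides which. -/
theorem exists_isTubular (c : Fin D.m) {ρ : ℝ} (hρ : 0 < ρ)
    (hjac : ∀ z : ℝ × ℝ, |z.2| < ρ → D.jac c z ≠ 0) :
    ∃ δ > 0, δ ≤ ρ ∧ ∃ e, D.IsTubular c δ e := by
  let e₀ := (contDiff_tube (D := D) (c := c)).contDiffAt.toOpenPartialHomeomorph (D.tube c)
    (a := ((0, 0) : ℝ × ℝ)) (hasFDerivAt_tube_equiv _ (jac_zero_ne 0)) (by simp)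
  have he₀ : ⇑e₀ = D.tube c := ContDiffAt.toOpenPartialHomeomorph_coe _ _ _
  have hmem : ((0, 0) : ℝ × ℝ) ∈ e₀.source :=
    ContDiffAt.mem_toOpenPartialHomeomorph_source _ _ _
  have box : ∀ U ∈ 𝓝 ((0, 0) : ℝ × ℝ), ∃ δ > 0, Ioo (-δ) δ ×ˢ Ioo (-δ) δ ⊆ U := by
    intro U hU
    obtain ⟨δ, hδ, h⟩ := Metric.mem_nhds_iff.1 hU
    refine ⟨δ, hδ, fun z hz => h ?_⟩
    rw [Metric.mem_ball, Prod.dist_eq, max_lt_iff, Real.dist_eq, Real.dist_eq, abs_lt, abs_lt]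
    simpa using hz
  obtain ⟨δ₀, hδ₀, hbox₀⟩ := box _ (e₀.open_source.mem_nhds hmem)
  have hcont : Continuous fun z => planeEquiv.symm (D.tube c z) :=
    planeEquiv.symm.continuous.comp contDiff_tube.continuous
  have hfr : ∀ᶠ z in 𝓝 ((0, 0) : ℝ × ℝ), planeEquiv.symm (D.tube c z) ∈ frontier D.Ω →
      ∃ s, |s| < δ₀ ∧ planeEquiv.symm (D.tube c z) = D.M c s := by
    have h := eventually_frontier c hδ₀
    rw [← tube_zero 0] at h
    exact hcont.continuousAt.eventually h
  obtain ⟨δ₁, hδ₁, hbox₁⟩ := box _ hfr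
  set δ := min ρ (min δ₀ δ₁) with hδdef
  have hδ : 0 < δ := by positivity
  have hsub : ∀ δ', δ ≤ δ' → Ioo (-δ) δ ×ˢ Ioo (-δ) δ ⊆ Ioo (-δ') δ' ×ˢ Ioo (-δ') δ' :=
    fun δ' h => prod_mono (Ioo_subset_Ioo (by linarith) h) (Ioo_subset_Ioo (by linarith) h)
  have hb₀ := (hsub δ₀ ((min_le_right _ _).trans (min_le_left _ _))).trans hbox₀
  have hb₁ := (hsub δ₁ ((min_le_right _ _).trans (min_le_right _ _))).trans hbox₁
  let S : Set (ℝ × ℝ) := Ioo (-δ) δ ×ˢ Ioo (-δ) δ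
  have hSo : IsOpen S := isOpen_Ioo.prod isOpen_Ioo
  let e := e₀.restrOpen S hSo
  have hes : e.source = S := by
    rw [OpenPartialHomeomorph.restrOpen_source]
    exact inter_eq_right.2 hb₀
  have hec : ⇑e = D.tube c := he₀
  have hfront : ∀ z ∈ S, planeEquiv.symm (D.tube c z) ∈ frontier D.Ω → z.2 = 0 := by
    intro z hz hzf
    obtain ⟨s, hs, h⟩ := hb₁ hz hzf
    rw [← tube_zero, planeEquiv.symm.injective.eq_iff, ← he₀] at h
    have h1 : (s, (0 : ℝ)) ∈ e₀.source :=
      hbox₀ ⟨⟨by linarith [(abs_lt.1 hs).1], (abs_lt.1 hs).2⟩, by simpa using hδ₀⟩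
    rw [e₀.injOn (hb₀ hz) h1 h]
  have side : ∀ J : Set ℝ, J ⊆ Ioo (-δ) δ → IsPreconnected J → 0 ∉ J →
      IsPreconnected ((fun z => planeEquiv.symm (D.tube c z)) '' (Ioo (-δ) δ ×ˢ J)) ∧
      Disjoint ((fun z => planeEquiv.symm (D.tube c z)) '' (Ioo (-δ) δ ×ˢ J))
        (_root_.frontier D.Ω) := by
    intro J hJ hJc hJ0
    refine ⟨(isPreconnected_Ioo.prod hJc).image _ hcont.continuousOn, ?_⟩
    rw [Set.disjoint_left]
    rintro _ ⟨z, hz, rfl⟩ hzf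
    have h1 := hfront z ⟨hz.1, hJ hz.2⟩ hzf
    exact hJ0 (h1 ▸ hz.2)
  obtain ⟨t, ht1, ht2, ht3⟩ : ∃ t ∈ Ioo 0 δ, planeEquiv.symm (D.tube c (0, t)) ∈ D.Ω ∧
      planeEquiv.symm (D.tube c (0, -t)) ∉ D.Ω := by
    obtain ⟨t, h1, h2⟩ := ((D.one_sided c 0).and (Ioo_mem_nhdsGT hδ)).exists
    refine ⟨t, h2, ?_⟩
    rw [tube_eq, tube_eq]
    simpa [sub_eq_add_neg] using h1
  have hplus : ∀ z ∈ S, 0 < z.2 → planeEquiv.symm (D.tube c z) ∈ D.Ω := by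
    intro z hz hz0
    obtain ⟨h1, h2⟩ := side (Ioo 0 δ) (Ioo_subset_Ioo (by linarith) le_rfl) isPreconnected_Ioo
      (by simp)
    exact h1.subset_of_disjoint_frontier D.isOpen h2
      ⟨_, ⟨(0, t), ⟨⟨by simpa using hδ, hδ⟩, ht1⟩, rfl⟩, ht2⟩ ⟨z, ⟨hz.1, hz0, hz.2.2⟩, rfl⟩
  have hminus : ∀ z ∈ S, z.2 < 0 → planeEquiv.symm (D.tube c z) ∉ D.Ω := by
    intro z hz hz0 hcon
    obtain ⟨h1, h2⟩ := side (Ioo (-δ) 0) (Ioo_subset_Ioo le_rfl hδ.le) isPreconnected_Ioo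
      (by simp)
    exact ht3 (h1.subset_of_disjoint_frontier D.isOpen h2
      ⟨_, ⟨z, ⟨hz.1, hz.2.1, hz0⟩, rfl⟩, hcon⟩ ⟨(0, -t), ⟨⟨by simpa using hδ, hδ⟩,
        by simpa using ht1.2, by simpa using ht1.1⟩, rfl⟩)
  refine ⟨δ, hδ, min_le_left _ _, e, hec, hes, ?_, fun z hz => ⟨fun h => ?_, fun h => ?_⟩,
    fun z hz h => hfront z (hes ▸ hz) h⟩
  · intro y hy
    have hz : e.symm y ∈ S := hes ▸ e.map_target hy
    have hj : D.jac c (e.symm y) ≠ 0 := by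
      refine hjac _ (abs_lt.2 ?_)
      have := min_le_left ρ (min δ₀ δ₁)
      exact ⟨by linarith [hz.2.1], by linarith [hz.2.2]⟩
    refine (e.contDiffAt_symm hy (f₀' := D.tubeDerivEquiv c _ hj) ?_ ?_).contDiffWithinAt
    · rw [hec]
      exact hasFDerivAt_tube_equiv _ hj
    · rw [hec]
      exact contDiff_tube.contDiffAt
  · rw [hes] at hz
    rcases lt_trichotomy z.2 0 with h0 | h0 | h0
    · exact absurd h (hminus z hz h0)
    · have h1 : planeEquiv.symm (D.tube c z) ∈ _root_.frontier D.Ω := by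
        rw [show z = (z.1, 0) from Prod.ext rfl h0, tube_zero]
        exact M_mem_frontier _
      rw [D.isOpen.frontier_eq] at h1
      exact absurd h h1.2
    · exact h0
  · exact hplus z (hes ▸ hz) h

end SmoothDomain

namespace SmoothDomain

/-! ### Calculus in tubular coordinates -/

variable {D : SmoothDomain} {c : Fin D.m}

variable (D c) in
/-- The point of the plane with tubular coordinates `z`. -/
def tubePoint (z : ℝ × ℝ) : Plane := planeEquiv.symm (D.tube c z)

theorem fderiv_eq_pd (ψ : Plane → ℝ) (x : Plane) (y : ℝ × ℝ) :
    fderiv ℝ ψ x (planeEquiv.symm y) = y.1 * pd 0 ψ x + y.2 * pd 1 ψ x := by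
  have e : planeEquiv.symm y
      = y.1 • EuclideanSpace.single 0 1 + y.2 • EuclideanSpace.single 1 1 := by
    refine planeEquiv.injective ?_
    rw [ContinuousLinearEquiv.apply_symm_apply, planeEquiv_apply]
    simp
  rw [e, map_add, map_smul, map_smul]
  rfl

theorem hasDerivAt_comp_tubePoint_fst {ψ : Plane → ℝ} (hψ : Differentiable ℝ ψ) (s t : ℝ) :
    HasDerivAt (fun s => ψ (D.tubePoint c (s, t)))
      (D.jac c (s, t) * (D.tangent c 0 s * pd 0 ψ (D.tubePoint c (s, t))
        + D.tangent c 1 s * pd 1 ψ (D.tubePoint c (s, t)))) s := by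
  have h1 : HasDerivAt (fun s => D.tube c (s, t))
      (D.jac c (s, t) * D.tangent c 0 s, D.jac c (s, t) * D.tangent c 1 s) s := by
    refine HasDerivAt.prodMk ?_ ?_
    · refine ((hasDerivAt_M 0 s).sub ((hasDerivAt_tangent_one s).const_mul t)).congr_deriv ?_
      simp only [jac]; ring
    · refine ((hasDerivAt_M 1 s).add ((hasDerivAt_tangent_zero s).const_mul t)).congr_deriv ?_
      simp only [jac]; ring
  have h2 := (planeEquiv.symm : (ℝ × ℝ) →L[ℝ] Plane).hasFDerivAt.comp_hasDerivAt s h1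
  refine ((hψ _).hasFDerivAt.comp_hasDerivAt s h2).congr_deriv ?_
  simp only [ContinuousLinearEquiv.coe_coe, fderiv_eq_pd, tubePoint, Function.comp_apply]
  ring

theorem hasDerivAt_comp_tubePoint_snd {ψ : Plane → ℝ} (hψ : Differentiable ℝ ψ) (s t : ℝ) :
    HasDerivAt (fun t => ψ (D.tubePoint c (s, t)))
      (-D.tangent c 1 s * pd 0 ψ (D.tubePoint c (s, t))
        + D.tangent c 0 s * pd 1 ψ (D.tubePoint c (s, t))) t := by
  have h1 : HasDerivAt (fun t => D.tube c (s, t)) (-D.tangent c 1 s, D.tangent c 0 s) t := by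
    refine HasDerivAt.prodMk ?_ ?_
    · refine (((hasDerivAt_id' t).mul_const (D.tangent c 1 s)).const_sub (D.M c s 0)).congr_deriv ?_
      simp
    · refine (((hasDerivAt_id' t).mul_const (D.tangent c 0 s)).const_add (D.M c s 1)).congr_deriv ?_
      simp
  have h2 := (planeEquiv.symm : (ℝ × ℝ) →L[ℝ] Plane).hasFDerivAt.comp_hasDerivAt t h1
  refine ((hψ _).hasFDerivAt.comp_hasDerivAt t h2).congr_deriv ?_
  simp only [ContinuousLinearEquiv.coe_coe, fderiv_eq_pd, tubePoint, Function.comp_apply]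

theorem hasDerivAt_jac_fst (s t : ℝ) :
    HasDerivAt (fun s => D.jac c (s, t)) (-(t * deriv (D.curvature c) s)) s :=
  ((contDiff_curvature.differentiable (by simp) s).hasDerivAt.const_mul t).const_sub 1

section Product

variable {φ : Plane → ℝ} (hφ : ContDiff ℝ ∞ φ) {S : Set (ℝ × ℝ)} (hS : IsOpen S)
  {g g₁ g₂ w w₁ w₂ : ℝ → ℝ} (hg : ∀ s, HasDerivAt g (g₁ s) s) (hg₁ : ∀ s, HasDerivAt g₁ (g₂ s) s)
  (hw : ∀ t, HasDerivAt w (w₁ t) t) (hw₁ : ∀ t, HasDerivAt w₁ (w₂ t) t)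
  (heq : ∀ z ∈ S, φ (D.tubePoint c z) = g z.1 * w z.2)

theorem eventually_fst {S : Set (ℝ × ℝ)} (hS : IsOpen S) {s t : ℝ} (h : (s, t) ∈ S) :
    ∀ᶠ s' in 𝓝 s, (s', t) ∈ S :=
  (by fun_prop : Continuous fun s' : ℝ => (s', t)).continuousAt.eventually (hS.mem_nhds h)

theorem eventually_snd {S : Set (ℝ × ℝ)} (hS : IsOpen S) {s t : ℝ} (h : (s, t) ∈ S) :
    ∀ᶠ t' in 𝓝 t, (s, t') ∈ S :=
  (by fun_prop : Continuous fun t' : ℝ => (s, t')).continuousAt.eventually (hS.mem_nhds h)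

include hφ hS hg heq in
theorem tangential_deriv_eq {s t : ℝ} (hz : (s, t) ∈ S) :
    g₁ s * w t = D.jac c (s, t) * (D.tangent c 0 s * pd 0 φ (D.tubePoint c (s, t))
        + D.tangent c 1 s * pd 1 φ (D.tubePoint c (s, t))) := by
  refine HasDerivAt.unique ?_
    (hasDerivAt_comp_tubePoint_fst (D := D) (c := c) (hφ.differentiable (by simp)) s t)
  refine ((hg s).mul_const (w t)).congr_of_eventuallyEq ?_
  filter_upwards [eventually_fst hS hz] with s' hs'
  exact heq _ hs'

include hφ hS hw heq in
theorem normal_deriv_eq {s t : ℝ} (hz : (s, t) ∈ S) :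
    g s * w₁ t = -D.tangent c 1 s * pd 0 φ (D.tubePoint c (s, t))
        + D.tangent c 0 s * pd 1 φ (D.tubePoint c (s, t)) := by
  refine HasDerivAt.unique ?_
    (hasDerivAt_comp_tubePoint_snd (D := D) (c := c) (hφ.differentiable (by simp)) s t)
  refine ((hw t).const_mul (g s)).congr_of_eventuallyEq ?_
  filter_upwards [eventually_snd hS hz] with t' ht'
  exact heq _ ht'

include hφ hS hg hg₁ hw hw₁ heq in
/-- The Laplacian in tubular coordinates,
`a Δ = ∂_s (a⁻¹ ∂_s) + ∂_t (a ∂_t)` with `a` the Jacobian, on a product function. -/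
theorem jac_mul_laplacian {s t : ℝ} (hz : (s, t) ∈ S) (hj : D.jac c (s, t) ≠ 0) :
    D.jac c (s, t) * laplacian φ (D.tubePoint c (s, t))
      = w t * (g₂ s / D.jac c (s, t)
          + t * deriv (D.curvature c) s * g₁ s / D.jac c (s, t) ^ 2)
        + g s * (D.jac c (s, t) * w₂ t - D.curvature c s * w₁ t) := by
  have hd : ∀ i, Differentiable ℝ (pd i φ) := fun i =>
    (contDiff_pd hφ i).differentiable (by simp)
  have e1 := tangential_deriv_eq hφ hS hg heq hz
  have e2 := normal_deriv_eq hφ hS hw heq hz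
  have d3 := ((hg₁ s).mul_const (w t)).congr_of_eventuallyEq
    ((eventually_fst hS hz).mono fun s' hs' => (tangential_deriv_eq hφ hS hg heq hs').symm)
  have e3 := d3.unique ((hasDerivAt_jac_fst (D := D) (c := c) s t).mul
    (((hasDerivAt_tangent_zero s).mul (hasDerivAt_comp_tubePoint_fst (hd 0) s t)).add
    ((hasDerivAt_tangent_one s).mul (hasDerivAt_comp_tubePoint_fst (hd 1) s t))))
  have d4 := ((hw₁ t).const_mul (g s)).congr_of_eventuallyEq
    ((eventually_snd hS hz).mono fun t' ht' => (normal_deriv_eq hφ hS hw heq ht').symm)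
  have e4 := d4.unique (((hasDerivAt_comp_tubePoint_snd (D := D) (c := c) (hd 0) s t).const_mul
    (-D.tangent c 1 s)).add
    ((hasDerivAt_comp_tubePoint_snd (hd 1) s t).const_mul (D.tangent c 0 s)))
  have hT := tangent_sq (c := c) s
  simp only [laplacian, Fin.sum_univ_two]
  set a := D.jac c (s, t)
  set κ := D.curvature c s
  set κ' := deriv (D.curvature c) s
  set T0 := D.tangent c 0 s
  set T1 := D.tangent c 1 s
  set x := D.tubePoint c (s, t)
  field_simp
  have hT' : T1 ^ 2 = 1 - T0 ^ 2 := by linarith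
  linear_combination (-a) * e3 - t * κ' * e1 - a ^ 3 * e4 + a ^ 2 * κ * e2
    - a ^ 3 * (pd 0 (pd 0 φ) x + pd 1 (pd 1 φ) x) * hT

end Product

/-! ### Functions supported in a tubular square -/

/-- The function on the plane that equals `F` in the coordinates `e` and vanishes elsewhere. -/
def ofTube (e : OpenPartialHomeomorph (ℝ × ℝ) (ℝ × ℝ)) (F : ℝ × ℝ → ℝ) (x : Plane) : ℝ :=
  e.target.indicator (fun y => F (e.symm y)) (planeEquiv x)

variable {δ : ℝ} {e : OpenPartialHomeomorph (ℝ × ℝ) (ℝ × ℝ)} (he : D.IsTubular c δ e)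
  {F : ℝ × ℝ → ℝ}

include he in
theorem ofTube_tubePoint {z : ℝ × ℝ} (hz : z ∈ e.source) :
    ofTube e F (D.tubePoint c z) = F z := by
  rw [ofTube, tubePoint, ContinuousLinearEquiv.apply_symm_apply, ← he.coe_eq,
    indicator_of_mem (e.map_source hz), e.left_inv hz]

theorem tsupport_ofTube_subset (hc : HasCompactSupport F) (hF : tsupport F ⊆ e.source) :
    HasCompactSupport (ofTube e F) ∧ tsupport (ofTube e F) ⊆ planeEquiv ⁻¹' e.target := by
  have hK : IsCompact (planeEquiv.symm '' (e '' tsupport F)) :=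
    (hc.isCompact.image_of_continuousOn (e.continuousOn.mono hF)).image
      planeEquiv.symm.continuous
  have h0 : ∀ x ∉ planeEquiv.symm '' (e '' tsupport F), ofTube e F x = 0 := by
    intro x hx
    by_cases hxt : planeEquiv x ∈ e.target
    · rw [ofTube, indicator_of_mem hxt]
      refine image_eq_zero_of_notMem_tsupport fun h => hx ?_
      exact ⟨planeEquiv x, ⟨_, h, e.right_inv hxt⟩, planeEquiv.symm_apply_apply x⟩
    · exact indicator_of_notMem hxt _
  have hs : tsupport (ofTube e F) ⊆ planeEquiv.symm '' (e '' tsupport F) := by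
    refine closure_minimal (fun x hx => ?_) hK.isClosed
    by_contra h
    exact hx (h0 x h)
  refine ⟨HasCompactSupport.intro hK h0, hs.trans ?_⟩
  rintro _ ⟨_, ⟨z, hz, rfl⟩, rfl⟩
  rw [mem_preimage, ContinuousLinearEquiv.apply_symm_apply]
  exact e.map_source (hF hz)

include he in
theorem ofTube_mem_testSpace (hFs : ContDiff ℝ ∞ F) (hc : HasCompactSupport F)
    (hF : tsupport F ⊆ e.source) : ofTube e F ∈ testSpace := by
  obtain ⟨h1, h2⟩ := tsupport_ofTube_subset hc hF
  refine ⟨contDiff_iff_contDiffAt.2 fun x => ?_, h1⟩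
  by_cases hx : x ∈ tsupport (ofTube e F)
  · have hxt := h2 hx
    have hopen := e.open_target.preimage planeEquiv.continuous
    have hd : ContDiffAt ℝ ∞ (fun x => F (e.symm (planeEquiv x))) x :=
      hFs.contDiffAt.comp x ((he.contDiffOn_symm.contDiffAt (e.open_target.mem_nhds hxt)).comp x
        planeEquiv.contDiff.contDiffAt)
    refine hd.congr_of_eventuallyEq ?_
    filter_upwards [hopen.mem_nhds hxt] with y hy
    exact indicator_of_mem (show planeEquiv y ∈ e.target from hy) fun y => F (e.symm y)
  · have h3 : ofTube e F =ᶠ[𝓝 x] fun _ => 0 := notMem_tsupport_iff_eventuallyEq.1 hx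
    exact contDiffAt_const.congr_of_eventuallyEq h3

theorem normal_eq_of_M_eq {c' : Fin D.m} {s s' : ℝ} (h : D.M c s = D.M c' s') :
    D.normal c s = D.normal c' s' := by
  obtain ⟨rfl, k, rfl⟩ := D.embedded c c' s s' h
  have hp : Function.Periodic (D.M c) (D.len c) := D.periodic c
  have e : (fun x => D.M c (x + k * D.len c)) = D.M c := funext fun x => hp.int_mul k x
  have h1 := deriv_comp_add_const (D.M c) (k * D.len c) s
  rw [e] at h1
  rw [normal, normal, h1]

include he in
/-- A product `g(s) w(t)` with `√h w'(0) = -w(0)` gives a function with the Robin condition. -/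
theorem robin_ofTube {h : ℝ} {g w w₁ : ℝ → ℝ} (hw : ∀ t, HasDerivAt w (w₁ t) t)
    (hFs : ContDiff ℝ ∞ fun z : ℝ × ℝ => g z.1 * w z.2)
    (hc : HasCompactSupport fun z : ℝ × ℝ => g z.1 * w z.2)
    (hF : tsupport (fun z : ℝ × ℝ => g z.1 * w z.2) ⊆ e.source) (hrobin : √h * w₁ 0 = -w 0) :
    (⟨ofTube e fun z : ℝ × ℝ => g z.1 * w z.2, ofTube_mem_testSpace he hFs hc hF⟩ : testSpace)
      ∈ D.robinTestSpace h := by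
  intro c' s
  obtain ⟨h1, h2⟩ := tsupport_ofTube_subset hc hF
  have hφ := (ofTube_mem_testSpace he hFs hc hF).1
  simp only
  set φ := ofTube e fun z : ℝ × ℝ => g z.1 * w z.2 with hφdef
  by_cases hx : D.M c' s ∈ tsupport φ
  · have hxt := h2 hx
    have hz := e.map_target hxt
    set z := e.symm (planeEquiv (D.M c' s)) with hzdef
    have hpt : D.tubePoint c z = D.M c' s := by
      rw [tubePoint, ← he.coe_eq, hzdef, e.right_inv hxt, ContinuousLinearEquiv.symm_apply_apply]
    have hz2 : z.2 = 0 := he.frontier z hz (by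
      have h3 : D.tubePoint c z ∈ frontier D.Ω := hpt ▸ M_mem_frontier s
      exact h3)
    have hz' : z = (z.1, 0) := Prod.ext rfl hz2
    have hM : D.M c z.1 = D.M c' s := by
      rw [← hpt, hz']
      exact (tube_zero z.1).symm
    have e1 := normal_deriv_eq hφ e.open_source hw (fun z hz => ofTube_tubePoint he hz)
      (hz' ▸ hz)
    have e2 : φ (D.tubePoint c z) = g z.1 * w z.2 := ofTube_tubePoint he hz
    rw [← hz', hpt] at e1
    rw [hpt, hz2] at e2
    rw [Fin.sum_univ_two, ← normal_eq_of_M_eq hM, normal_zero, normal_one, e2]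
    linear_combination √h * e1 - g z.1 * hrobin
  · have h3 : φ =ᶠ[𝓝 (D.M c' s)] fun _ => 0 := notMem_tsupport_iff_eventuallyEq.1 hx
    have h4 : fderiv ℝ φ (D.M c' s) = 0 := by rw [h3.fderiv_eq]; simp
    simp [pd, h4, h3.eq_of_nhds]

include he in
theorem box_subset_source : Ioo (-δ) δ ×ˢ Ioo 0 δ ⊆ e.source := by
  rw [he.source_eq]
  rintro z ⟨h1, h2⟩
  exact ⟨h1, by linarith [h2.1, h2.2], h2.2⟩

include he in
/-- Change of variables to tubular coordinates. -/
theorem setIntegral_eq_tube (hjac : ∀ z ∈ e.source, 0 ≤ D.jac c z) {f : Plane → ℝ}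
    (hf : ∀ x, planeEquiv x ∉ e.target → f x = 0) :
    ∫ x in D.Ω, f x
      = ∫ z in Ioo (-δ) δ ×ˢ Ioo 0 δ, D.jac c z * f (D.tubePoint c z) := by
  have hsub := box_subset_source he
  have himg : e.target ∩ planeEquiv.symm ⁻¹' D.Ω = D.tube c '' (Ioo (-δ) δ ×ˢ Ioo 0 δ) := by
    ext y
    constructor
    · rintro ⟨hy, hyΩ⟩
      have hz := e.map_target hy
      have hzy : D.tube c (e.symm y) = y := by rw [← he.coe_eq, e.right_inv hy]
      refine ⟨e.symm y, ?_, hzy⟩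
      have h1 := (he.mem_iff _ hz).1 (by rw [hzy]; exact hyΩ)
      rw [he.source_eq] at hz
      exact ⟨hz.1, h1, hz.2.2⟩
    · rintro ⟨z, hz, rfl⟩
      refine ⟨?_, (he.mem_iff z (hsub hz)).2 hz.2.1⟩
      rw [← he.coe_eq]
      exact e.map_source (hsub hz)
  have hmeas : MeasurableSet (planeEquiv ⁻¹' e.target) :=
    (e.open_target.preimage planeEquiv.continuous).measurableSet
  calc ∫ x in D.Ω, f x = ∫ x in D.Ω ∩ planeEquiv ⁻¹' e.target, f x := by
        rw [setIntegral_eq_of_subset_of_forall_sdiff_eq_zero D.isOpen.measurableSet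
          inter_subset_left]
        intro x hx
        exact hf x fun h => hx.2 ⟨hx.1, h⟩
    _ = ∫ x in planeEquiv ⁻¹' (e.target ∩ planeEquiv.symm ⁻¹' D.Ω),
          f (planeEquiv.symm (planeEquiv x)) := by
        simp only [ContinuousLinearEquiv.symm_apply_apply]
        congr 2
        ext x
        simp [and_comm]
    _ = ∫ y in e.target ∩ planeEquiv.symm ⁻¹' D.Ω, f (planeEquiv.symm y) :=
        measurePreserving_planeEquiv.setIntegral_preimage_emb
          planeEquiv.toHomeomorph.measurableEmbedding (fun y => f (planeEquiv.symm y)) _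
    _ = ∫ z in Ioo (-δ) δ ×ˢ Ioo 0 δ, |(D.tubeDeriv c z).det| • f (D.tubePoint c z) := by
        rw [himg]
        refine integral_image_eq_integral_abs_det_fderiv_smul volume
          (measurableSet_Ioo.prod measurableSet_Ioo)
          (fun z _ => (hasFDerivAt_tube z).hasFDerivWithinAt) ?_ _
        rw [← he.coe_eq]
        exact e.injOn.mono hsub
    _ = _ := by
        refine setIntegral_congr_fun (measurableSet_Ioo.prod measurableSet_Ioo) fun z hz => ?_
        rw [det_tubeDeriv, abs_of_nonneg (hjac z (hsub hz)), smul_eq_mul]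

end SmoothDomain

/-! ### Pointwise estimates of the trial functions -/

theorem abs_mul_le_mul {x y α β : ℝ} (hx : |x| ≤ α) (hy : |y| ≤ β) : |x * y| ≤ α * β := by
  rw [abs_mul]
  exact mul_le_mul hx hy (abs_nonneg _) ((abs_nonneg _).trans hx)

/-- The density that dominates all error terms, in terms of the values `G₀`, `G₁`, `G₂` at `σ` of
a function and of its first two derivatives. -/
def errDensity (σ G₀ G₁ G₂ : ℝ) : ℝ := (1 + σ ^ 2) ^ 2 * (G₀ ^ 2 + G₁ ^ 2 + G₂ ^ 2)

theorem abs_pow_le_weight (σ : ℝ) {k : ℕ} (hk : k ≤ 4) : |σ| ^ k ≤ (1 + σ ^ 2) ^ 2 := by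
  have h0 : 0 ≤ |σ| := abs_nonneg σ
  have h1 : σ ^ 2 = |σ| ^ 2 := (sq_abs σ).symm
  rw [h1]
  generalize |σ| = x at *
  interval_cases k <;> nlinarith [sq_nonneg (x - 1), sq_nonneg (x ^ 2 - 1), sq_nonneg (x * (x - 1)),
    mul_nonneg h0 (sq_nonneg (x - 1)), sq_nonneg x, sq_nonneg (x ^ 2), pow_nonneg h0 3]

set_option maxHeartbeats 1000000 in
/-- The tangential part: `-ε¹⁶ g (a⁻¹ g'' + t κ' a⁻² g')` is `-ε¹⁴ G G''` up to errors. Here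
`s = ε σ` and `t = ε⁴ τ` are the tubular coordinates, `a = 1 - t κ` is the Jacobian, and
`g(s) = χ(s) G(s / ε)`; the variables `X₀`, `X₁`, `X₂` and `Y₀`, `Y₁`, `Y₂` of this and the next
lemmas stand for the values of the cutoff `χ` and of its two derivatives at `s` and at `t`. -/
theorem tangential_le {ε σ τ G₀ G₁ G₂ X₀ X₁ X₂ κ κ₁ K : ℝ} (hε : 0 < ε) (hε1 : ε ≤ 1)
    (hτ : 0 ≤ τ) (hX₀ : 0 ≤ X₀) (hX₀' : X₀ ≤ 1) (hX₁ : |X₁| ≤ K) (hX₂ : |X₂| ≤ K)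
    (hX : 1 - X₀ ^ 2 ≤ K * |ε * σ|) (hκ : |κ| ≤ K) (hκ₁ : |κ₁| ≤ K)
    (ha : |ε ^ 4 * τ * κ| ≤ 1 / 2) :
    -ε ^ 16 * (X₀ * G₀) * ((X₂ * G₀ + 2 * (X₁ * G₁ / ε) + X₀ * G₂ / ε ^ 2) / (1 - ε ^ 4 * τ * κ)
        + ε ^ 4 * τ * κ₁ * (X₁ * G₀ + X₀ * G₁ / ε) / (1 - ε ^ 4 * τ * κ) ^ 2)
      ≤ ε ^ 14 * (-(G₀ * G₂))
        + (10 * K + 10 * K ^ 2) * (ε ^ 15 * (1 + τ) * errDensity σ G₀ G₁ G₂) := by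
  have hK : 0 ≤ K := (abs_nonneg κ).trans hκ
  set a := 1 - ε ^ 4 * τ * κ with hadef
  have ha2 : 1 / 2 ≤ a := by linarith [(abs_le.1 ha).2]
  have ha0 : a ≠ 0 := by linarith
  have hinv : |a⁻¹| ≤ 2 := by
    rw [abs_inv, abs_of_pos (by linarith)]
    exact (inv_le_comm₀ (by linarith) (by norm_num)).2 (by linarith)
  have hinv2 : |(a ^ 2)⁻¹| ≤ 4 := by
    rw [← inv_pow, abs_pow]
    nlinarith only [abs_nonneg a⁻¹, hinv]
  set m := G₀ ^ 2 + G₁ ^ 2 + G₂ ^ 2 with hm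
  set B := errDensity σ G₀ G₁ G₂ with hB
  have hX₀a : |X₀| ≤ 1 := by rwa [abs_of_nonneg hX₀]
  have hm0 : 0 ≤ m := by positivity
  have h00 : |G₀ * G₀| ≤ m := by
    rw [abs_le]; constructor <;> nlinarith only [sq_nonneg G₀, sq_nonneg G₁, sq_nonneg G₂]
  have h01 : |G₀ * G₁| ≤ m := by
    rw [abs_le]; constructor <;>
      nlinarith only [sq_nonneg (G₀ + G₁), sq_nonneg (G₀ - G₁), sq_nonneg G₂, sq_nonneg G₀]
  have h02 : |G₀ * G₂| ≤ m := by
    rw [abs_le]; constructor <;>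
      nlinarith only [sq_nonneg (G₀ + G₂), sq_nonneg (G₀ - G₂), sq_nonneg G₁, sq_nonneg G₀]
  have hmB : m ≤ B := by
    have := abs_pow_le_weight σ (k := 0) (by norm_num)
    rw [pow_zero] at this
    rw [hB, errDensity]
    exact le_mul_of_one_le_left hm0 this
  have hB0 : 0 ≤ B := hm0.trans hmB
  have hσB : |σ| * m ≤ B := by
    have := abs_pow_le_weight σ (k := 1) (by norm_num)
    rw [pow_one] at this
    rw [hB, errDensity]
    exact mul_le_mul_of_nonneg_right this hm0
  -- the quantities `ε² X₀ G₀ g''` and `ε X₀ G₀ g'`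
  have q2 : |ε ^ 2 * (X₀ * G₀) * (X₂ * G₀ + 2 * (X₁ * G₁ / ε) + X₀ * G₂ / ε ^ 2)|
      ≤ (3 * K + 1) * m := by
    have e : ε ^ 2 * (X₀ * G₀) * (X₂ * G₀ + 2 * (X₁ * G₁ / ε) + X₀ * G₂ / ε ^ 2)
        = ε ^ 2 * (X₀ * X₂ * (G₀ * G₀)) + ε * (2 * (X₀ * X₁ * (G₀ * G₁)))
          + X₀ * X₀ * (G₀ * G₂) := by
      field_simp
    have t1 := abs_mul_le_mul (abs_mul_le_mul hX₀a hX₂) h00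
    have t2 := abs_mul_le_mul (abs_mul_le_mul hX₀a hX₁) h01
    have t3 := abs_mul_le_mul (abs_mul_le_mul hX₀a hX₀a) h02
    have t1' := abs_mul_le_mul (show |ε ^ 2| ≤ 1 by
      rw [abs_of_pos (by positivity)]; exact pow_le_one₀ hε.le hε1) t1
    have t2' := abs_mul_le_mul (show |ε| ≤ 1 by rwa [abs_of_pos hε])
      (abs_mul_le_mul (show |(2 : ℝ)| ≤ 2 by norm_num) t2)
    rw [e]
    refine (abs_add_three _ _ _).trans ?_
    linarith only [t1', t2', t3]
  have q1 : |ε * (X₀ * G₀) * (X₁ * G₀ + X₀ * G₁ / ε)| ≤ (K + 1) * m := by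
    have e : ε * (X₀ * G₀) * (X₁ * G₀ + X₀ * G₁ / ε)
        = ε * (X₀ * X₁ * (G₀ * G₀)) + X₀ * X₀ * (G₀ * G₁) := by
      field_simp
    have t1 := abs_mul_le_mul (show |ε| ≤ 1 by rwa [abs_of_pos hε])
      (abs_mul_le_mul (abs_mul_le_mul hX₀a hX₁) h00)
    have t3 := abs_mul_le_mul (abs_mul_le_mul hX₀a hX₀a) h01
    rw [e]
    refine (abs_add_le _ _).trans ?_
    linarith only [t1, t3]
  -- the Jacobian is removed by `a⁻¹ = 1 + t κ a⁻¹`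
  have split : -ε ^ 16 * (X₀ * G₀)
        * ((X₂ * G₀ + 2 * (X₁ * G₁ / ε) + X₀ * G₂ / ε ^ 2) / a
        + ε ^ 4 * τ * κ₁ * (X₁ * G₀ + X₀ * G₁ / ε) / a ^ 2)
      = ε ^ 14 * (-(G₀ * G₂)) + ε ^ 14 * ((1 - X₀ ^ 2) * (G₀ * G₂))
        - ε ^ 15 * (2 * (X₀ * X₁ * (G₀ * G₁)) + ε * (X₀ * X₂ * (G₀ * G₀)))
        - ε ^ 18 * τ * ((κ * a⁻¹)
          * (ε ^ 2 * (X₀ * G₀) * (X₂ * G₀ + 2 * (X₁ * G₁ / ε) + X₀ * G₂ / ε ^ 2)))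
        - ε ^ 19 * τ * ((κ₁ * (a ^ 2)⁻¹) * (ε * (X₀ * G₀) * (X₁ * G₀ + X₀ * G₁ / ε))) := by
    field_simp
    rw [hadef]
    ring
  have p1 : (1 - X₀ ^ 2) * (G₀ * G₂) ≤ ε * (K * B) := by
    have h1 : 0 ≤ 1 - X₀ ^ 2 := sub_nonneg.2 (pow_le_one₀ hX₀ hX₀')
    have h2 := abs_mul_le_mul (show |1 - X₀ ^ 2| ≤ K * |ε * σ| by rwa [abs_of_nonneg h1]) h02
    rw [abs_mul ε, abs_of_pos hε] at h2
    refine (le_abs_self _).trans (h2.trans ?_)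
    calc K * (ε * |σ|) * m = ε * (K * (|σ| * m)) := by ring
      _ ≤ ε * (K * B) := by gcongr
  have p2 : |2 * (X₀ * X₁ * (G₀ * G₁)) + ε * (X₀ * X₂ * (G₀ * G₀))| ≤ 3 * K * B := by
    have t1 := abs_mul_le_mul (show |ε| ≤ 1 by rwa [abs_of_pos hε])
      (abs_mul_le_mul (abs_mul_le_mul hX₀a hX₂) h00)
    have t2 := abs_mul_le_mul (show |(2 : ℝ)| ≤ 2 by norm_num)
      (abs_mul_le_mul (abs_mul_le_mul hX₀a hX₁) h01)
    refine (abs_add_le _ _).trans ?_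
    have := mul_le_mul_of_nonneg_left hmB hK
    linarith only [t1, t2, this]
  have p3 := abs_mul_le_mul (abs_mul_le_mul hκ hinv) q2
  have p4 := abs_mul_le_mul (abs_mul_le_mul hκ₁ hinv2) q1
  have hpow : ∀ k, 15 ≤ k → ε ^ k ≤ ε ^ 15 := fun k hk => pow_le_pow_of_le_one hε.le hε1 hk
  have f1 : ε ^ 14 * ((1 - X₀ ^ 2) * (G₀ * G₂)) ≤ K * (ε ^ 15 * (1 + τ) * B) := by
    calc ε ^ 14 * ((1 - X₀ ^ 2) * (G₀ * G₂)) ≤ ε ^ 14 * (ε * (K * B)) := by gcongr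
      _ = K * (ε ^ 15 * 1 * B) := by ring
      _ ≤ K * (ε ^ 15 * (1 + τ) * B) := by gcongr; linarith
  have f2 : -(ε ^ 15 * (2 * (X₀ * X₁ * (G₀ * G₁)) + ε * (X₀ * X₂ * (G₀ * G₀))))
      ≤ 3 * K * (ε ^ 15 * (1 + τ) * B) := by
    rw [← mul_neg]
    calc _ ≤ ε ^ 15 * (3 * K * B) := by gcongr; exact (neg_le_abs _).trans p2
      _ = 3 * K * (ε ^ 15 * 1 * B) := by ring
      _ ≤ 3 * K * (ε ^ 15 * (1 + τ) * B) := by gcongr; linarith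
  have f3 : -(ε ^ 18 * τ * ((κ * a⁻¹)
          * (ε ^ 2 * (X₀ * G₀) * (X₂ * G₀ + 2 * (X₁ * G₁ / ε) + X₀ * G₂ / ε ^ 2))))
      ≤ (K * 2 * (3 * K + 1)) * (ε ^ 15 * (1 + τ) * B) := by
    rw [← mul_neg]
    calc _ ≤ ε ^ 18 * τ * (K * 2 * ((3 * K + 1) * m)) := by
          gcongr; exact (neg_le_abs _).trans p3
      _ = (K * 2 * (3 * K + 1)) * (ε ^ 18 * τ * m) := by ring
      _ ≤ (K * 2 * (3 * K + 1)) * (ε ^ 15 * (1 + τ) * B) := by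
          exact mul_le_mul_of_nonneg_left (mul_le_mul (mul_le_mul (hpow 18 (by norm_num))
            (by linarith only) hτ (by positivity)) hmB hm0 (by positivity)) (by positivity)
  have f4 : -(ε ^ 19 * τ * ((κ₁ * (a ^ 2)⁻¹) * (ε * (X₀ * G₀) * (X₁ * G₀ + X₀ * G₁ / ε))))
      ≤ (K * 4 * (K + 1)) * (ε ^ 15 * (1 + τ) * B) := by
    rw [← mul_neg]
    calc _ ≤ ε ^ 19 * τ * (K * 4 * ((K + 1) * m)) := by
          gcongr; exact (neg_le_abs _).trans p4
      _ = (K * 4 * (K + 1)) * (ε ^ 19 * τ * m) := by ring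
      _ ≤ (K * 4 * (K + 1)) * (ε ^ 15 * (1 + τ) * B) := by
          exact mul_le_mul_of_nonneg_left (mul_le_mul (mul_le_mul (hpow 19 (by norm_num))
            (by linarith only) hτ (by positivity)) hmB hm0 (by positivity)) (by positivity)
  rw [split]
  linarith only [f1, f2, f3, f4]

set_option maxHeartbeats 1000000 in
/-- The normal part: `-ε¹⁶ w (a w'' - κ w')` produces `-(ε⁸ + κ₀ ε¹²) a w²` and, from the Taylor
expansion of the curvature, the potential of the harmonic oscillator. -/
theorem normal_le {ε σ τ G₀ X₀ Y₀ Y₁ Y₂ κ κ₀ b K : ℝ} (G₁ G₂ : ℝ) (hε : 0 < ε) (hε1 : ε ≤ 1)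
    (hτ : 0 ≤ τ) (hX₀ : 0 ≤ X₀) (hX₀' : X₀ ≤ 1) (hY₀ : 0 ≤ Y₀) (hY₀' : Y₀ ≤ 1)
    (hY₁ : |Y₁| ≤ K * (ε ^ 4 * τ)) (hY₁' : |Y₁| ≤ K) (hY₂ : |Y₂| ≤ K)
    (hκ : |κ| ≤ K) (hκ₀ : κ₀ - b ^ 2 * (ε * σ) ^ 2 - K * |ε * σ| ^ 3 ≤ κ)
    (ha : |ε ^ 4 * τ * κ| ≤ 1 / 2) :
    -ε ^ 16 * ((X₀ * G₀) ^ 2 * Y₀) * ((1 - ε ^ 4 * τ * κ) * (Y₂ - 2 * Y₁ / ε ^ 4 + Y₀ / ε ^ 8)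
        - κ * (Y₁ - Y₀ / ε ^ 4))
      + (ε ^ 8 + κ₀ * ε ^ 12) * ((1 - ε ^ 4 * τ * κ) * (X₀ * G₀) ^ 2 * Y₀ ^ 2)
      ≤ ε ^ 14 * (b ^ 2 * σ ^ 2 * G₀ ^ 2) * Y₀ ^ 2
        + (8 * K + K ^ 2 + b ^ 2 * K) * (ε ^ 15 * (1 + τ) * errDensity σ G₀ G₁ G₂) := by
  have hK : 0 ≤ K := (abs_nonneg κ).trans hκ
  set a := 1 - ε ^ 4 * τ * κ with hadef
  have ha1 : 1 / 2 ≤ a := by linarith [(abs_le.1 ha).2]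
  have ha2 : a ≤ 2 := by linarith [(abs_le.1 ha).1]
  have ha3 : a ≤ 1 + K * (ε ^ 4 * τ) := by
    have h1 : ε ^ 4 * τ * (-κ) ≤ ε ^ 4 * τ * K := by gcongr; exact (neg_le_abs κ).trans hκ
    rw [hadef]; linarith
  set B := errDensity σ G₀ G₁ G₂ with hB
  set m := G₀ ^ 2 + G₁ ^ 2 + G₂ ^ 2 with hm
  have hm0 : 0 ≤ m := by positivity
  set q := (X₀ * G₀) ^ 2 with hq
  have hq0 : 0 ≤ q := by positivity
  have hqG : q ≤ G₀ ^ 2 := by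
    rw [hq, mul_pow]
    exact mul_le_of_le_one_left (sq_nonneg _) (pow_le_one₀ hX₀ hX₀')
  have hqm : q ≤ m := by
    rw [hm]; linarith only [hqG, sq_nonneg G₁, sq_nonneg G₂]
  have hweight : ∀ k, k ≤ 4 → |σ| ^ k * q ≤ B := fun k hk =>
    mul_le_mul (abs_pow_le_weight σ hk) hqm hq0 (by positivity)
  have hqB : q ≤ B := by simpa using hweight 0 (by norm_num)
  have hB0 : 0 ≤ B := hq0.trans hqB
  have hY2 : Y₀ ^ 2 ≤ 1 := pow_le_one₀ hY₀ hY₀'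
  have hpow : ∀ k, 15 ≤ k → ε ^ k ≤ ε ^ 15 := fun k hk => pow_le_pow_of_le_one hε.le hε1 hk
  have split : -ε ^ 16 * (q * Y₀) * (a * (Y₂ - 2 * Y₁ / ε ^ 4 + Y₀ / ε ^ 8)
        - κ * (Y₁ - Y₀ / ε ^ 4)) + (ε ^ 8 + κ₀ * ε ^ 12) * (a * q * Y₀ ^ 2)
      = ε ^ 12 * (q * Y₀ ^ 2) * (κ₀ * a - κ)
        - (q * Y₀) * (a * (ε ^ 16 * Y₂ - ε ^ 12 * (2 * Y₁)) - κ * (ε ^ 16 * Y₁)) := by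
    field_simp
    ring
  have p1 : κ₀ * a - κ ≤ b ^ 2 * (ε * σ) ^ 2 * (1 + K * (ε ^ 4 * τ)) + 2 * K * |ε * σ| ^ 3 := by
    have e : κ₀ * a - κ = (κ₀ - κ) * a - ε ^ 4 * τ * κ ^ 2 := by rw [hadef]; ring
    have h1 : 0 ≤ ε ^ 4 * τ * κ ^ 2 := by positivity
    have h2 : (κ₀ - κ) * a ≤ (b ^ 2 * (ε * σ) ^ 2 + K * |ε * σ| ^ 3) * a :=
      mul_le_mul_of_nonneg_right (by linarith) (by linarith)
    have h3 : b ^ 2 * (ε * σ) ^ 2 * a ≤ b ^ 2 * (ε * σ) ^ 2 * (1 + K * (ε ^ 4 * τ)) := by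
      gcongr
    have h4 : K * |ε * σ| ^ 3 * a ≤ K * |ε * σ| ^ 3 * 2 := by gcongr
    rw [e]
    linarith
  have p2 : |a * (ε ^ 16 * Y₂ - ε ^ 12 * (2 * Y₁)) - κ * (ε ^ 16 * Y₁)|
      ≤ (6 * K + K ^ 2) * (ε ^ 15 * (1 + τ)) := by
    have s1 : |ε ^ 16 * Y₂ - ε ^ 12 * (2 * Y₁)|
        ≤ ε ^ 16 * K + ε ^ 12 * (2 * (K * (ε ^ 4 * τ))) := by
      refine (abs_sub _ _).trans (add_le_add ?_ ?_)
      · exact abs_mul_le_mul (abs_of_pos (by positivity)).le hY₂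
      · exact abs_mul_le_mul (abs_of_pos (by positivity)).le
          (abs_mul_le_mul (by norm_num) hY₁)
    have s2 := abs_mul_le_mul (show |a| ≤ 2 by rwa [abs_of_pos (by linarith)]) s1
    have s3 := abs_mul_le_mul hκ
      (abs_mul_le_mul (show |ε ^ 16| ≤ ε ^ 16 from (abs_of_pos (by positivity)).le) hY₁')
    refine (abs_sub _ _).trans ((add_le_add s2 s3).trans ?_)
    have h1 : 2 * (ε ^ 16 * K + ε ^ 12 * (2 * (K * (ε ^ 4 * τ)))) + K * (ε ^ 16 * K)
        = ε ^ 16 * (2 * K + 4 * K * τ + K ^ 2) := by ring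
    have h2 : 2 * K + 4 * K * τ + K ^ 2 ≤ (6 * K + K ^ 2) * (1 + τ) := by
      linarith only [hK, mul_nonneg hK hτ, mul_nonneg (sq_nonneg K) hτ]
    rw [h1]
    calc ε ^ 16 * (2 * K + 4 * K * τ + K ^ 2) ≤ ε ^ 15 * ((6 * K + K ^ 2) * (1 + τ)) := by
          exact mul_le_mul (hpow 16 (by norm_num)) h2 (by positivity) (by positivity)
      _ = _ := by ring
  have f1 : ε ^ 12 * (q * Y₀ ^ 2) * (κ₀ * a - κ) ≤ ε ^ 14 * (b ^ 2 * σ ^ 2 * G₀ ^ 2) * Y₀ ^ 2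
      + (b ^ 2 * K) * (ε ^ 15 * (1 + τ) * B) + 2 * K * (ε ^ 15 * (1 + τ) * B) := by
    have e : ε ^ 12 * (q * Y₀ ^ 2) * (b ^ 2 * (ε * σ) ^ 2 * (1 + K * (ε ^ 4 * τ))
          + 2 * K * |ε * σ| ^ 3)
        = ε ^ 14 * (b ^ 2 * σ ^ 2 * q) * Y₀ ^ 2
          + (b ^ 2 * K) * (ε ^ 18 * τ * (|σ| ^ 2 * q * Y₀ ^ 2))
          + 2 * K * (ε ^ 15 * 1 * (|σ| ^ 3 * q * Y₀ ^ 2)) := by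
      rw [abs_mul, abs_of_pos hε, sq_abs]
      ring
    have h2 : |σ| ^ 2 * q * Y₀ ^ 2 ≤ B :=
      (mul_le_of_le_one_right (by positivity) hY2).trans (hweight 2 (by norm_num))
    have h3 : |σ| ^ 3 * q * Y₀ ^ 2 ≤ B :=
      (mul_le_of_le_one_right (by positivity) hY2).trans (hweight 3 (by norm_num))
    calc _ ≤ ε ^ 12 * (q * Y₀ ^ 2) * (b ^ 2 * (ε * σ) ^ 2 * (1 + K * (ε ^ 4 * τ))
          + 2 * K * |ε * σ| ^ 3) := by gcongr
      _ = _ := e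
      _ ≤ _ := by
        have r1 : ε ^ 14 * (b ^ 2 * σ ^ 2 * q) * Y₀ ^ 2
            ≤ ε ^ 14 * (b ^ 2 * σ ^ 2 * G₀ ^ 2) * Y₀ ^ 2 := by gcongr
        have r2 : ε ^ 18 * τ * (|σ| ^ 2 * q * Y₀ ^ 2) ≤ ε ^ 15 * (1 + τ) * B :=
          mul_le_mul (mul_le_mul (hpow 18 (by norm_num)) (by linarith only) hτ (by positivity)) h2
            (by positivity) (by positivity)
        have r3 : ε ^ 15 * 1 * (|σ| ^ 3 * q * Y₀ ^ 2) ≤ ε ^ 15 * (1 + τ) * B := by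
          gcongr
          linarith only [hτ]
        exact add_le_add (add_le_add r1 (mul_le_mul_of_nonneg_left r2 (by positivity)))
          (mul_le_mul_of_nonneg_left r3 (by positivity))
  have f2 : -((q * Y₀) * (a * (ε ^ 16 * Y₂ - ε ^ 12 * (2 * Y₁)) - κ * (ε ^ 16 * Y₁)))
      ≤ (6 * K + K ^ 2) * (ε ^ 15 * (1 + τ) * B) := by
    have h1 : |q * Y₀| ≤ B * 1 := abs_mul_le_mul (by rwa [abs_of_nonneg hq0])
      (by rwa [abs_of_nonneg hY₀])
    refine (neg_le_abs _).trans ((abs_mul_le_mul h1 p2).trans (le_of_eq ?_))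
    ring
  rw [split]
  linarith only [f1, f2]

/-- The pointwise form of the upper bound of the Rayleigh quotient, `r` being the value of
`exp (-τ)`. -/
theorem density_le {ε σ τ G₀ G₁ G₂ X₀ X₁ X₂ Y₀ Y₁ Y₂ κ κ₁ κ₀ b K r : ℝ} (hε : 0 < ε)
    (hε1 : ε ≤ 1) (hτ : 0 ≤ τ) (hX₀ : 0 ≤ X₀) (hX₀' : X₀ ≤ 1) (hX₁ : |X₁| ≤ K) (hX₂ : |X₂| ≤ K)
    (hX : 1 - X₀ ^ 2 ≤ K * |ε * σ|) (hY₀ : 0 ≤ Y₀) (hY₀' : Y₀ ≤ 1)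
    (hY₁ : |Y₁| ≤ K * (ε ^ 4 * τ)) (hY₁' : |Y₁| ≤ K) (hY₂ : |Y₂| ≤ K)
    (hκ : |κ| ≤ K) (hκ₁ : |κ₁| ≤ K) (hκ₀ : κ₀ - b ^ 2 * (ε * σ) ^ 2 - K * |ε * σ| ^ 3 ≤ κ)
    (ha : Y₀ ≠ 0 → |ε ^ 4 * τ * κ| ≤ 1 / 2) (hr : 0 ≤ r) :
    -ε ^ 16 * ((X₀ * G₀) * (Y₀ * r)
        * ((Y₀ * r) * ((X₂ * G₀ + 2 * (X₁ * G₁ / ε) + X₀ * G₂ / ε ^ 2) / (1 - ε ^ 4 * τ * κ)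
            + ε ^ 4 * τ * κ₁ * (X₁ * G₀ + X₀ * G₁ / ε) / (1 - ε ^ 4 * τ * κ) ^ 2)
          + (X₀ * G₀) * ((1 - ε ^ 4 * τ * κ) * ((Y₂ - 2 * Y₁ / ε ^ 4 + Y₀ / ε ^ 8) * r)
            - κ * ((Y₁ - Y₀ / ε ^ 4) * r))))
      + (ε ^ 8 + κ₀ * ε ^ 12) * ((1 - ε ^ 4 * τ * κ) * ((X₀ * G₀) * (Y₀ * r)) ^ 2)
      ≤ ε ^ 14 * ((-(G₀ * G₂) + b ^ 2 * σ ^ 2 * G₀ ^ 2) * (Y₀ * r) ^ 2)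
        + (18 * K + 11 * K ^ 2 + b ^ 2 * K)
          * (ε ^ 15 * (errDensity σ G₀ G₁ G₂ * ((1 + τ) * r ^ 2))) := by
  have hK : 0 ≤ K := (abs_nonneg κ).trans hκ
  have hB0 : 0 ≤ errDensity σ G₀ G₁ G₂ := by unfold errDensity; positivity
  rcases eq_or_ne Y₀ 0 with h0 | h0
  · subst h0
    have : 0 ≤ (18 * K + 11 * K ^ 2 + b ^ 2 * K)
          * (ε ^ 15 * (errDensity σ G₀ G₁ G₂ * ((1 + τ) * r ^ 2))) := by positivity
    simpa using this
  · have h1 := tangential_le (G₀ := G₀) (G₁ := G₁) (G₂ := G₂) hε hε1 hτ hX₀ hX₀' hX₁ hX₂ hX hκ hκ₁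
      (ha h0)
    have h2 := normal_le (G₀ := G₀) G₁ G₂ hε hε1 hτ hX₀ hX₀' hY₀ hY₀' hY₁ hY₁' hY₂ hκ hκ₀ (ha h0)
    have hY2 : Y₀ ^ 2 ≤ 1 := pow_le_one₀ hY₀ hY₀'
    have h3 := mul_le_mul_of_nonneg_left h1 (show 0 ≤ (Y₀ * r) ^ 2 by positivity)
    have h4 := mul_le_mul_of_nonneg_left h2 (show 0 ≤ r ^ 2 by positivity)
    have h5 : (Y₀ * r) ^ 2 * ((10 * K + 10 * K ^ 2)
          * (ε ^ 15 * (1 + τ) * errDensity σ G₀ G₁ G₂))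
        ≤ r ^ 2 * ((10 * K + 10 * K ^ 2) * (ε ^ 15 * (1 + τ) * errDensity σ G₀ G₁ G₂)) := by
      gcongr
      exact mul_le_of_le_one_left hr hY₀'
    rw [mul_add] at h3 h4
    linarith only [h3, h4, h5]

/-- The pointwise form of the lower bound of the norm. -/
theorem sq_density_ge {ε σ τ G₀ X₀ Y₀ κ K r : ℝ} (G₁ G₂ : ℝ) (hε : 0 < ε) (hε1 : ε ≤ 1)
    (hτ : 0 ≤ τ) (hX₀ : 0 ≤ X₀) (hX₀' : X₀ ≤ 1) (hX : 1 - X₀ ^ 2 ≤ K * |ε * σ|) (hY₀ : 0 ≤ Y₀)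
    (hY₀' : Y₀ ≤ 1) (hκ : |κ| ≤ K) :
    G₀ ^ 2 * (Y₀ * r) ^ 2
      - 2 * K * (ε * (errDensity σ G₀ G₁ G₂ * ((1 + τ) * r ^ 2)))
      ≤ (1 - ε ^ 4 * τ * κ) * ((X₀ * G₀) * (Y₀ * r)) ^ 2 := by
  have hK : 0 ≤ K := (abs_nonneg κ).trans hκ
  have hw : ∀ k, k ≤ 4 → |σ| ^ k * G₀ ^ 2 ≤ errDensity σ G₀ G₁ G₂ := fun k hk =>
    mul_le_mul (abs_pow_le_weight σ hk) (by linarith only [sq_nonneg G₁, sq_nonneg G₂])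
      (sq_nonneg _) (by positivity)
  set B := errDensity σ G₀ G₁ G₂
  have h0 : G₀ ^ 2 ≤ B := by simpa using hw 0 (by norm_num)
  have h1 : |σ| * G₀ ^ 2 ≤ B := by simpa using hw 1 (by norm_num)
  have hB0 : 0 ≤ B := (sq_nonneg _).trans h0
  have hY2 : Y₀ ^ 2 ≤ 1 := pow_le_one₀ hY₀ hY₀'
  have hX2 : X₀ ^ 2 ≤ 1 := pow_le_one₀ hX₀ hX₀'
  have hε4 : ε ^ 4 ≤ ε := by simpa using pow_le_pow_of_le_one hε.le hε1 (show 1 ≤ 4 by norm_num)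
  have e : G₀ ^ 2 * (Y₀ * r) ^ 2 - (1 - ε ^ 4 * τ * κ) * ((X₀ * G₀) * (Y₀ * r)) ^ 2
      = (Y₀ ^ 2 * r ^ 2) * ((1 - X₀ ^ 2) * G₀ ^ 2)
        + (Y₀ ^ 2 * r ^ 2) * (ε ^ 4 * τ * (κ * (X₀ ^ 2 * G₀ ^ 2))) := by ring
  have f1 : (1 - X₀ ^ 2) * G₀ ^ 2 ≤ ε * (K * B) := by
    rw [abs_mul, abs_of_pos hε] at hX
    calc (1 - X₀ ^ 2) * G₀ ^ 2 ≤ K * (ε * |σ|) * G₀ ^ 2 := by gcongr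
      _ = ε * (K * (|σ| * G₀ ^ 2)) := by ring
      _ ≤ ε * (K * B) := by gcongr
  have f2 : ε ^ 4 * τ * (κ * (X₀ ^ 2 * G₀ ^ 2)) ≤ ε * τ * (K * B) := by
    have h2 : κ * (X₀ ^ 2 * G₀ ^ 2) ≤ K * B :=
      mul_le_mul ((le_abs_self κ).trans hκ) ((mul_le_of_le_one_left (sq_nonneg _) hX2).trans h0)
        (by positivity) hK
    calc _ ≤ ε ^ 4 * τ * (K * B) := by gcongr
      _ ≤ ε * τ * (K * B) := by gcongr
  have f3 : (Y₀ ^ 2 * r ^ 2) * ((1 - X₀ ^ 2) * G₀ ^ 2)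
        + (Y₀ ^ 2 * r ^ 2) * (ε ^ 4 * τ * (κ * (X₀ ^ 2 * G₀ ^ 2)))
      ≤ (1 * r ^ 2) * (ε * (K * B) + ε * τ * (K * B)) := by
    rw [← mul_add]
    calc _ ≤ (Y₀ ^ 2 * r ^ 2) * (ε * (K * B) + ε * τ * (K * B)) := by gcongr
      _ ≤ _ := by gcongr
  have f4 : (1 * r ^ 2) * (ε * (K * B) + ε * τ * (K * B))
      = K * (ε * (B * ((1 + τ) * r ^ 2))) := by ring
  have f5 : 0 ≤ K * (ε * (B * ((1 + τ) * r ^ 2))) := by positivity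
  linarith

/-! ### The trial functions and their energy -/

section GaussFn

open Polynomial

/-- A polynomial times the Gaussian `exp (-b x² / 2)`. -/
def gaussFn (b : ℝ) (p : ℝ[X]) (x : ℝ) : ℝ := p.eval x * Real.exp (-b / 2 * x ^ 2)

/-- The polynomial factor of the derivative of `gaussFn b p`. -/
def gaussStep (b : ℝ) (p : ℝ[X]) : ℝ[X] := derivative p + C (-b) * (X * p)

theorem hasDerivAt_gaussFn (b : ℝ) (p : ℝ[X]) (x : ℝ) :
    HasDerivAt (gaussFn b p) (gaussFn b (gaussStep b p) x) x := by
  have h2 : HasDerivAt (fun x : ℝ => Real.exp (-b / 2 * x ^ 2))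
      (Real.exp (-b / 2 * x ^ 2) * (-b / 2 * (2 * x))) x := by
    simpa using (((hasDerivAt_id x).pow 2).const_mul (-b / 2)).exp
  refine ((p.hasDerivAt x).mul h2).congr_deriv ?_
  simp only [gaussFn, gaussStep, eval_add, eval_mul, eval_C, eval_X]
  ring

theorem contDiff_gaussFn (b : ℝ) (p : ℝ[X]) : ContDiff ℝ ∞ (gaussFn b p) := by
  have h : ContDiff ℝ ∞ fun x : ℝ => p.eval x := by
    have e : (fun x : ℝ => p.eval x) = fun x => aeval x p := by
      funext x
      rw [coe_aeval_eq_eval]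
    rw [e]
    exact p.contDiff_aeval ∞
  exact h.mul (by fun_prop)

theorem gaussFn_mul (b : ℝ) (p q : ℝ[X]) (x : ℝ) :
    gaussFn b p x * gaussFn b q x = (p * q).eval x * Real.exp (-b * x ^ 2) := by
  rw [eval_mul, show -b * x ^ 2 = -b / 2 * x ^ 2 + -b / 2 * x ^ 2 by ring, Real.exp_add]
  simp only [gaussFn]
  ring

/-- The energy density `-u u'' + b² x² u²` of the harmonic oscillator at `u = gaussFn b p`. -/
def oscDensity (b : ℝ) (p : ℝ[X]) (x : ℝ) : ℝ :=
  -(gaussFn b p x * gaussFn b (gaussStep b (gaussStep b p)) x) + b ^ 2 * x ^ 2 * gaussFn b p x ^ 2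

theorem oscDensity_eq (b : ℝ) (p : ℝ[X]) (x : ℝ) : oscDensity b p x
    = ((C (2 * b) * X * derivative p - derivative (derivative p)) * p + C b * p ^ 2).eval x
      * Real.exp (-b * x ^ 2) := by
  rw [oscDensity, sq (gaussFn b p x), gaussFn_mul, gaussFn_mul]
  simp only [gaussStep, derivative_add, derivative_mul, derivative_C, derivative_X, eval_add,
    eval_mul, eval_sub, eval_C, eval_X, eval_pow, eval_zero, eval_one]
  ring

theorem integrable_oscDensity {b : ℝ} (hb : 0 < b) (p : ℝ[X]) : Integrable (oscDensity b p) :=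
  (integrable_eval_mul_gaussian hb _).congr
    (Eventually.of_forall fun x => (oscDensity_eq b p x).symm)

/-- On polynomials of degree at most `m` times the Gaussian ground state the energy of the harmonic
oscillator `-∂² + b² x²` is at most its `m`-th level, counted from zero. -/
theorem integral_oscDensity_le {b : ℝ} (hb : 0 < b) {m : ℕ} {p : ℝ[X]} (hp : p.natDegree ≤ m) :
    ∫ x, oscDensity b p x ≤ (2 * m + 1) * b * gaussInt hb (p ^ 2) := by
  simp only [oscDensity_eq]
  rw [← gaussInt_apply hb, map_add, gaussInt_hermite_mul, ← smul_eq_C_mul, map_smul, smul_eq_mul,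
    ← sq]
  have := gaussInt_derivative_sq_le hb m p hp
  linarith

/-- The error density along `gaussFn b p`. -/
def gaussErr (b : ℝ) (p : ℝ[X]) (x : ℝ) : ℝ :=
  errDensity x (gaussFn b p x) (gaussFn b (gaussStep b p) x)
    (gaussFn b (gaussStep b (gaussStep b p)) x)

theorem gaussErr_nonneg (b : ℝ) (p : ℝ[X]) (x : ℝ) : 0 ≤ gaussErr b p x := by
  unfold gaussErr errDensity
  positivity

/-- The polynomial `(1 + X²) q`. -/
def weightMul (q : ℝ[X]) : ℝ[X] := q + X * (X * q)

theorem gaussErr_eq (b : ℝ) (p : ℝ[X]) (x : ℝ) : gaussErr b p x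
    = (weightMul p ^ 2 + weightMul (gaussStep b p) ^ 2
        + weightMul (gaussStep b (gaussStep b p)) ^ 2).eval x * Real.exp (-b * x ^ 2) := by
  simp only [gaussErr, errDensity, sq (gaussFn _ _ _), gaussFn_mul]
  simp only [weightMul, eval_add, eval_mul, eval_X, eval_pow]
  ring

theorem integrable_gaussErr {b : ℝ} (hb : 0 < b) (p : ℝ[X]) : Integrable (gaussErr b p) :=
  (integrable_eval_mul_gaussian hb _).congr
    (Eventually.of_forall fun x => (gaussErr_eq b p x).symm)

theorem exists_integral_gaussErr_le {b : ℝ} (hb : 0 < b) (m : ℕ) :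
    ∃ c, 0 ≤ c ∧ ∀ p : ℝ[X], p.natDegree ≤ m →
      ∫ x, gaussErr b p x ≤ c * gaussInt hb (p ^ 2) := by
  have step : ∀ {T : ℝ[X] → ℝ[X]}, GaussBounded hb T →
      GaussBounded hb (fun p => gaussStep b (T p)) := fun hT =>
    (hT.derivative hb).add hb ((hT.X_mul hb).C_mul hb (-b))
  have weight : ∀ {T : ℝ[X] → ℝ[X]}, GaussBounded hb T →
      GaussBounded hb (fun p => weightMul (T p)) := fun hT =>
    hT.add hb ((hT.X_mul hb).X_mul hb)
  have h0 := GaussBounded.id hb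
  obtain ⟨_, c₀, hc₀, h₀⟩ := weight h0 m
  obtain ⟨_, c₁, hc₁, h₁⟩ := weight (step h0) m
  obtain ⟨_, c₂, hc₂, h₂⟩ := weight (step (step h0)) m
  refine ⟨c₀ + c₁ + c₂, by positivity, fun p hp => ?_⟩
  simp only [gaussErr_eq]
  rw [← gaussInt_apply hb, map_add, map_add]
  linarith [(h₀ p hp).2, (h₁ p hp).2, (h₂ p hp).2]

end GaussFn

/-- A cutoff `χ` of the line with values in `[0, 1]`, its first two derivatives `χ₁` and `χ₂`, and
a common bound `K`: it is supported in `[-δ, δ]`, and it is `1` with vanishing derivative at the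
origin, in the quantitative form `abs₁_le_mul` and `one_sub_sq_le`. -/
structure IsCutoff (δ K : ℝ) (χ χ₁ χ₂ : ℝ → ℝ) : Prop where
  hasDerivAt : ∀ x, HasDerivAt χ (χ₁ x) x
  hasDerivAt₁ : ∀ x, HasDerivAt χ₁ (χ₂ x) x
  continuous₂ : Continuous χ₂
  nonneg : ∀ x, 0 ≤ χ x
  le_one : ∀ x, χ x ≤ 1
  abs₁_le : ∀ x, |χ₁ x| ≤ K
  abs₁_le_mul : ∀ x, |χ₁ x| ≤ K * |x|
  abs₂_le : ∀ x, |χ₂ x| ≤ K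
  one_sub_sq_le : ∀ x, 1 - χ x ^ 2 ≤ K * |x|
  eq_zero : ∀ x, δ ≤ |x| → χ x = 0

/-- Global bounds for a function `κ` that has a quadratic maximum `κ₀` at `0`, and for a second
function `κ₁` that stands for its derivative. Only the lower bound by the Taylor polynomial is
needed for an upper bound of the eigenvalues. -/
structure IsPeak (κ₀ b K : ℝ) (κ κ₁ : ℝ → ℝ) : Prop where
  continuous : Continuous κ
  continuous₁ : Continuous κ₁
  abs_le : ∀ s, |κ s| ≤ K
  abs₁_le : ∀ s, |κ₁ s| ≤ K
  taylor : ∀ s, κ₀ - b ^ 2 * s ^ 2 - K * |s| ^ 3 ≤ κ s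

section Trial

open Polynomial

variable (χ χ₁ χ₂ : ℝ → ℝ) (b : ℝ) (p : ℝ[X]) (ε : ℝ)

/-- The tangential factor of the trial function. It lives on the scale `ε = h^{1/8}` of the harmonic
oscillator `-h² ∂² + b² h^{3/2} s²`. -/
def trialS (s : ℝ) : ℝ := χ s * gaussFn b p (s / ε)

/-- The derivative of the tangential factor. -/
def trialS₁ (s : ℝ) : ℝ := χ₁ s * gaussFn b p (s / ε) + χ s * gaussFn b (gaussStep b p) (s / ε) / ε

/-- The second derivative of the tangential factor. -/
def trialS₂ (s : ℝ) : ℝ := χ₂ s * gaussFn b p (s / ε)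
  + 2 * (χ₁ s * gaussFn b (gaussStep b p) (s / ε) / ε)
  + χ s * gaussFn b (gaussStep b (gaussStep b p)) (s / ε) / ε ^ 2

/-- The normal factor of the trial function: up to the cutoff the ground state `exp (-t / √h)` of
the Robin problem on the half-line, with `√h = ε⁴`. -/
def trialT (t : ℝ) : ℝ := χ t * Real.exp (-(t / ε ^ 4))

/-- The derivative of the normal factor. -/
def trialT₁ (t : ℝ) : ℝ := (χ₁ t - χ t / ε ^ 4) * Real.exp (-(t / ε ^ 4))

/-- The second derivative of the normal factor. -/
def trialT₂ (t : ℝ) : ℝ := (χ₂ t - 2 * χ₁ t / ε ^ 4 + χ t / ε ^ 8) * Real.exp (-(t / ε ^ 4))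

variable {χ χ₁ χ₂}

theorem hasDerivAt_gaussFn_div (s : ℝ) : HasDerivAt (fun s => gaussFn b p (s / ε))
    (gaussFn b (gaussStep b p) (s / ε) / ε) s := by
  have h := (hasDerivAt_gaussFn b p (s / ε)).comp s ((hasDerivAt_id' s).div_const ε)
  refine h.congr_deriv ?_
  ring

theorem hasDerivAt_trialS {δ K : ℝ} (hχ : IsCutoff δ K χ χ₁ χ₂) (s : ℝ) :
    HasDerivAt (trialS χ b p ε) (trialS₁ χ χ₁ b p ε s) s := by
  refine ((hχ.hasDerivAt s).mul (hasDerivAt_gaussFn_div b p ε s)).congr_deriv ?_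
  simp only [trialS₁]
  ring

theorem hasDerivAt_trialS₁ {δ K : ℝ} (hχ : IsCutoff δ K χ χ₁ χ₂) (s : ℝ) :
    HasDerivAt (trialS₁ χ χ₁ b p ε) (trialS₂ χ χ₁ χ₂ b p ε s) s := by
  refine (((hχ.hasDerivAt₁ s).mul (hasDerivAt_gaussFn_div b p ε s)).add
    (((hχ.hasDerivAt s).mul (hasDerivAt_gaussFn_div b (gaussStep b p) ε s)).div_const
      ε)).congr_deriv ?_
  simp only [trialS₂]
  ring

theorem hasDerivAt_exp_div (t : ℝ) : HasDerivAt (fun t => Real.exp (-(t / ε ^ 4)))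
    (-(1 / ε ^ 4) * Real.exp (-(t / ε ^ 4))) t := by
  refine ((hasDerivAt_id' t).div_const (ε ^ 4)).neg.exp.congr_deriv ?_
  simp only [Pi.neg_apply]
  ring

theorem hasDerivAt_trialT {δ K : ℝ} (hχ : IsCutoff δ K χ χ₁ χ₂) (t : ℝ) :
    HasDerivAt (trialT χ ε) (trialT₁ χ χ₁ ε t) t := by
  refine ((hχ.hasDerivAt t).mul (hasDerivAt_exp_div ε t)).congr_deriv ?_
  simp only [trialT₁]
  ring

theorem hasDerivAt_trialT₁ {δ K : ℝ} (hχ : IsCutoff δ K χ χ₁ χ₂) (t : ℝ) :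
    HasDerivAt (trialT₁ χ χ₁ ε) (trialT₂ χ χ₁ χ₂ ε t) t := by
  refine (((hχ.hasDerivAt₁ t).sub ((hχ.hasDerivAt t).div_const (ε ^ 4))).mul
    (hasDerivAt_exp_div ε t)).congr_deriv ?_
  simp only [trialT₂, Pi.sub_apply]
  ring

variable (χ χ₁ χ₂)

/-- The density of the squared norm of the trial function in tubular coordinates `(s, t)`, with
the Jacobian included. -/
def normDensity (κ : ℝ → ℝ) (z : ℝ × ℝ) : ℝ :=
  (1 - z.2 * κ z.1) * (trialS χ b p ε z.1 * trialT χ ε z.2) ^ 2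

/-- The density of `⟨-h² Δ u, u⟩` for the trial function `u` in tubular coordinates `(s, t)`, with
`h = ε⁸` and the Jacobian included. -/
def energyDensity (κ κ₁ : ℝ → ℝ) (z : ℝ × ℝ) : ℝ :=
  -ε ^ 16 * (trialS χ b p ε z.1 * trialT χ ε z.2
    * (trialT χ ε z.2 * (trialS₂ χ χ₁ χ₂ b p ε z.1 / (1 - z.2 * κ z.1)
        + z.2 * κ₁ z.1 * trialS₁ χ χ₁ b p ε z.1 / (1 - z.2 * κ z.1) ^ 2)
      + trialS χ b p ε z.1 * ((1 - z.2 * κ z.1) * trialT₂ χ χ₁ χ₂ ε z.2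
        - κ z.1 * trialT₁ χ χ₁ ε z.2)))

variable {χ χ₁ χ₂} {δ K κ₀ ε} {κ κ₁ : ℝ → ℝ}

/-- One factor `exp (-τ)` absorbs the growth of the errors in the normal direction. -/
theorem exp_weight_le {τ : ℝ} : (1 + τ) * Real.exp (-τ) ^ 2 ≤ Real.exp (-τ) := by
  have h1 : (1 + τ) * Real.exp (-τ) ≤ 1 := by
    have := Real.add_one_le_exp τ
    calc (1 + τ) * Real.exp (-τ) ≤ Real.exp τ * Real.exp (-τ) := by
          gcongr; linarith
      _ = 1 := by rw [← Real.exp_add]; simp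
  calc (1 + τ) * Real.exp (-τ) ^ 2 = (1 + τ) * Real.exp (-τ) * Real.exp (-τ) := by ring
    _ ≤ 1 * Real.exp (-τ) := by gcongr
    _ = _ := one_mul _

theorem energyDensity_le (hχ : IsCutoff δ K χ χ₁ χ₂) (hκ : IsPeak κ₀ b K κ κ₁)
    (hδ : ∀ s, δ * |κ s| ≤ 1 / 2) (hε : ε ∈ Ioo (0 : ℝ) 1) {z : ℝ × ℝ} (hz : 0 < z.2) :
    energyDensity χ χ₁ χ₂ b p ε κ κ₁ z + (ε ^ 8 + κ₀ * ε ^ 12) * normDensity χ b p ε κ z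
      ≤ ε ^ 14 * (oscDensity b p (z.1 / ε) * trialT χ ε z.2 ^ 2)
        + (18 * K + 11 * K ^ 2 + b ^ 2 * K)
          * (ε ^ 15 * (gaussErr b p (z.1 / ε) * Real.exp (-(z.2 / ε ^ 4)))) := by
  obtain ⟨s, t⟩ := z
  simp only at hz ⊢
  have hε0 : ε ≠ 0 := hε.1.ne'
  have hK : 0 ≤ K := (abs_nonneg _).trans (hκ.abs_le 0)
  have e1 : ε * (s / ε) = s := mul_div_cancel₀ s hε0
  have e2 : ε ^ 4 * (t / ε ^ 4) = t := mul_div_cancel₀ t (pow_ne_zero 4 hε0)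
  have hτ : 0 ≤ t / ε ^ 4 := div_nonneg hz.le (pow_nonneg hε.1.le 4)
  have h := density_le (ε := ε) (σ := s / ε) (τ := t / ε ^ 4) (G₀ := gaussFn b p (s / ε))
    (G₁ := gaussFn b (gaussStep b p) (s / ε))
    (G₂ := gaussFn b (gaussStep b (gaussStep b p)) (s / ε))
    (X₀ := χ s) (X₁ := χ₁ s) (X₂ := χ₂ s) (Y₀ := χ t) (Y₁ := χ₁ t) (Y₂ := χ₂ t) (κ := κ s)
    (κ₁ := κ₁ s) (κ₀ := κ₀) (b := b) (K := K) (r := Real.exp (-(t / ε ^ 4)))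
    hε.1 hε.2.le hτ (hχ.nonneg s) (hχ.le_one s) (hχ.abs₁_le s) (hχ.abs₂_le s)
    (by rw [e1]; exact hχ.one_sub_sq_le s) (hχ.nonneg t) (hχ.le_one t)
    (by rw [e2]; simpa [abs_of_pos hz] using hχ.abs₁_le_mul t) (hχ.abs₁_le t) (hχ.abs₂_le t)
    (hκ.abs_le s) (hκ.abs₁_le s) (by rw [e1]; exact hκ.taylor s)
    (by
      intro hY
      rw [e2, abs_mul]
      have h1 : |t| ≤ δ := by
        by_contra h2
        exact hY (hχ.eq_zero t (not_le.1 h2).le)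
      exact (mul_le_mul_of_nonneg_right h1 (abs_nonneg _)).trans (hδ s))
    (Real.exp_nonneg _)
  rw [e2] at h
  refine h.trans (add_le_add le_rfl ?_)
  have h0 : 0 ≤ errDensity (s / ε) (gaussFn b p (s / ε)) (gaussFn b (gaussStep b p) (s / ε))
    (gaussFn b (gaussStep b (gaussStep b p)) (s / ε)) := gaussErr_nonneg b p (s / ε)
  have hpos := hε.1
  unfold gaussErr
  gcongr
  exact exp_weight_le

theorem normDensity_ge (hχ : IsCutoff δ K χ χ₁ χ₂) (hκ : IsPeak κ₀ b K κ κ₁)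
    (hε : ε ∈ Ioo (0 : ℝ) 1) {z : ℝ × ℝ} (hz : 0 < z.2) :
    gaussFn b p (z.1 / ε) ^ 2 * trialT χ ε z.2 ^ 2
      - 2 * K * (ε * (gaussErr b p (z.1 / ε) * Real.exp (-(z.2 / ε ^ 4))))
      ≤ normDensity χ b p ε κ z := by
  obtain ⟨s, t⟩ := z
  simp only at hz ⊢
  have hε0 : ε ≠ 0 := hε.1.ne'
  have hK : 0 ≤ K := (abs_nonneg _).trans (hκ.abs_le 0)
  have e1 : ε * (s / ε) = s := mul_div_cancel₀ s hε0
  have e2 : ε ^ 4 * (t / ε ^ 4) = t := mul_div_cancel₀ t (pow_ne_zero 4 hε0)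
  have hτ : 0 ≤ t / ε ^ 4 := div_nonneg hz.le (pow_nonneg hε.1.le 4)
  have h := sq_density_ge (ε := ε) (σ := s / ε) (τ := t / ε ^ 4) (G₀ := gaussFn b p (s / ε))
    (gaussFn b (gaussStep b p) (s / ε))
    (gaussFn b (gaussStep b (gaussStep b p)) (s / ε))
    (X₀ := χ s) (Y₀ := χ t) (κ := κ s) (K := K) (r := Real.exp (-(t / ε ^ 4)))
    hε.1 hε.2.le hτ (hχ.nonneg s) (hχ.le_one s)
    (by rw [e1]; exact hχ.one_sub_sq_le s) (hχ.nonneg t) (hχ.le_one t) (hκ.abs_le s)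
  rw [e2] at h
  refine le_trans (sub_le_sub le_rfl ?_) h
  have h0 : 0 ≤ errDensity (s / ε) (gaussFn b p (s / ε)) (gaussFn b (gaussStep b p) (s / ε))
    (gaussFn b (gaussStep b (gaussStep b p)) (s / ε)) := gaussErr_nonneg b p (s / ε)
  have hpos := hε.1
  unfold gaussErr
  gcongr
  exact exp_weight_le

/-! ### Integration of the densities -/

theorem restrict_halfPlane : (volume : Measure (ℝ × ℝ)).restrict (univ ×ˢ Ioi 0)
    = (volume : Measure ℝ).prod ((volume : Measure ℝ).restrict (Ioi 0)) := by
  rw [Measure.volume_eq_prod, ← Measure.prod_restrict, Measure.restrict_univ]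

theorem box_subset_halfPlane :
    Ioo (-δ) δ ×ˢ Ioo 0 δ ⊆ (univ : Set ℝ) ×ˢ Ioi (0 : ℝ) := fun _ hz => ⟨trivial, hz.2.1⟩

theorem trial_mul_eq_zero (hχ : IsCutoff δ K χ χ₁ χ₂) {z : ℝ × ℝ}
    (hz : z ∈ ((univ : Set ℝ) ×ˢ Ioi (0 : ℝ)) \ (Ioo (-δ) δ ×ˢ Ioo 0 δ)) :
    trialS χ b p ε z.1 * trialT χ ε z.2 = 0 := by
  by_contra h
  refine hz.2 ⟨?_, hz.1.2, ?_⟩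
  · by_contra h1
    rw [mem_Ioo, ← abs_lt, not_lt] at h1
    exact h (by simp [trialS, hχ.eq_zero _ h1])
  · by_contra h1
    have h2 : δ ≤ |z.2| := (not_lt.1 h1).trans (le_abs_self _)
    exact h (by simp [trialT, hχ.eq_zero _ h2])

/-- A function on the half-plane that is continuous on the closed box and vanishes off the open
box is integrable, and its integral is that over the box. -/
theorem integral_box {f : ℝ × ℝ → ℝ} (hf : ContinuousOn f (Icc (-δ) δ ×ˢ Icc 0 δ))
    (h0 : ∀ z ∈ ((univ : Set ℝ) ×ˢ Ioi (0 : ℝ)) \ (Ioo (-δ) δ ×ˢ Ioo 0 δ), f z = 0) :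
    Integrable f ((volume : Measure ℝ).prod ((volume : Measure ℝ).restrict (Ioi 0))) ∧
    ∫ z in Ioo (-δ) δ ×ˢ Ioo 0 δ, f z
      = ∫ z, f z ∂((volume : Measure ℝ).prod ((volume : Measure ℝ).restrict (Ioi 0))) := by
  have hm : MeasurableSet ((univ : Set ℝ) ×ˢ Ioi (0 : ℝ)) :=
    MeasurableSet.univ.prod measurableSet_Ioi
  have h1 : IntegrableOn f (Ioo (-δ) δ ×ˢ Ioo 0 δ) :=
    (hf.integrableOn_compact (isCompact_Icc.prod isCompact_Icc)).mono_set
      (prod_mono Ioo_subset_Icc_self Ioo_subset_Icc_self)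
  rw [← restrict_halfPlane]
  exact ⟨h1.of_forall_sdiff_eq_zero hm h0,
    (setIntegral_eq_of_subset_of_forall_sdiff_eq_zero hm box_subset_halfPlane h0).symm⟩

end Trial

section TrialIntegral

open Polynomial

variable {χ χ₁ χ₂ : ℝ → ℝ} {b : ℝ} {p : ℝ[X]} {ε δ K κ₀ : ℝ} {κ κ₁ : ℝ → ℝ}

theorem continuous_trialS (hχ : IsCutoff δ K χ χ₁ χ₂) : Continuous (trialS χ b p ε) :=
  continuous_iff_continuousAt.2 fun s => (hasDerivAt_trialS b p ε hχ s).continuousAt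

theorem continuous_trialT (hχ : IsCutoff δ K χ χ₁ χ₂) : Continuous (trialT χ ε) :=
  continuous_iff_continuousAt.2 fun s => (hasDerivAt_trialT ε hχ s).continuousAt

theorem continuous_trialS₁ (hχ : IsCutoff δ K χ χ₁ χ₂) : Continuous (trialS₁ χ χ₁ b p ε) :=
  continuous_iff_continuousAt.2 fun s => (hasDerivAt_trialS₁ b p ε hχ s).continuousAt

theorem continuous_trialT₁ (hχ : IsCutoff δ K χ χ₁ χ₂) : Continuous (trialT₁ χ χ₁ ε) :=
  continuous_iff_continuousAt.2 fun s => (hasDerivAt_trialT₁ ε hχ s).continuousAt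

theorem continuous_trialS₂ (hχ : IsCutoff δ K χ χ₁ χ₂) : Continuous (trialS₂ χ χ₁ χ₂ b p ε) := by
  have h0 : Continuous χ := continuous_iff_continuousAt.2 fun s => (hχ.hasDerivAt s).continuousAt
  have h1 : Continuous χ₁ := continuous_iff_continuousAt.2 fun s => (hχ.hasDerivAt₁ s).continuousAt
  have h2 := hχ.continuous₂
  have hg : ∀ q : ℝ[X], Continuous fun s : ℝ => gaussFn b q (s / ε) := fun q =>
    (contDiff_gaussFn b q).continuous.comp (continuous_id.div_const ε)
  unfold trialS₂
  exact ((h2.mul (hg _)).add (continuous_const.mul ((h1.mul (hg _)).div_const _))).add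
    ((h0.mul (hg _)).div_const _)

theorem continuous_trialT₂ (hχ : IsCutoff δ K χ χ₁ χ₂) : Continuous (trialT₂ χ χ₁ χ₂ ε) := by
  have h0 : Continuous χ := continuous_iff_continuousAt.2 fun s => (hχ.hasDerivAt s).continuousAt
  have h1 : Continuous χ₁ := continuous_iff_continuousAt.2 fun s => (hχ.hasDerivAt₁ s).continuousAt
  have h2 := hχ.continuous₂
  unfold trialT₂
  fun_prop

theorem jacobian_ne_zero (hδ : ∀ s, δ * |κ s| ≤ 1 / 2) {z : ℝ × ℝ}
    (hz : z ∈ Icc (-δ) δ ×ˢ Icc 0 δ) : 1 - z.2 * κ z.1 ≠ 0 := by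
  have h1 : z.2 * κ z.1 ≤ δ * |κ z.1| :=
    (mul_le_mul_of_nonneg_left (le_abs_self _) hz.2.1).trans
      (mul_le_mul_of_nonneg_right hz.2.2 (abs_nonneg _))
  linarith [hδ z.1]

/-- The two densities are integrable over the half-plane, with the same integrals as over the
box. -/
theorem integral_box_densities (hχ : IsCutoff δ K χ χ₁ χ₂) (hκ : IsPeak κ₀ b K κ κ₁)
    (hδ : ∀ s, δ * |κ s| ≤ 1 / 2) :
    (Integrable (normDensity χ b p ε κ)
        ((volume : Measure ℝ).prod ((volume : Measure ℝ).restrict (Ioi 0))) ∧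
      ∫ z in Ioo (-δ) δ ×ˢ Ioo 0 δ, normDensity χ b p ε κ z = ∫ z, normDensity χ b p ε κ z
        ∂((volume : Measure ℝ).prod ((volume : Measure ℝ).restrict (Ioi 0)))) ∧
    (Integrable (energyDensity χ χ₁ χ₂ b p ε κ κ₁)
        ((volume : Measure ℝ).prod ((volume : Measure ℝ).restrict (Ioi 0))) ∧
      ∫ z in Ioo (-δ) δ ×ˢ Ioo 0 δ, energyDensity χ χ₁ χ₂ b p ε κ κ₁ z
        = ∫ z, energyDensity χ χ₁ χ₂ b p ε κ κ₁ z
        ∂((volume : Measure ℝ).prod ((volume : Measure ℝ).restrict (Ioi 0)))) := by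
  have hS : Continuous fun z : ℝ × ℝ => trialS χ b p ε z.1 :=
    (continuous_trialS hχ).comp continuous_fst
  have hS₁ : Continuous fun z : ℝ × ℝ => trialS₁ χ χ₁ b p ε z.1 :=
    (continuous_trialS₁ hχ).comp continuous_fst
  have hS₂ : Continuous fun z : ℝ × ℝ => trialS₂ χ χ₁ χ₂ b p ε z.1 :=
    (continuous_trialS₂ hχ).comp continuous_fst
  have hT : Continuous fun z : ℝ × ℝ => trialT χ ε z.2 :=
    (continuous_trialT hχ).comp continuous_snd
  have hT₁ : Continuous fun z : ℝ × ℝ => trialT₁ χ χ₁ ε z.2 :=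
    (continuous_trialT₁ hχ).comp continuous_snd
  have hT₂ : Continuous fun z : ℝ × ℝ => trialT₂ χ χ₁ χ₂ ε z.2 :=
    (continuous_trialT₂ hχ).comp continuous_snd
  have hκc : Continuous fun z : ℝ × ℝ => κ z.1 := hκ.continuous.comp continuous_fst
  have hκ₁c : Continuous fun z : ℝ × ℝ => κ₁ z.1 := hκ.continuous₁.comp continuous_fst
  have ha : Continuous fun z : ℝ × ℝ => 1 - z.2 * κ z.1 :=
    continuous_const.sub (continuous_snd.mul hκc)
  refine ⟨integral_box ?_ ?_, integral_box ?_ ?_⟩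
  · exact (ha.mul ((hS.mul hT).pow 2)).continuousOn
  · intro z hz
    simp [normDensity, trial_mul_eq_zero b p hχ hz]
  · have ha0 : ∀ z ∈ Icc (-δ) δ ×ˢ Icc 0 δ, 1 - z.2 * κ z.1 ≠ 0 := fun z hz =>
      jacobian_ne_zero hδ hz
    have h1 := (hS₂.continuousOn (s := Icc (-δ) δ ×ˢ Icc 0 δ)).div ha.continuousOn ha0
    have h2 := ((continuous_snd.mul hκ₁c).mul hS₁).continuousOn.div
      (ha.pow 2).continuousOn fun z hz => pow_ne_zero 2 (ha0 z hz)
    have h3 := (hS.mul ((ha.mul hT₂).sub (hκc.mul hT₁))).continuousOn (s := Icc (-δ) δ ×ˢ Icc 0 δ)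
    exact continuousOn_const.mul ((hS.mul hT).continuousOn.mul
      ((hT.continuousOn.mul (h1.add h2)).add h3))
  · intro z hz
    simp [energyDensity, trial_mul_eq_zero b p hχ hz]

theorem trialT_sq_le (hχ : IsCutoff δ K χ χ₁ χ₂) {t : ℝ} (ht : 0 < t) (hε : 0 < ε) :
    trialT χ ε t ^ 2 ≤ Real.exp (-(t / ε ^ 4)) := by
  have h1 : χ t ^ 2 ≤ 1 := pow_le_one₀ (hχ.nonneg t) (hχ.le_one t)
  have h2 : Real.exp (-(t / ε ^ 4)) ≤ 1 := by
    rw [Real.exp_le_one_iff]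
    have : 0 ≤ t / ε ^ 4 := by positivity
    linarith
  have h3 := Real.exp_nonneg (-(t / ε ^ 4))
  rw [trialT, mul_pow]
  calc χ t ^ 2 * Real.exp (-(t / ε ^ 4)) ^ 2
      ≤ 1 * (Real.exp (-(t / ε ^ 4)) * 1) := by
        rw [sq (Real.exp _)]
        gcongr
    _ = _ := by ring

theorem exp_div_eq (t : ℝ) :
    Real.exp (-(t / ε ^ 4)) = Real.exp (-(1 / ε ^ 4) * t) := by
  congr 1
  ring

theorem integrable_exp_div (hε : 0 < ε) :
    IntegrableOn (fun t => Real.exp (-(t / ε ^ 4))) (Ioi 0) := by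
  simp only [exp_div_eq]
  exact integrableOn_exp_mul_Ioi (by simpa using pow_pos hε 4) 0

theorem integral_exp_div (hε : 0 < ε) : ∫ t in Ioi 0, Real.exp (-(t / ε ^ 4)) = ε ^ 4 := by
  simp only [exp_div_eq]
  rw [integral_exp_mul_Ioi (by simpa using pow_pos hε 4)]
  simp

theorem integrable_trialT_sq (hχ : IsCutoff δ K χ χ₁ χ₂) (hε : 0 < ε) :
    IntegrableOn (fun t => trialT χ ε t ^ 2) (Ioi 0) := by
  refine Integrable.mono' (integrable_exp_div hε)
    ((continuous_trialT hχ).pow 2).aestronglyMeasurable ?_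
  filter_upwards [ae_restrict_mem measurableSet_Ioi] with t ht
  rw [Real.norm_of_nonneg (sq_nonneg _)]
  exact trialT_sq_le hχ ht hε

/-- The cutoff hardly changes `∫ exp (-2 t / √h) dt = √h / 2`. -/
theorem integral_trialT_sq_ge (hχ : IsCutoff δ K χ χ₁ χ₂) (hε : 0 < ε) :
    ε ^ 4 / 2 - K * ε ^ 8 ≤ ∫ t in Ioi 0, trialT χ ε t ^ 2 := by
  have hK : 0 ≤ K := (abs_nonneg _).trans (hχ.abs₁_le 0)
  have e : ∀ t, Real.exp (-(t / ε ^ 4)) ^ 2 = Real.exp (-(2 / ε ^ 4) * t) := by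
    intro t
    rw [← Real.exp_nat_mul]
    congr 1
    push_cast
    ring
  have hneg : -(2 / ε ^ 4) < 0 := by
    have : 0 < 2 / ε ^ 4 := by positivity
    linarith
  have i1 : IntegrableOn (fun t => Real.exp (-(t / ε ^ 4)) ^ 2) (Ioi 0) := by
    simp only [e]
    exact integrableOn_exp_mul_Ioi hneg 0
  have i2 : ∫ t in Ioi 0, Real.exp (-(t / ε ^ 4)) ^ 2 = ε ^ 4 / 2 := by
    simp only [e]
    rw [integral_exp_mul_Ioi hneg]
    simp
  have i3 : IntegrableOn (fun t => K * ε ^ 4 * Real.exp (-(t / ε ^ 4))) (Ioi 0) :=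
    (integrable_exp_div hε).const_mul _
  have h := setIntegral_mono_on (i1.sub i3) (integrable_trialT_sq (ε := ε) hχ hε)
    measurableSet_Ioi (fun t (ht : 0 < t) => ?_)
  · rw [integral_sub' i1 i3, i2, integral_const_mul, integral_exp_div hε] at h
    refine le_trans (le_of_eq ?_) h
    ring
  · have h1 := hχ.one_sub_sq_le t
    rw [abs_of_pos ht] at h1
    have h2 : t / ε ^ 4 * Real.exp (-(t / ε ^ 4)) ^ 2 ≤ Real.exp (-(t / ε ^ 4)) := by
      have := exp_weight_le (τ := t / ε ^ 4)
      nlinarith [sq_nonneg (Real.exp (-(t / ε ^ 4)))]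
    have h3 : K * t * Real.exp (-(t / ε ^ 4)) ^ 2 ≤ K * ε ^ 4 * Real.exp (-(t / ε ^ 4)) := by
      calc K * t * Real.exp (-(t / ε ^ 4)) ^ 2
          = K * ε ^ 4 * (t / ε ^ 4 * Real.exp (-(t / ε ^ 4)) ^ 2) := by
            field_simp
        _ ≤ _ := by gcongr
    have h4 : (1 - χ t ^ 2) * Real.exp (-(t / ε ^ 4)) ^ 2
        ≤ K * t * Real.exp (-(t / ε ^ 4)) ^ 2 := by gcongr
    rw [trialT, mul_pow]
    simp only [Pi.sub_apply]
    linarith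

/-- The integrated estimate: the trial functions of degree at most `m` have Rayleigh quotients
bounded by the `m`-th level of the effective harmonic oscillator, up to `O(ε¹⁵)`. -/
theorem exists_trial_estimate {b : ℝ} (hb : 0 < b) {δ K κ₀ : ℝ} {χ χ₁ χ₂ κ κ₁ : ℝ → ℝ}
    (hχ : IsCutoff δ K χ χ₁ χ₂) (hκ : IsPeak κ₀ b K κ κ₁) (hδ : ∀ s, δ * |κ s| ≤ 1 / 2) (m : ℕ) :
    ∃ C, 0 ≤ C ∧ ∃ ε₀ ∈ Ioo (0 : ℝ) 1, ∀ ε ∈ Ioo 0 ε₀, ∀ p : ℝ[X], p.natDegree ≤ m →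
      (p ≠ 0 → 0 < ∫ z in Ioo (-δ) δ ×ˢ Ioo 0 δ, normDensity χ b p ε κ z) ∧
      ∫ z in Ioo (-δ) δ ×ˢ Ioo 0 δ, energyDensity χ χ₁ χ₂ b p ε κ κ₁ z
        ≤ (-ε ^ 8 - κ₀ * ε ^ 12 + (2 * m + 1) * b * ε ^ 14 + C * ε ^ 15)
          * ∫ z in Ioo (-δ) δ ×ˢ Ioo 0 δ, normDensity χ b p ε κ z := by
  have hK : 0 ≤ K := (abs_nonneg _).trans (hκ.abs_le 0)
  obtain ⟨c, hc, herr⟩ := exists_integral_gaussErr_le hb m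
  set C₁ := 18 * K + 11 * K ^ 2 + b ^ 2 * K with hC₁
  have hC₁0 : 0 ≤ C₁ := by positivity
  -- for `ε < ε₀` the errors in the norm are at most half of its main term `ε N θ ≥ ε⁵ N / 4`
  set ε₀ := 1 / (16 * K * c + 4 * K + 2) with hε₀
  have hden : 0 < 16 * K * c + 4 * K + 2 := by positivity
  -- by the bound `ε⁵ N ≤ 8 D` below errors of size `N` are errors of size `D`
  refine ⟨8 * ((2 * m + 1) * b * (2 * K * c) + C₁ * c), by positivity, ε₀,
    ⟨by positivity, by rw [hε₀, div_lt_one hden]; nlinarith [mul_nonneg hK hc]⟩,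
    fun ε hε p hp => ?_⟩
  have hε0 := hε.1
  have hε₁ : ε₀ ≤ 1 := by rw [hε₀, div_le_one hden]; nlinarith [mul_nonneg hK hc]
  have hεI : ε ∈ Ioo (0 : ℝ) 1 := ⟨hε0, hε.2.trans_le hε₁⟩
  have hsmall : ε * (16 * K * c + 4 * K + 2) ≤ 1 := by
    have := hε.2.le
    rwa [hε₀, le_div_iff₀ hden] at this
  have hs1 : ε * (16 * K * c) ≤ 1 := by nlinarith [mul_nonneg hε0.le hK]
  have hs2 : ε * (4 * K) ≤ 1 := by nlinarith [mul_nonneg hε0.le (mul_nonneg hK hc)]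
  obtain ⟨⟨iN, eN⟩, ⟨iE, eE⟩⟩ := integral_box_densities (p := p) (ε := ε) hχ hκ hδ
  rw [eN, eE]
  set ν := (volume : Measure ℝ).prod ((volume : Measure ℝ).restrict (Ioi 0)) with hν
  -- `ε N θ` is the main term of the squared norm `D`
  set N := gaussInt hb (p ^ 2) with hN
  set D := ∫ z, normDensity χ b p ε κ z ∂ν with hD
  set θ := ∫ t in Ioi 0, trialT χ ε t ^ 2 with hθ
  have hN0 : 0 ≤ N := gaussInt_sq_nonneg hb p
  have hθ4 : ε ^ 4 / 4 ≤ θ := by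
    have h1 := integral_trialT_sq_ge (ε := ε) hχ hε0
    have h2 : K * ε ^ 8 ≤ ε ^ 4 / 4 := by
      have h3 : ε ^ 4 ≤ ε := by
        simpa using pow_le_pow_of_le_one hε0.le hεI.2.le (show 1 ≤ 4 by norm_num)
      have h4 : K * ε ^ 4 ≤ 1 / 4 := by nlinarith
      have h5 := mul_le_mul_of_nonneg_right h4 (pow_nonneg hε0.le 4)
      linarith
    linarith
  have hθ0 : 0 ≤ θ := le_trans (by positivity) hθ4
  have hae : ∀ᵐ z ∂ν, 0 < z.2 := by
    rw [hν, ← restrict_halfPlane]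
    filter_upwards [ae_restrict_mem (MeasurableSet.univ.prod measurableSet_Ioi)] with z hz
    exact hz.2
  -- integrals of the three product densities
  have scale : ∀ f : ℝ → ℝ, ∫ s, f (s / ε) = ε * ∫ x, f x := fun f => by
    rw [Measure.integral_comp_div, abs_of_pos hε0, smul_eq_mul]
  have iT := integrable_trialT_sq (ε := ε) hχ hε0
  have iX := integrable_exp_div hε0
  have iO : Integrable (fun z : ℝ × ℝ => oscDensity b p (z.1 / ε) * trialT χ ε z.2 ^ 2) ν :=
    ((integrable_oscDensity hb p).comp_div hε0.ne').mul_prod iT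
  have iR : Integrable (fun z : ℝ × ℝ => gaussErr b p (z.1 / ε) * Real.exp (-(z.2 / ε ^ 4))) ν :=
    ((integrable_gaussErr hb p).comp_div hε0.ne').mul_prod iX
  have hGsq : ∀ x, gaussFn b p x ^ 2 = (p ^ 2).eval x * Real.exp (-b * x ^ 2) := fun x => by
    rw [sq (gaussFn b p x), gaussFn_mul, sq p]
  have iG0 : Integrable (fun x => gaussFn b p x ^ 2) :=
    (integrable_eval_mul_gaussian hb _).congr (Eventually.of_forall fun x => (hGsq x).symm)
  have iG : Integrable (fun z : ℝ × ℝ => gaussFn b p (z.1 / ε) ^ 2 * trialT χ ε z.2 ^ 2) ν :=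
    (iG0.comp_div hε0.ne').mul_prod iT
  have vO : ∫ z : ℝ × ℝ, oscDensity b p (z.1 / ε) * trialT χ ε z.2 ^ 2 ∂ν
      ≤ ε * ((2 * m + 1) * b * N) * θ := by
    rw [hν, integral_prod_mul (fun s => oscDensity b p (s / ε)) (fun t => trialT χ ε t ^ 2),
      scale]
    gcongr
    exact integral_oscDensity_le hb hp
  have vR : ∫ z : ℝ × ℝ, gaussErr b p (z.1 / ε) * Real.exp (-(z.2 / ε ^ 4)) ∂ν
      ≤ ε * (c * N) * ε ^ 4 := by
    rw [hν, integral_prod_mul (fun s => gaussErr b p (s / ε)) (fun t => Real.exp (-(t / ε ^ 4))),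
      scale, integral_exp_div hε0]
    gcongr
    exact herr p hp
  have vG : ∫ z : ℝ × ℝ, gaussFn b p (z.1 / ε) ^ 2 * trialT χ ε z.2 ^ 2 ∂ν = ε * N * θ := by
    rw [hν, integral_prod_mul (fun s => gaussFn b p (s / ε) ^ 2) (fun t => trialT χ ε t ^ 2),
      scale fun x => gaussFn b p x ^ 2, hN, gaussInt_apply]
    simp only [hGsq]
    rfl
  -- the norm from below
  have hlow : ε * N * θ - 2 * K * c * (ε ^ 6 * N) ≤ D := by
    have h := integral_mono_ae (iG.sub ((iR.const_mul ε).const_mul (2 * K))) iN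
      (by filter_upwards [hae] with z hz using normDensity_ge b p hχ hκ hεI hz)
    rw [integral_sub' iG ((iR.const_mul ε).const_mul (2 * K)), integral_const_mul,
      integral_const_mul, vG] at h
    have h2 : 2 * K * (ε * ∫ z : ℝ × ℝ, gaussErr b p (z.1 / ε) * Real.exp (-(z.2 / ε ^ 4)) ∂ν)
        ≤ 2 * K * (ε * (ε * (c * N) * ε ^ 4)) := by gcongr
    have h3 : 2 * K * (ε * (ε * (c * N) * ε ^ 4)) = 2 * K * c * (ε ^ 6 * N) := by ring
    linarith
  have hDN : ε ^ 5 * N ≤ 8 * D := by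
    have h1 : ε * N * (ε ^ 4 / 4) ≤ ε * N * θ := by gcongr
    have h2 : 2 * K * c * (ε ^ 6 * N) ≤ ε ^ 5 * N / 8 := by
      have h3 := mul_le_mul_of_nonneg_right hs1 (show 0 ≤ ε ^ 5 * N by positivity)
      linarith
    have h3 : ε * N * (ε ^ 4 / 4) = ε ^ 5 * N / 4 := by ring
    linarith
  refine ⟨fun hp0 => ?_, ?_⟩
  · have h1 : 0 < ε ^ 5 * N := mul_pos (pow_pos hε0 5) (gaussInt_sq_pos hb hp0)
    linarith
  -- the energy from above
  have hup : (∫ z, energyDensity χ χ₁ χ₂ b p ε κ κ₁ z ∂ν) + (ε ^ 8 + κ₀ * ε ^ 12) * D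
      ≤ ε ^ 14 * (ε * ((2 * m + 1) * b * N) * θ) + C₁ * (ε ^ 15 * (ε * (c * N) * ε ^ 4)) := by
    have h := integral_mono_ae (iE.add (iN.const_mul (ε ^ 8 + κ₀ * ε ^ 12)))
      ((iO.const_mul (ε ^ 14)).add ((iR.const_mul (ε ^ 15)).const_mul C₁))
      (by filter_upwards [hae] with z hz using energyDensity_le b p hχ hκ hδ hεI hz)
    rw [integral_add' iE (iN.const_mul _),
      integral_add' (iO.const_mul (ε ^ 14)) ((iR.const_mul (ε ^ 15)).const_mul C₁),
      integral_const_mul, integral_const_mul, integral_const_mul, integral_const_mul] at h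
    refine h.trans (add_le_add ?_ ?_)
    · gcongr
    · gcongr
  have h1 : ε ^ 14 * (ε * ((2 * m + 1) * b * N) * θ)
      ≤ ε ^ 14 * ((2 * m + 1) * b) * (D + 2 * K * c * (ε ^ 6 * N)) := by
    calc ε ^ 14 * (ε * ((2 * m + 1) * b * N) * θ)
        = ε ^ 14 * ((2 * m + 1) * b) * (ε * N * θ) := by ring
      _ ≤ _ := by gcongr; linarith
  have h2 : ((2 * m + 1) * b * (2 * K * c) + C₁ * c) * ε ^ 15 * (ε ^ 5 * N)
      ≤ ((2 * m + 1) * b * (2 * K * c) + C₁ * c) * ε ^ 15 * (8 * D) := by gcongr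
  linarith

end TrialIntegral

/-! ### Cutoffs and the maximum of the curvature -/

theorem contDiff_deriv {f : ℝ → ℝ} (hf : ContDiff ℝ ∞ f) : ContDiff ℝ ∞ (deriv f) :=
  ((contDiff_infty_iff_deriv).1 hf).2

theorem hasDerivAt_deriv {f : ℝ → ℝ} (hf : ContDiff ℝ ∞ f) (x : ℝ) :
    HasDerivAt f (deriv f x) x :=
  (hf.differentiable (by simp) x).hasDerivAt

theorem exists_cutoff {δ : ℝ} (hδ : 0 < δ) : ∃ (K : ℝ) (χ χ₁ χ₂ : ℝ → ℝ), 0 ≤ K ∧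
    IsCutoff δ K χ χ₁ χ₂ ∧ ContDiff ℝ ∞ χ ∧ ∀ x, δ / 2 ≤ |x| → χ x = 0 := by
  let χ : ContDiffBump (0 : ℝ) := ⟨δ / 4, δ / 2, by positivity, by linarith⟩
  have hχ : ContDiff ℝ ∞ χ := χ.contDiff
  have hχ₁ := contDiff_deriv hχ
  have hχ₂ := contDiff_deriv hχ₁
  have hc : HasCompactSupport χ := χ.hasCompactSupport
  obtain ⟨K₁, hK₁⟩ := hc.deriv.exists_bound_of_continuous hχ₁.continuous
  obtain ⟨K₂, hK₂⟩ := hc.deriv.deriv.exists_bound_of_continuous hχ₂.continuous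
  have hK₁0 : 0 ≤ K₁ := (norm_nonneg _).trans (hK₁ 0)
  have hK₂0 : 0 ≤ K₂ := (norm_nonneg _).trans (hK₂ 0)
  have hz : ∀ x, δ / 2 ≤ |x| → χ x = 0 := fun x hx =>
    χ.zero_of_le_dist (by rwa [Real.dist_eq, sub_zero])
  have h0 : deriv χ 0 = 0 := by
    have h : (χ : ℝ → ℝ) =ᶠ[𝓝 0] fun _ => 1 := χ.eventuallyEq_one
    rw [h.deriv_eq]
    simp
  have hK : 0 < 4 / δ := by positivity
  refine ⟨K₁ + K₂ + 4 / δ, χ, deriv χ, deriv (deriv χ), by positivity,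
    ⟨hasDerivAt_deriv hχ, hasDerivAt_deriv hχ₁, hχ₂.continuous, fun x => χ.nonneg,
      fun x => χ.le_one, fun x => ?_, fun x => ?_, fun x => ?_, fun x => ?_,
      fun x hx => hz x (by linarith)⟩, hχ, hz⟩
  · have := hK₁ x
    rw [Real.norm_eq_abs] at this
    linarith
  · have h1 := Convex.norm_image_sub_le_of_norm_hasDerivWithin_le (s := univ) (x := 0) (y := x)
      (fun y _ => (hasDerivAt_deriv hχ₁ y).hasDerivWithinAt) (fun y _ => hK₂ y) convex_univ
      trivial trivial
    rw [h0, sub_zero, sub_zero, Real.norm_eq_abs, Real.norm_eq_abs] at h1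
    refine h1.trans ?_
    gcongr
    linarith
  · have := hK₂ x
    rw [Real.norm_eq_abs] at this
    linarith
  · by_cases hx : |x| ≤ δ / 4
    · rw [χ.one_of_mem_closedBall (by rwa [mem_closedBall_zero_iff, Real.norm_eq_abs])]
      simp only [one_pow, sub_self]
      positivity
    · rw [not_le] at hx
      have h1 : 1 ≤ 4 / δ * |x| := by
        rw [div_mul_eq_mul_div, le_div_iff₀ hδ]
        linarith
      have h2 : 0 ≤ (K₁ + K₂) * |x| := by positivity
      nlinarith [sq_nonneg (χ x)]

theorem IsCutoff.mono {δ K K' : ℝ} {χ χ₁ χ₂ : ℝ → ℝ} (h : IsCutoff δ K χ χ₁ χ₂) (hK : K ≤ K') :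
    IsCutoff δ K' χ χ₁ χ₂ where
  __ := h
  abs₁_le x := (h.abs₁_le x).trans hK
  abs₁_le_mul x := (h.abs₁_le_mul x).trans (by gcongr)
  abs₂_le x := (h.abs₂_le x).trans hK
  one_sub_sq_le x := (h.one_sub_sq_le x).trans (by gcongr)

theorem IsPeak.mono {κ₀ b K K' : ℝ} {κ κ₁ : ℝ → ℝ} (h : IsPeak κ₀ b K κ κ₁) (hK : K ≤ K') :
    IsPeak κ₀ b K' κ κ₁ where
  __ := h
  abs_le x := (h.abs_le x).trans hK
  abs₁_le x := (h.abs₁_le x).trans hK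
  taylor x := le_trans (by gcongr) (h.taylor x)

theorem abs_le_pow_succ_of_deriv {f f' : ℝ → ℝ} {C : ℝ} {k : ℕ} (hC : 0 ≤ C)
    (hf : ∀ x, HasDerivAt f (f' x) x) (h0 : f 0 = 0)
    (h : ∀ x, |x| ≤ 1 → |f' x| ≤ C * |x| ^ k) {x : ℝ} (hx : |x| ≤ 1) :
    |f x| ≤ C * |x| ^ (k + 1) := by
  have h1 := Convex.norm_image_sub_le_of_norm_hasDerivWithin_le (s := Icc (-|x|) |x|) (x := 0)
    (y := x) (C := C * |x| ^ k) (fun y _ => (hf y).hasDerivWithinAt) (fun y hy => by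
      have h2 : |y| ≤ |x| := abs_le.2 hy
      rw [Real.norm_eq_abs]
      refine (h y (h2.trans hx)).trans ?_
      gcongr) (convex_Icc _ _) ⟨by simp, abs_nonneg x⟩ ⟨neg_abs_le x, le_abs_self x⟩
  rw [h0, sub_zero, sub_zero, Real.norm_eq_abs, Real.norm_eq_abs] at h1
  rw [pow_succ, ← mul_assoc]
  exact h1

/-- The lower bound by the second Taylor polynomial at a critical point of a bounded smooth
function. It is global: away from `[-1, 1]` the cubic error dominates everything else. -/
theorem exists_taylor_lower {f : ℝ → ℝ} {K : ℝ} (hf : ContDiff ℝ ∞ f) (hK : ∀ s, |f s| ≤ K)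
    (h0 : deriv f 0 = 0) :
    ∃ C, 0 ≤ C ∧ ∀ s, f 0 + deriv (deriv f) 0 / 2 * s ^ 2 - C * |s| ^ 3 ≤ f s := by
  have hf₁ := contDiff_deriv hf
  have hf₂ := contDiff_deriv hf₁
  have hf₃ := contDiff_deriv hf₂
  have hK0 : 0 ≤ K := (abs_nonneg _).trans (hK 0)
  obtain ⟨C, hC⟩ := isCompact_Icc.exists_bound_of_continuousOn
    (hf₃.continuous.continuousOn (s := Icc (-1 : ℝ) 1))
  have hC0 : 0 ≤ C := (norm_nonneg _).trans (hC 0 ⟨by norm_num, by norm_num⟩)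
  set A := deriv (deriv f) 0 with hA
  have e2 : ∀ x, |x| ≤ 1 → |deriv (deriv f) x - A| ≤ C * |x| ^ 1 := fun x hx =>
    abs_le_pow_succ_of_deriv (f := fun x => deriv (deriv f) x - A) (k := 0) hC0
      (fun y => (hasDerivAt_deriv hf₂ y).sub_const A) (sub_self _)
      (fun y hy => by simpa using hC y (abs_le.1 hy)) hx
  have e1 : ∀ x, |x| ≤ 1 → |deriv f x - A * x| ≤ C * |x| ^ 2 := fun x hx =>
    abs_le_pow_succ_of_deriv (f := fun x => deriv f x - A * x) (k := 1) hC0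
      (fun y => by
        refine ((hasDerivAt_deriv hf₁ y).sub
          ((hasDerivAt_id' y).const_mul A)).congr_deriv ?_
        simp)
      (by simp [h0]) e2 hx
  have e0 : ∀ x, |x| ≤ 1 → |f x - f 0 - A / 2 * x ^ 2| ≤ C * |x| ^ 3 := fun x hx =>
    abs_le_pow_succ_of_deriv (f := fun x => f x - f 0 - A / 2 * x ^ 2) (k := 2) hC0
      (fun y => by
        refine (((hasDerivAt_deriv hf y).sub_const (f 0)).sub
          (((hasDerivAt_id' y).pow 2).const_mul (A / 2))).congr_deriv ?_
        simp
        ring)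
      (by simp) e1 hx
  refine ⟨C + 2 * K + |A|, by positivity, fun s => ?_⟩
  have h3 : 0 ≤ |s| ^ 3 := by positivity
  rcases le_total |s| 1 with hs | hs
  · have h1 := (abs_le.1 (e0 s hs)).1
    have h2 : 0 ≤ (2 * K + |A|) * |s| ^ 3 := by positivity
    linarith
  · have h1 : f 0 - f s ≤ 2 * K := by
      have := (abs_le.1 (hK 0)).2
      have := (abs_le.1 (hK s)).1
      linarith
    have h2 : 1 ≤ |s| ^ 3 := one_le_pow₀ hs
    have h4 : s ^ 2 ≤ |s| ^ 3 := by
      rw [← sq_abs]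
      exact pow_le_pow_right₀ hs (by norm_num)
    have h5 : A / 2 * s ^ 2 ≤ |A| * |s| ^ 3 :=
      mul_le_mul (by linarith [le_abs_self A, abs_nonneg A]) h4 (sq_nonneg s) (abs_nonneg A)
    have h6 : 2 * K * 1 ≤ 2 * K * |s| ^ 3 := by gcongr
    have h7 : 0 ≤ C * |s| ^ 3 := by positivity
    linarith

theorem periodic_deriv {E : Type*} [NormedAddCommGroup E] [NormedSpace ℝ E] {f : ℝ → E} {c : ℝ}
    (h : Function.Periodic f c) : Function.Periodic (deriv f) c := by
  intro x
  have h1 := deriv_comp_add_const f c x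
  rw [funext h] at h1
  exact h1.symm

theorem exists_bound_of_periodic {f : ℝ → ℝ} {c : ℝ} (h : Function.Periodic f c) (hc : 0 < c)
    (hf : Continuous f) : ∃ K, ∀ x, |f x| ≤ K := by
  obtain ⟨K, hK⟩ := (h.isBounded_of_continuous hc.ne' hf).exists_norm_le
  exact ⟨K, fun x => hK _ (mem_range_self x)⟩

namespace SmoothDomain

variable {D : SmoothDomain} {c : Fin D.m}

theorem periodic_curvature : Function.Periodic (D.curvature c) (D.len c) := by
  have h0 : Function.Periodic (D.M c) (D.len c) := D.periodic c
  have h1 := periodic_deriv h0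
  have h2 := periodic_deriv h1
  intro s
  simp only [curvature, normal, h1 s, h2 s]

theorem UniqueNondegenerateMax.exists_isPeak (hA : D.UniqueNondegenerateMax c) :
    ∃ K, 0 ≤ K ∧ IsPeak (D.curvature c 0) (√(-iteratedDeriv 2 (D.curvature c) 0 / 2)) K
      (D.curvature c) (deriv (D.curvature c)) := by
  have hκ : ContDiff ℝ ∞ (D.curvature c) := contDiff_curvature
  have hκ₁ := contDiff_deriv hκ
  have hp : Function.Periodic (D.curvature c) (D.len c) := periodic_curvature
  obtain ⟨K₁, hK₁⟩ := exists_bound_of_periodic hp (D.len_pos c) hκ.continuous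
  obtain ⟨K₂, hK₂⟩ := exists_bound_of_periodic (periodic_deriv hp) (D.len_pos c) hκ₁.continuous
  have h0 : deriv (D.curvature c) 0 = 0 :=
    IsLocalMax.deriv_eq_zero (Eventually.of_forall fun s => hA.is_max c s)
  obtain ⟨C, hC, hT⟩ := exists_taylor_lower hκ hK₁ h0
  have hK₁0 : 0 ≤ K₁ := (abs_nonneg _).trans (hK₁ 0)
  have hK₂0 : 0 ≤ K₂ := (abs_nonneg _).trans (hK₂ 0)
  refine ⟨K₁ + K₂ + C, by positivity, hκ.continuous, hκ₁.continuous,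
    fun s => (hK₁ s).trans (by linarith), fun s => (hK₂ s).trans (by linarith), fun s => ?_⟩
  refine le_trans ?_ (hT s)
  have e : iteratedDeriv 2 (D.curvature c) 0 = deriv (deriv (D.curvature c)) 0 := by
    rw [iteratedDeriv_succ, iteratedDeriv_one]
  have hneg := hA.nondegenerate
  rw [Real.sq_sqrt (by linarith), e]
  have h2 : C * |s| ^ 3 ≤ (K₁ + K₂ + C) * |s| ^ 3 := by gcongr; linarith
  linarith

/-! ### The trial space -/

section TrialSpace

open Polynomial

variable {δ K : ℝ} {χ χ₁ χ₂ : ℝ → ℝ} {e : OpenPartialHomeomorph (ℝ × ℝ) (ℝ × ℝ)} {ε b : ℝ}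

theorem contDiff_trial (hs : ContDiff ℝ ∞ χ) (p : ℝ[X]) :
    ContDiff ℝ ∞ fun z : ℝ × ℝ => trialS χ b p ε z.1 * trialT χ ε z.2 := by
  have h1 : ContDiff ℝ ∞ (trialS χ b p ε) :=
    hs.mul ((contDiff_gaussFn b p).comp (contDiff_id.div_const ε))
  have h2 : ContDiff ℝ ∞ (trialT χ ε) :=
    hs.mul (contDiff_id.div_const (ε ^ 4)).neg.exp
  exact (h1.comp contDiff_fst).mul (h2.comp contDiff_snd)

theorem support_trial_subset (h0 : ∀ x, δ / 2 ≤ |x| → χ x = 0) (p : ℝ[X]) :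
    tsupport (fun z : ℝ × ℝ => trialS χ b p ε z.1 * trialT χ ε z.2)
      ⊆ Icc (-(δ / 2)) (δ / 2) ×ˢ Icc (-(δ / 2)) (δ / 2) := by
  refine closure_minimal (fun z hz => ?_) (isClosed_Icc.prod isClosed_Icc)
  have h : ∀ x, χ x ≠ 0 → x ∈ Icc (-(δ / 2)) (δ / 2) := fun x hx => by
    rw [mem_Icc, ← abs_le]
    by_contra h1
    exact hx (h0 x (not_le.1 h1).le)
  refine ⟨h _ fun h1 => hz ?_, h _ fun h1 => hz ?_⟩
  · simp [trialS, h1]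
  · simp [trialT, h1]

theorem tsupport_trial_subset_source (he : D.IsTubular c δ e) (hδ : 0 < δ)
    (h0 : ∀ x, δ / 2 ≤ |x| → χ x = 0) (p : ℝ[X]) :
    tsupport (fun z : ℝ × ℝ => trialS χ b p ε z.1 * trialT χ ε z.2) ⊆ e.source := by
  rw [he.source_eq]
  have h : Icc (-(δ / 2)) (δ / 2) ⊆ Ioo (-δ) δ := Icc_subset_Ioo (by linarith) (by linarith)
  exact (support_trial_subset h0 p).trans (prod_mono h h)

theorem hasCompactSupport_trial (h0 : ∀ x, δ / 2 ≤ |x| → χ x = 0) (p : ℝ[X]) :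
    HasCompactSupport fun z : ℝ × ℝ => trialS χ b p ε z.1 * trialT χ ε z.2 :=
  (isCompact_Icc.prod isCompact_Icc).of_isClosed_subset (isClosed_tsupport _)
    (support_trial_subset h0 p)

theorem trial_mem_testSpace (he : D.IsTubular c δ e) (hδ : 0 < δ) (hs : ContDiff ℝ ∞ χ)
    (h0 : ∀ x, δ / 2 ≤ |x| → χ x = 0) (p : ℝ[X]) :
    ofTube e (fun z : ℝ × ℝ => trialS χ b p ε z.1 * trialT χ ε z.2) ∈ testSpace :=
  ofTube_mem_testSpace he (contDiff_trial hs p) (hasCompactSupport_trial h0 p)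
    (tsupport_trial_subset_source he hδ h0 p)

/-- The trial functions, as a linear function of the polynomial, for `h = ε⁸`. The Robin condition
holds exactly since the normal factor has logarithmic derivative `-ε⁻⁴` at the boundary. -/
def trialMap (b : ℝ) (he : D.IsTubular c δ e) (hδ : 0 < δ) (hχ : IsCutoff δ K χ χ₁ χ₂)
    (hs : ContDiff ℝ ∞ χ) (h0 : ∀ x, δ / 2 ≤ |x| → χ x = 0) (hε : 0 < ε) :
    ℝ[X] →ₗ[ℝ] D.robinTestSpace (ε ^ 8) where
  toFun p := ⟨⟨_, trial_mem_testSpace (b := b) (ε := ε) he hδ hs h0 p⟩,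
    robin_ofTube he (hasDerivAt_trialT ε hχ) (contDiff_trial hs p) (hasCompactSupport_trial h0 p)
      (tsupport_trial_subset_source he hδ h0 p) (by
        have h1 : χ₁ 0 = 0 := by simpa using hχ.abs₁_le_mul 0
        have h2 : √(ε ^ 8) = ε ^ 4 := by
          rw [show ε ^ 8 = (ε ^ 4) ^ 2 by ring, Real.sqrt_sq (by positivity)]
        rw [h2, trialT₁, trialT, h1]
        field_simp
        ring)⟩
  map_add' p q := by
    ext x
    simp only [ofTube, trialS, gaussFn, eval_add, Submodule.coe_add, Pi.add_apply, indicator]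
    split_ifs <;> ring
  map_smul' a p := by
    ext x
    simp only [ofTube, trialS, gaussFn, eval_smul, Submodule.coe_smul, Pi.smul_apply, indicator,
      smul_eq_mul, RingHom.id_apply]
    split_ifs <;> ring

theorem trialMap_apply (he : D.IsTubular c δ e) (hδ : 0 < δ) (hχ : IsCutoff δ K χ χ₁ χ₂)
    (hs : ContDiff ℝ ∞ χ) (h0 : ∀ x, δ / 2 ≤ |x| → χ x = 0) (hε : 0 < ε) (p : ℝ[X]) :
    (trialMap b he hδ hχ hs h0 hε p).1.1
      = ofTube e (fun z : ℝ × ℝ => trialS χ b p ε z.1 * trialT χ ε z.2) := rfl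

theorem ofTube_eq_zero {F : ℝ × ℝ → ℝ} {x : Plane} (hx : planeEquiv x ∉ e.target) :
    ofTube e F x = 0 :=
  indicator_of_notMem hx _

theorem jac_pos (he : D.IsTubular c δ e) (hκ : ∀ s, δ * |D.curvature c s| ≤ 1 / 2) {z : ℝ × ℝ}
    (hz : z ∈ e.source) : 0 < D.jac c z := by
  rw [he.source_eq] at hz
  have h1 : |z.2| ≤ δ := (abs_lt.2 hz.2).le
  have h2 : z.2 * D.curvature c z.1 ≤ δ * |D.curvature c z.1| := by
    refine (le_abs_self _).trans ?_
    rw [abs_mul]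
    exact mul_le_mul_of_nonneg_right h1 (abs_nonneg _)
  rw [jac]
  linarith [hκ z.1]

theorem integral_trialMap_sq (he : D.IsTubular c δ e) (hδ : 0 < δ) (hχ : IsCutoff δ K χ χ₁ χ₂)
    (hs : ContDiff ℝ ∞ χ) (h0 : ∀ x, δ / 2 ≤ |x| → χ x = 0) (hε : 0 < ε)
    (hκ : ∀ s, δ * |D.curvature c s| ≤ 1 / 2) (p : ℝ[X]) :
    ∫ x in D.Ω, (trialMap b he hδ hχ hs h0 hε p).1.1 x ^ 2
      = ∫ z in Ioo (-δ) δ ×ˢ Ioo 0 δ, normDensity χ b p ε (D.curvature c) z := by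
  rw [setIntegral_eq_tube he (fun z hz => (jac_pos he hκ hz).le)]
  · refine setIntegral_congr_fun (measurableSet_Ioo.prod measurableSet_Ioo) fun z hz => ?_
    simp only [trialMap_apply, ofTube_tubePoint he (box_subset_source he hz), normDensity, jac]
  · intro x hx
    rw [trialMap_apply, ofTube_eq_zero hx]
    simp

theorem integral_trialMap_energy (he : D.IsTubular c δ e) (hδ : 0 < δ)
    (hχ : IsCutoff δ K χ χ₁ χ₂) (hs : ContDiff ℝ ∞ χ) (h0 : ∀ x, δ / 2 ≤ |x| → χ x = 0)
    (hε : 0 < ε) (hκ : ∀ s, δ * |D.curvature c s| ≤ 1 / 2) (p : ℝ[X]) :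
    ∫ x in D.Ω, -(ε ^ 8) ^ 2 * ((trialMap b he hδ hχ hs h0 hε p).1.1 x
        * laplacian (trialMap b he hδ hχ hs h0 hε p).1.1 x)
      = ∫ z in Ioo (-δ) δ ×ˢ Ioo 0 δ,
          energyDensity χ χ₁ χ₂ b p ε (D.curvature c) (deriv (D.curvature c)) z := by
  rw [setIntegral_eq_tube he (fun z hz => (jac_pos he hκ hz).le)]
  · refine setIntegral_congr_fun (measurableSet_Ioo.prod measurableSet_Ioo) fun z hz => ?_
    have hz' := box_subset_source he hz
    have h1 := jac_mul_laplacian (trial_mem_testSpace (b := b) (ε := ε) he hδ hs h0 p).1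
      e.open_source (hasDerivAt_trialS b p ε hχ) (hasDerivAt_trialS₁ b p ε hχ)
      (hasDerivAt_trialT ε hχ) (hasDerivAt_trialT₁ ε hχ)
      (fun z hz => ofTube_tubePoint he hz) hz' (jac_pos he hκ hz').ne'
    simp only [trialMap_apply, ofTube_tubePoint he hz', energyDensity]
    simp only [jac] at h1 ⊢
    linear_combination (-(ε ^ 16) * (trialS χ b p ε z.1 * trialT χ ε z.2)) * h1
  · intro x hx
    rw [trialMap_apply, ofTube_eq_zero hx]
    simp

end TrialSpace

end SmoothDomain

end RobinPlane

end

theorem theorem6p1 (D : RobinPlane.SmoothDomain) (c₀ : Fin D.m)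
    (hA : D.UniqueNondegenerateMax c₀) (n : ℕ) :
    ∃ hn ∈ Set.Ioo (0 : ℝ) 1, ∃ Cn > (0 : ℝ), ∃ r : ℕ → ℝ → ℝ,
      ∀ j ∈ Set.Icc 1 n, ∀ h ∈ Set.Ioo (0 : ℝ) hn,
        RobinPlane.minMax (D.robinOperator h) j ≤
          ((-h - D.curvature c₀ 0 * h ^ (3 / 2 : ℝ)
            + (2 * (j : ℝ) - 1) * √(-iteratedDeriv 2 (D.curvature c₀) 0 / 2) * h ^ (7 / 4 : ℝ)
            + r j h : ℝ) : EReal) ∧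
        |r j h| ≤ Cn * h ^ (15 / 8 : ℝ) := by
  set b := √(-iteratedDeriv 2 (D.curvature c₀) 0 / 2) with hbdef
  have hb : 0 < b := Real.sqrt_pos.2 (by linarith [hA.nondegenerate])
  obtain ⟨K₁, hK₁, hpeak⟩ := hA.exists_isPeak
  -- the size of the tubular neighbourhood keeps the Jacobian `1 - t κ` between `1/2` and `3/2`
  have hρ : 0 < 1 / (2 * (K₁ + 1)) := by positivity
  obtain ⟨δ, hδ, hδρ, e, he⟩ := RobinPlane.SmoothDomain.exists_isTubular c₀ hρ (fun z hz => by
    have h1 : z.2 * D.curvature c₀ z.1 ≤ 1 / (2 * (K₁ + 1)) * (K₁ + 1) := by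
      refine (le_abs_self _).trans ?_
      rw [abs_mul]
      exact mul_le_mul hz.le ((hpeak.abs_le z.1).trans (by linarith)) (abs_nonneg _) hρ.le
    have h2 : 1 / (2 * (K₁ + 1)) * (K₁ + 1) = 1 / 2 := by field_simp
    have h3 : 0 < D.jac c₀ z := by
      rw [RobinPlane.SmoothDomain.jac]
      linarith
    exact h3.ne')
  have hδκ : ∀ s, δ * |D.curvature c₀ s| ≤ 1 / 2 := fun s => by
    have h2 : 1 / (2 * (K₁ + 1)) * (K₁ + 1) = 1 / 2 := by field_simp
    rw [← h2]
    exact mul_le_mul hδρ ((hpeak.abs_le s).trans (by linarith)) (abs_nonneg _) hρ.le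
  obtain ⟨K₂, χ, χ₁, χ₂, hK₂, hχ, hs, h0⟩ := RobinPlane.exists_cutoff hδ
  replace hpeak := hpeak.mono (K' := K₁ + K₂) (by linarith)
  replace hχ := hχ.mono (K' := K₁ + K₂) (by linarith)
  choose C hC ε₀ hε₀ hest using RobinPlane.exists_trial_estimate hb hχ hpeak hδκ
  obtain ⟨η, hη, hη0, hη1⟩ : ∃ η, (∀ j ∈ Finset.range n, η < ε₀ j) ∧ 0 < η ∧ η < 1 := by
    have h1 : ∀ᶠ η in 𝓝[>] (0 : ℝ), ∀ j ∈ Finset.range n, η < ε₀ j :=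
      (Filter.eventually_all_finset _).2 fun j _ =>
        mem_nhdsWithin_of_mem_nhds (Iio_mem_nhds (hε₀ j).1)
    obtain ⟨η, h2, h3⟩ := (h1.and (Ioo_mem_nhdsGT one_pos)).exists
    exact ⟨η, h2, h3.1, h3.2⟩
  refine ⟨η ^ 8, ⟨by positivity, pow_lt_one₀ hη0.le hη1 (by norm_num)⟩,
    1 + ∑ j ∈ Finset.range n, C j, ?_, fun j h => C (j - 1) * h ^ (15 / 8 : ℝ), ?_⟩
  · have : 0 ≤ ∑ j ∈ Finset.range n, C j := Finset.sum_nonneg fun j _ => hC j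
    linarith
  intro j hj h hh
  have hjr : j - 1 ∈ Finset.range n := Finset.mem_range.2 (by have := hj.1; have := hj.2; omega)
  -- everything is a power of `ε = h^{1/8}`
  obtain ⟨ε, hε, rfl⟩ : ∃ ε, 0 < ε ∧ h = ε ^ 8 := by
    refine ⟨h ^ (1 / 8 : ℝ), Real.rpow_pos_of_pos hh.1 _, ?_⟩
    rw [← Real.rpow_natCast, ← Real.rpow_mul hh.1.le]
    norm_num
  have hpow : ∀ (r : ℝ) (k : ℕ), 8 * r = k → (ε ^ 8) ^ r = ε ^ k := fun r k hk => by
    rw [← Real.rpow_natCast ε 8, ← Real.rpow_mul hε.le, ← Real.rpow_natCast ε k, ← hk]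
    norm_num
  have hεη : ε < η := lt_of_pow_lt_pow_left₀ 8 hη0.le hh.2
  have hεI : ε ∈ Ioo 0 (ε₀ (j - 1)) := ⟨hε, hεη.trans (hη _ hjr)⟩
  beta_reduce
  rw [hpow (3 / 2) 12 (by norm_num), hpow (7 / 4) 14 (by norm_num),
    hpow (15 / 8) 15 (by norm_num)]
  refine ⟨?_, ?_⟩
  · have hfin : Module.finrank ℝ (Polynomial.degreeLT ℝ j) = j := by
      rw [(Polynomial.degreeLTEquiv ℝ j).finrank_eq, Module.finrank_fin_fun]
    have : FiniteDimensional ℝ (Polynomial.degreeLT ℝ j) :=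
      Module.Finite.equiv (Polynomial.degreeLTEquiv ℝ j).symm
    have hdeg : ∀ p : Polynomial.degreeLT ℝ j, p.1.natDegree ≤ j - 1 := fun p => by
      rcases eq_or_ne p.1 0 with hp | hp
      · simp [hp]
      · have := (Polynomial.natDegree_lt_iff_degree_lt hp).2 (Polynomial.mem_degreeLT.1 p.2)
        omega
    have hj1 : ((j - 1 : ℕ) : ℝ) = j - 1 := by
      rw [Nat.cast_sub hj.1, Nat.cast_one]
    have hmain := RobinPlane.SmoothDomain.minMax_le_of_test (D := D) (h := ε ^ 8)
      (RobinPlane.SmoothDomain.trialMap b he hδ hχ hs h0 hε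
        ∘ₗ (Polynomial.degreeLT ℝ j).subtype)
      (-ε ^ 8 - D.curvature c₀ 0 * ε ^ 12 + (2 * (j - 1 : ℕ) + 1) * b * ε ^ 14
        + C (j - 1) * ε ^ 15) (fun p hp => ?_) (fun p => ?_)
    · rw [hfin] at hmain
      refine hmain.trans (le_of_eq ?_)
      rw [hj1]
      congr 1
      ring
    · have h1 := (hest (j - 1) ε hεI p.1 (hdeg p)).1 fun h => hp (Subtype.ext h)
      simp only [LinearMap.comp_apply, Submodule.subtype_apply]
      rwa [RobinPlane.SmoothDomain.integral_trialMap_sq he hδ hχ hs h0 hε hδκ]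
    · have h1 := (hest (j - 1) ε hεI p.1 (hdeg p)).2
      simp only [LinearMap.comp_apply, Submodule.subtype_apply]
      rwa [RobinPlane.SmoothDomain.integral_trialMap_sq he hδ hχ hs h0 hε hδκ,
        RobinPlane.SmoothDomain.integral_trialMap_energy he hδ hχ hs h0 hε hδκ]
  · have h1 : C (j - 1) ≤ ∑ j ∈ Finset.range n, C j :=
      Finset.single_le_sum (fun j _ => hC j) hjr
    rw [abs_of_nonneg (mul_nonneg (hC _) (by positivity))]
    gcongr
    linarith
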